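/- Let $\mathbb{F}$ be a finite field with $q$ elements, $C$ a geometrically irreducible smooth projective curve over $\mathbb{F}$ with function field $K$, $\infty$ a closed point of $C$, and $A=\mathcal{O}_C(C\setminus\{\infty\})$. Let $K_\infty$ be the completion of $K$ at $\infty$, $K_\infty^s$ a separable closure of $K_\infty$, $G_\infty=\operatorname{Gal}(K_\infty^s|K_\infty)$, and $\mathbb{C}_\infty$ the completion of $K_\infty^s$, to which the absolute value $|\cdot|$ of $K_\infty$ and the action of $G_\infty$ extend. Unlabelled tensor products are over $\mathbb{F}$. For $L\in\{K_\infty,\mathbb{C}_\infty\}$ let $L\langle A\rangle$ be the completion of $A\otimes L$ for the Gauss norm $\|x\|=\inf\max_i|\ell_i|$, the infimum being over all finite sums $x=\sum_i a_i\otimes\ell_i$. Let $\tau$ be the endomorphism $a\otimes c\mapsto a\otimes c^q$ of $A\otimes K$ and its continuous analogue on $L\langle A\rangle$; the group $G_\infty$ acts on $\mathbb{C}_\infty\langle A\rangle$ through $\mathbb{C}_\infty$. Let $\mathfrak{j}$ be the kernel of the multiplication map $A\otimes K\to K$. An $A$-motive over $K$ is a pair $\underline{M}=(M,\tau_M)$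 where $M$ is a finite locally free $A\otimes K$-module and $\tau_M$ is an isomorphism from $\tau^*M$ to $M$ over $\operatorname{Spec}(A\otimes K)\setminus V(\mathfrak{j})$. The ideal $\mathfrak{j}$ generates the unit ideal in $K_\infty\langle A\rangle$ and in $\mathbb{C}_\infty\langle A\rangle$, so that $\tau_M$ induces a $\tau$-semilinear map $f\mapsto\tau_M(\tau^*f)$ on $M\otimes_{A\otimes K}K_\infty\langle A\rangle$ and on $M\otimes_{A\otimes K}\mathbb{C}_\infty\langle A\rangle$; write $\operatorname{id}-\tau_M$ for the $A$-linear map $f\mapsto f-\tau_M(\tau^*f)$. Put $$M_B=\{\omega\in M\otimes_{A\otimes K}\mathbb{C}_\infty\langle A\rangle \mid \omega=\tau_M(\tau^*\omega)\},$$ an $A$-module with an action of $G_\infty$, and let $M_B^+$ be its submodule of elements fixed by $G_\infty$. The $A$-motive $\underline{M}$ is rigid analytically trivial if the multiplication map $M_B\otimes_A\mathbb{C}_\infty\langle A\rangle\to M\otimes_{A\otimes K}\mathbb{C}_\infty\langle A\rangle$ is bijective. **Theorem.** Let $\underline{M}$ be a rigid analytically trivial $A$-motive over $K$. Then there is an exact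 sequence of $A[G_\infty]$-modules $$0\longrightarrow M_B\longrightarrow M\otimes_{A\otimes K}\mathbb{C}_\infty\langle A\rangle\xrightarrow{\ \operatorname{id}-\tau_M\ }M\otimes_{A\otimes K}\mathbb{C}_\infty\langle A\rangle\longrightarrow 0,$$ where the first map is the inclusion. The action of $G_\infty$ on $M_B$ is continuous for the profinite topology on $G_\infty$ and the discrete topology on $M_B$. Moreover the sequence above induces an exact sequence of $A$-modules $$0\longrightarrow M_B^+\longrightarrow M\otimes_{A\otimes K}K_\infty\langle A\rangle\xrightarrow{\ \operatorname{id}-\tau_M\ }M\otimes_{A\otimes K}K_\infty\langle A\rangle\xrightarrow{\ \delta\ }\operatorname{H}^1(G_\infty,M_B)\longrightarrow 0,$$ where $\operatorname{H}^1(G_\infty,M_B)$ is continuous cohomology (continuous cocycles with values in the discrete module $M_B$ modulo coboundaries). Here the first map is compatible with the inclusion of $M_B$ in $M\otimes_{A\otimes K}\mathbb{C}_\infty\langle A\rangle$, and $\delta$ is the connecting homomorphism: for every $\xi\in M\otimes_{A\otimes K}\mathbb{C}_\infty\langle A\rangle$ such that $\xi-\tau_M(\tau^*\xi)$ is the image of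 $f$, the map $\sigma\mapsto{}^\sigma\xi-\xi$ is a continuous cocycle with values in $M_B$, and $\delta(f)$ is its class. -/

import Mathlib

open scoped WithZero TensorProduct NNReal

namespace AMot

noncomputable section

/-! ### Curves over a finite field, their points and the ring of functions regular away from a point

A geometrically irreducible smooth projective curve `C` over a finite field `F` is given by its
function field `K`, a function field of one variable over `F` in which `F` is algebraically closed.
The closed points of `C` are the normalised discrete valuations of `K` that are trivial on `F`, the
local ring at a point being its valuation ring. A rational function is regular on an open subset
iff it lies in the local rings of all closed points of that subset. -/

section Curve

variable (F K : Type*) [Field F] [Field K] [Algebra F K]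

/-- `K` is the function field of a geometrically irreducible smooth projective curve over the
finite (hence perfect) field `F`: it is a finite extension of `F(x)` for some `x` transcendental
over `F`, and `F` is algebraically closed in `K`. -/
structure IsCurveFunctionField : Prop where
  exists_transcendental : ∃ x : K, Transcendental F x ∧
    FiniteDimensional (IntermediateField.adjoin F {x}) K
  mem_range_of_isAlgebraic : ∀ x : K, IsAlgebraic F x → x ∈ Set.range (algebraMap F K)

/-- A closed point of the curve, as the normalised discrete valuation of `K`, trivial on `F`, that
it defines: `val f = exp (- ord f)`. -/
structure ClosedPoint where
  val : Valuation K ℤᵐ⁰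
  val_const : ∀ c : F, c ≠ 0 → val (algebraMap F K c) = 1
  surjective : Function.Surjective val

variable {F K}

/-- The functions on the curve that are regular away from the closed point `P`. -/
def ClosedPoint.ringAway (P : ClosedPoint F K) : Subalgebra F K where
  carrier := {f | ∀ Q : ClosedPoint F K, Q ≠ P → Q.val f ≤ 1}
  mul_mem' {f g} hf hg Q hQ := by
    rw [map_mul]; exact mul_le_one' (hf Q hQ) (hg Q hQ)
  add_mem' {f g} hf hg Q hQ := (Q.val.map_add f g).trans (max_le (hf Q hQ) (hg Q hQ))
  algebraMap_mem' c Q _ := by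
    rcases eq_or_ne c 0 with rfl | hc
    · simp
    · exact (Q.val_const c hc).le

/-- The ring `A` of functions on the curve that are regular away from the closed point `P`. -/
def CoordRing (P : ClosedPoint F K) : Type _ := P.ringAway

section CoordRing

variable (P : ClosedPoint F K)

instance : CommRing (CoordRing P) := inferInstanceAs (CommRing P.ringAway)

instance : Algebra F (CoordRing P) := inferInstanceAs (Algebra F P.ringAway)

instance : Algebra (CoordRing P) K := inferInstanceAs (Algebra P.ringAway K)

instance : IsScalarTower F (CoordRing P) K := inferInstanceAs (IsScalarTower F P.ringAway K)

end CoordRing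

variable [Fintype F]

lemma one_lt_card_nnreal (F : Type*) [Field F] [Fintype F] : (1 : ℝ≥0) < Fintype.card F := by
  exact_mod_cast Fintype.one_lt_card

/-- The absolute value `|f| = q ^ (- ord f)` of `K` attached to a closed point, `q` being the number
of elements of `F`. -/
def ClosedPoint.absVal (P : ClosedPoint F K) : AbsoluteValue K ℝ where
  toFun f := (WithZeroMulInt.toNNReal (one_lt_card_nnreal F).ne_zero (P.val f) : ℝ)
  map_mul' f g := by simp
  nonneg' f := NNReal.coe_nonneg _
  eq_zero' f := by simp
  add_le' f g := by
    have hm := (WithZeroMulInt.toNNReal_strictMono (one_lt_card_nnreal F)).monotone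
    rw [← NNReal.coe_add, NNReal.coe_le_coe]
    refine (hm (P.val.map_add f g)).trans ?_
    rw [hm.map_max]
    exact max_le_add_of_nonneg zero_le zero_le

lemma ClosedPoint.absVal_add_le_max (P : ClosedPoint F K) (f g : K) :
    P.absVal (f + g) ≤ max (P.absVal f) (P.absVal g) := by
  have hm := (WithZeroMulInt.toNNReal_strictMono (one_lt_card_nnreal F)).monotone
  have h := hm (P.val.map_add f g)
  rw [hm.map_max] at h
  exact_mod_cast h

/-- The local field `K_∞`: the completion of `K` at the closed point `∞`. -/
abbrev LocalField (P : ClosedPoint F K) : Type _ := P.absVal.Completion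

instance (P : ClosedPoint F K) : IsUltrametricDist (WithAbs P.absVal) :=
  IsUltrametricDist.isUltrametricDist_of_forall_norm_add_le_max_norm
    fun x y => P.absVal_add_le_max x.ofAbs y.ofAbs

instance (P : ClosedPoint F K) : IsUltrametricDist (LocalField P) :=
  IsUltrametricDist.isUltrametricDist_of_forall_norm_add_le_max_norm fun x y => by
    induction x, y using UniformSpace.Completion.induction_on₂ with
    | hp => exact isClosed_le (by fun_prop) (by fun_prop)
    | ih x y =>
      rw [← UniformSpace.Completion.coe_add]
      simp only [UniformSpace.Completion.norm_coe]
      exact IsUltrametricDist.norm_add_le_max x y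

instance (P : ClosedPoint F K) : NontriviallyNormedField (LocalField P) where
  non_trivial := by
    obtain ⟨f, hf⟩ := P.surjective (WithZero.exp 1)
    refine ⟨((WithAbs.toAbs P.absVal f : WithAbs P.absVal) : LocalField P), ?_⟩
    rw [UniformSpace.Completion.norm_coe]
    change (1 : ℝ) < (WithZeroMulInt.toNNReal (one_lt_card_nnreal F).ne_zero (P.val f) : ℝ)
    have h : (1 : ℤᵐ⁰) < WithZero.exp 1 := by decide
    have h' := WithZeroMulInt.toNNReal_strictMono (one_lt_card_nnreal F) h
    rw [map_one] at h'
    rw [hf]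
    exact_mod_cast h'

/-- A separable closure `K_∞^s` of `K_∞`. -/
abbrev LocalSep (P : ClosedPoint F K) : Type _ := SeparableClosure (LocalField P)

/-- `K_∞^s` carries the unique extension of the absolute value of `K_∞`. -/
instance (P : ClosedPoint F K) : NormedField (LocalSep P) :=
  spectralNorm.normedField (LocalField P) (LocalSep P)

instance (P : ClosedPoint F K) (R : Type*) [CommRing R] [Algebra R (LocalSep P)] :
    UniformContinuousConstSMul R (LocalSep P) where
  uniformContinuous_const_smul r := by
    simp_rw [Algebra.smul_def]
    exact (Ring.uniformContinuousConstSMul _).uniformContinuous_const_smul _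

/-- The field `ℂ_∞`: the completion of `K_∞^s`. -/
abbrev LocalComplex (P : ClosedPoint F K) : Type _ := UniformSpace.Completion (LocalSep P)

/-- The absolute Galois group `G_∞` of `K_∞`, with its Krull topology. -/
abbrev LocalGal (P : ClosedPoint F K) : Type _ := Gal(LocalSep P/LocalField P)

end Curve

/-! ### Tate algebras over `A` -/

section Tate

variable (F A : Type*) [Field F] [CommRing A] [Algebra F A]

/-- The ring `A ⊗ L` endowed with its Gauss norm. -/
def Gauss (L : Type*) [NormedField L] [Algebra F L] : Type _ := A ⊗[F] L

variable (L : Type*) [NormedField L] [Algebra F L]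

instance : CommRing (Gauss F A L) := inferInstanceAs (CommRing (A ⊗[F] L))

/-- The identification of `A ⊗ L` with its copy `Gauss F A L`. -/
def toGauss : A ⊗[F] L ≃+* Gauss F A L := RingEquiv.refl (A ⊗[F] L)

/-- The elements of `A ⊗ L` that can be written as finite sums `∑ a_i ⊗ ℓ_i` with all
`‖ℓ_i‖ ≤ r`. -/
def gaussBall (r : ℝ) : AddSubgroup (Gauss F A L) :=
  AddSubgroup.closure {x | ∃ (a : A) (ℓ : L), ‖ℓ‖ ≤ r ∧ x = toGauss F A L (a ⊗ₜ[F] ℓ)}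

variable {F A L}

lemma gaussBall_mono {r s : ℝ} (h : r ≤ s) : gaussBall F A L r ≤ gaussBall F A L s :=
  AddSubgroup.closure_mono fun _ ⟨a, ℓ, hℓ, hx⟩ => ⟨a, ℓ, hℓ.trans h, hx⟩

lemma gaussBall_mul {r s : ℝ} (hr : 0 ≤ r) {x y : Gauss F A L}
    (hx : x ∈ gaussBall F A L r) (hy : y ∈ gaussBall F A L s) :
    x * y ∈ gaussBall F A L (r * s) := by
  refine AddSubgroup.closure_induction ?_ ?_ ?_ ?_ hx
  · rintro _ ⟨a, ℓ, hℓ, rfl⟩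
    refine AddSubgroup.closure_induction ?_ ?_ ?_ ?_ hy
    · rintro _ ⟨b, m, hm, rfl⟩
      refine AddSubgroup.subset_closure ⟨a * b, ℓ * m, ?_, ?_⟩
      · rw [norm_mul]; exact mul_le_mul hℓ hm (norm_nonneg _) hr
      · rw [← map_mul, Algebra.TensorProduct.tmul_mul_tmul]
    · rw [mul_zero]; exact zero_mem _
    · intro u v _ _ hu hv; rw [mul_add]; exact add_mem hu hv
    · intro u _ hu; rw [mul_neg]; exact neg_mem hu
  · rw [zero_mul]; exact zero_mem _
  · intro u v _ _ hu hv; rw [add_mul]; exact add_mem hu hv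
  · intro u _ hu; rw [neg_mul]; exact neg_mem hu

lemma exists_mem_gaussBall (x : Gauss F A L) : ∃ r : ℝ, 0 ≤ r ∧ x ∈ gaussBall F A L r := by
  obtain ⟨x, rfl⟩ := (toGauss F A L).surjective x
  induction x using TensorProduct.induction_on with
  | zero => exact ⟨0, le_rfl, by rw [map_zero]; exact zero_mem _⟩
  | tmul a ℓ =>
    exact ⟨‖ℓ‖, norm_nonneg _, AddSubgroup.subset_closure ⟨a, ℓ, le_rfl, rfl⟩⟩
  | add u v hu hv =>
    obtain ⟨r, hr, hu⟩ := hu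
    obtain ⟨s, hs, hv⟩ := hv
    refine ⟨max r s, le_max_of_le_left hr, ?_⟩
    rw [map_add]
    exact add_mem (gaussBall_mono (le_max_left r s) hu) (gaussBall_mono (le_max_right r s) hv)

/-- The Gauss norm `inf max ‖ℓ_i‖`, the infimum being over all ways of writing an element of
`A ⊗ L` as a finite sum `∑ a_i ⊗ ℓ_i`. -/
def gaussNorm (x : Gauss F A L) : ℝ := sInf {r : ℝ | 0 ≤ r ∧ x ∈ gaussBall F A L r}

lemma gaussNorm_nonneg (x : Gauss F A L) : 0 ≤ gaussNorm x := Real.sInf_nonneg fun _ h => h.1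

lemma gaussNorm_le {x : Gauss F A L} {r : ℝ} (hr : 0 ≤ r) (hx : x ∈ gaussBall F A L r) :
    gaussNorm x ≤ r := csInf_le ⟨0, fun _ h => h.1⟩ ⟨hr, hx⟩

lemma mem_gaussBall_of_lt {x : Gauss F A L} {r : ℝ} (h : gaussNorm x < r) :
    x ∈ gaussBall F A L r := by
  obtain ⟨s, ⟨_, hs⟩, hsr⟩ := exists_lt_of_csInf_lt (exists_mem_gaussBall x) h
  exact gaussBall_mono hsr.le hs

lemma gaussNorm_add_le (x y : Gauss F A L) :
    gaussNorm (x + y) ≤ max (gaussNorm x) (gaussNorm y) := by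
  refine le_of_forall_gt_imp_ge_of_dense fun r hr => ?_
  obtain ⟨hx, hy⟩ := max_lt_iff.1 hr
  exact gaussNorm_le ((gaussNorm_nonneg x).trans hx.le)
    (add_mem (mem_gaussBall_of_lt hx) (mem_gaussBall_of_lt hy))

lemma gaussNorm_mul_le (x y : Gauss F A L) : gaussNorm (x * y) ≤ gaussNorm x * gaussNorm y := by
  refine le_mul_of_forall_lt₀ fun r hr s hs => ?_
  have hr' := (gaussNorm_nonneg x).trans hr.le
  exact gaussNorm_le (mul_nonneg hr' ((gaussNorm_nonneg y).trans hs.le))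
    (gaussBall_mul hr' (mem_gaussBall_of_lt hr) (mem_gaussBall_of_lt hs))

variable (F A L)

/-- The Gauss norm as a ring seminorm. -/
def gaussSeminorm : RingSeminorm (Gauss F A L) where
  toFun := gaussNorm
  map_zero' := le_antisymm (gaussNorm_le le_rfl (zero_mem _)) (gaussNorm_nonneg _)
  add_le' x y := (gaussNorm_add_le x y).trans
    (max_le_add_of_nonneg (gaussNorm_nonneg x) (gaussNorm_nonneg y))
  neg' x := by simp [gaussNorm]
  mul_le' := gaussNorm_mul_le

instance : SeminormedCommRing (Gauss F A L) :=
  { (gaussSeminorm F A L).toSeminormedRing with mul_comm := mul_comm }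

/-- The Tate algebra `L⟨A⟩`: the completion of `A ⊗ L` for the Gauss norm. -/
def Tate : Type _ := UniformSpace.Completion (Gauss F A L)

instance : NormedCommRing (Tate F A L) :=
  inferInstanceAs (NormedCommRing (UniformSpace.Completion (Gauss F A L)))

/-- The canonical homomorphism `A ⊗ L → L⟨A⟩`. -/
def toTate : A ⊗[F] L →+* Tate F A L :=
  (UniformSpace.Completion.coeRingHom :
    Gauss F A L →+* UniformSpace.Completion (Gauss F A L)).comp (toGauss F A L).toRingHom

variable {F L} {L' : Type*} [NormedField L'] [Algebra F L']

/-- The homomorphism `A ⊗ L → A ⊗ L'`, `a ⊗ ℓ ↦ a ⊗ φ ℓ`. -/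
def gaussMap (φ : L →ₐ[F] L') : Gauss F A L →+* Gauss F A L' :=
  ((toGauss F A L').toRingHom.comp
    (Algebra.TensorProduct.map (AlgHom.id F A) φ : A ⊗[F] L →ₐ[F] A ⊗[F] L').toRingHom).comp
    (toGauss F A L).symm.toRingHom

lemma gaussMap_toGauss (φ : L →ₐ[F] L') (x : A ⊗[F] L) :
    gaussMap A φ (toGauss F A L x) =
      toGauss F A L' (Algebra.TensorProduct.map (AlgHom.id F A) φ x) := rfl

lemma continuous_gaussMap (φ : L →ₐ[F] L') (hφ : Continuous φ) : Continuous (gaussMap A φ) := by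
  refine continuous_of_continuousAt_zero (gaussMap A φ) ?_
  rw [ContinuousAt, map_zero, Metric.tendsto_nhds_nhds]
  intro ε hε
  obtain ⟨δ, hδ, h⟩ := Metric.continuous_iff.1 hφ 0 (ε / 2) (half_pos hε)
  refine ⟨δ / 2, half_pos hδ, fun {x} hx => ?_⟩
  rw [dist_zero_right] at hx ⊢
  have hx' : x ∈ gaussBall F A L (δ / 2) := mem_gaussBall_of_lt hx
  refine lt_of_le_of_lt (gaussNorm_le (half_pos hε).le ?_) (half_lt_self hε)
  refine AddSubgroup.closure_induction ?_ ?_ ?_ ?_ hx'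
  · rintro _ ⟨a, ℓ, hℓ, rfl⟩
    refine AddSubgroup.subset_closure ⟨a, φ ℓ, ?_, ?_⟩
    · have := h ℓ (by rw [dist_zero_right]; exact hℓ.trans_lt (half_lt_self hδ))
      rw [map_zero, dist_zero_right] at this
      exact this.le
    · rw [gaussMap_toGauss, Algebra.TensorProduct.map_tmul, AlgHom.id_apply]
  · rw [map_zero]; exact zero_mem _
  · intro u v _ _ hu hv; rw [map_add]; exact add_mem hu hv
  · intro u _ hu; rw [map_neg]; exact neg_mem hu

/-- The continuous extension `L⟨A⟩ → L'⟨A⟩` of `a ⊗ ℓ ↦ a ⊗ φ ℓ`, for a continuous `φ`. -/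
def tateMap (φ : L →ₐ[F] L') (hφ : Continuous φ) : Tate F A L →+* Tate F A L' :=
  UniformSpace.Completion.mapRingHom (gaussMap A φ) (continuous_gaussMap A φ hφ)

lemma tateMap_toTate (φ : L →ₐ[F] L') (hφ : Continuous φ) (x : A ⊗[F] L) :
    tateMap A φ hφ (toTate F A L x) =
      toTate F A L' (Algebra.TensorProduct.map (AlgHom.id F A) φ x) :=
  UniformSpace.Completion.mapRingHom_coe (continuous_gaussMap A φ hφ) (toGauss F A L x)

lemma tateMap_comp {L'' : Type*} [NormedField L''] [Algebra F L''] (ψ : L' →ₐ[F] L'')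
    (hψ : Continuous ψ) (φ : L →ₐ[F] L') (hφ : Continuous φ) (h : Continuous (ψ.comp φ))
    (x : Tate F A L) :
    tateMap A ψ hψ (tateMap A φ hφ x) = tateMap A (ψ.comp φ) h x := by
  have h₁ := UniformSpace.Completion.mapRingHom_comp (continuous_gaussMap A ψ hψ)
    (continuous_gaussMap A φ hφ)
  have h₂ : (gaussMap A ψ).comp (gaussMap A φ) = gaussMap A (ψ.comp φ) := by
    refine RingHom.ext fun y => ?_
    obtain ⟨y, rfl⟩ := (toGauss F A L).surjective y
    rw [RingHom.comp_apply, gaussMap_toGauss, gaussMap_toGauss, gaussMap_toGauss,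
      ← AlgHom.comp_apply, ← Algebra.TensorProduct.map_comp, AlgHom.comp_id]
  simp only [h₂] at h₁
  exact congrArg (fun f => f x) h₁

lemma tateMap_id (h : Continuous (AlgHom.id F L)) (x : Tate F A L) :
    tateMap A (AlgHom.id F L) h x = x := by
  have h₁ : gaussMap A (AlgHom.id F L) = RingHom.id (Gauss F A L) := by
    refine RingHom.ext fun y => ?_
    obtain ⟨y, rfl⟩ := (toGauss F A L).surjective y
    rw [gaussMap_toGauss, Algebra.TensorProduct.map_id]
    rfl
  have h₂ := UniformSpace.Completion.mapRingHom_id (α := Gauss F A L)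
  simp only [← h₁] at h₂
  exact congrArg (fun f => f x) h₂

end Tate

/-! ### The ring of functions outside a closed subscheme -/

section Away

variable (B : Type*) [CommRing B] (J : Ideal B)

/-- The ring `B[J⁻¹]` of all `x` in the total ring of fractions of `B` such that `J ^ n x ⊆ B` for
some `n`. When `J` is an invertible ideal, this is the ring of functions on the affine open
subscheme `Spec B ∖ V(J)`. -/
def awayIdeal : Subalgebra B (FractionRing B) where
  carrier := {x | ∃ n : ℕ, ∀ b ∈ J ^ n, ∃ c : B,
    algebraMap B (FractionRing B) b * x = algebraMap B (FractionRing B) c}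
  mul_mem' := by
    rintro x y ⟨n, hx⟩ ⟨m, hy⟩
    refine ⟨n + m, fun b hb => ?_⟩
    rw [pow_add] at hb
    refine Submodule.mul_induction_on hb ?_ ?_
    · intro b₁ h₁ b₂ h₂
      obtain ⟨c₁, e₁⟩ := hx b₁ h₁
      obtain ⟨c₂, e₂⟩ := hy b₂ h₂
      exact ⟨c₁ * c₂, by rw [map_mul, map_mul, ← e₁, ← e₂]; ring⟩
    · rintro b₁ b₂ ⟨c₁, e₁⟩ ⟨c₂, e₂⟩
      exact ⟨c₁ + c₂, by rw [map_add, map_add, ← e₁, ← e₂]; ring⟩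
  add_mem' := by
    rintro x y ⟨n, hx⟩ ⟨m, hy⟩
    refine ⟨n + m, fun b hb => ?_⟩
    obtain ⟨c₁, e₁⟩ := hx b (Ideal.pow_le_pow_right (Nat.le_add_right n m) hb)
    obtain ⟨c₂, e₂⟩ := hy b (Ideal.pow_le_pow_right (Nat.le_add_left m n) hb)
    exact ⟨c₁ + c₂, by rw [map_add, ← e₁, ← e₂]; ring⟩
  algebraMap_mem' r := ⟨0, fun b _ => ⟨b * r, by rw [map_mul]⟩⟩

/-- A copy of `B[J⁻¹]`, regarded as a `B`-algebra through `B → B → B[J⁻¹]`, the first map being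
`τ`. For a `B`-module `M`, the `B[J⁻¹]`-module `AwayTwist B J τ ⊗[B] M` is the restriction of
`τ^* M` to `Spec B ∖ V(J)`. -/
def AwayTwist (_ : B →+* B) : Type _ := awayIdeal B J

variable {B J}

instance (τ : B →+* B) : CommRing (AwayTwist B J τ) := inferInstanceAs (CommRing (awayIdeal B J))

instance (τ : B →+* B) : Algebra (awayIdeal B J) (AwayTwist B J τ) :=
  inferInstanceAs (Algebra (awayIdeal B J) (awayIdeal B J))

instance (τ : B →+* B) : Algebra B (AwayTwist B J τ) :=
  ((algebraMap (awayIdeal B J) (AwayTwist B J τ)).comp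
    ((algebraMap B (awayIdeal B J)).comp τ)).toAlgebra

lemma AwayTwist.algebraMap_apply (τ : B →+* B) (b : B) :
    algebraMap B (AwayTwist B J τ) b =
      algebraMap (awayIdeal B J) (AwayTwist B J τ) (algebraMap B (awayIdeal B J) (τ b)) := rfl

instance (τ : B →+* B) : SMulCommClass B (awayIdeal B J) (AwayTwist B J τ) where
  smul_comm b x y := by
    simp only [Algebra.smul_def]
    ring

variable {S : Type*} [CommRing S] [Algebra B S]

lemma map_pow_eq_top (hJ : J.map (algebraMap B S) = ⊤) (n : ℕ) :
    (J ^ n).map (algebraMap B S) = ⊤ := by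
  rw [Ideal.map_pow, hJ, Ideal.top_pow]

lemma eq_zero_of_pow_mul (hJ : J.map (algebraMap B S) = ⊤) {n m : ℕ} {d : S}
    (h : ∀ b₁ ∈ J ^ n, ∀ b₂ ∈ J ^ m, algebraMap B S (b₁ * b₂) * d = 0) : d = 0 := by
  have h1 : (J ^ (n + m)).map (algebraMap B S) ≤
      LinearMap.ker (LinearMap.toSpanSingleton S S d) := by
    rw [Ideal.map_le_iff_le_comap, pow_add, Ideal.mul_le]
    intro b₁ hb₁ b₂ hb₂
    exact h b₁ hb₁ b₂ hb₂
  rw [map_pow_eq_top hJ, top_le_iff] at h1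
  have h2 : (1 : S) ∈ LinearMap.ker (LinearMap.toSpanSingleton S S d) := by
    rw [h1]; exact Submodule.mem_top
  simpa using h2

lemma exists_eval (hJ : J.map (algebraMap B S) = ⊤) (x : awayIdeal B J) :
    ∃ s : S, ∀ b c : B, algebraMap B (FractionRing B) b * x = algebraMap B (FractionRing B) c →
      algebraMap B S b * s = algebraMap B S c := by
  have hinj : Function.Injective (algebraMap B (FractionRing B)) :=
    IsFractionRing.injective B (FractionRing B)
  obtain ⟨x, n, hx⟩ := x
  let I : Ideal S :=
    { carrier := {t | ∃ s : S, ∀ b c : B,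
        algebraMap B (FractionRing B) b * x = algebraMap B (FractionRing B) c →
          algebraMap B S b * s = t * algebraMap B S c}
      add_mem' := by
        rintro t₁ t₂ ⟨s₁, h₁⟩ ⟨s₂, h₂⟩
        exact ⟨s₁ + s₂, fun b c h => by rw [mul_add, h₁ b c h, h₂ b c h, add_mul]⟩
      zero_mem' := ⟨0, fun b c _ => by simp⟩
      smul_mem' := by
        rintro r t ⟨s, h⟩
        exact ⟨r * s, fun b c e => by rw [mul_left_comm, h b c e, smul_eq_mul, mul_assoc]⟩ }
  have hI : (J ^ n).map (algebraMap B S) ≤ I := by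
    rw [Ideal.map_le_iff_le_comap]
    intro b₀ hb₀
    obtain ⟨c₀, hc₀⟩ := hx b₀ hb₀
    refine ⟨algebraMap B S c₀, fun b c h => ?_⟩
    rw [← map_mul, ← map_mul]
    congr 1
    apply hinj
    rw [map_mul, map_mul, ← hc₀, ← h]
    ring
  rw [map_pow_eq_top hJ, top_le_iff] at hI
  have h1 : (1 : S) ∈ I := by rw [hI]; exact Submodule.mem_top
  obtain ⟨s, hs⟩ := h1
  exact ⟨s, fun b c h => by rw [hs b c h, one_mul]⟩

/-- The value in `S` of an element of `B[J⁻¹]`, when `J` generates the unit ideal of `S`. -/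
def evalFun (hJ : J.map (algebraMap B S) = ⊤) (x : awayIdeal B J) : S := (exists_eval hJ x).choose

lemma evalFun_spec (hJ : J.map (algebraMap B S) = ⊤) (x : awayIdeal B J) {b c : B}
    (h : algebraMap B (FractionRing B) b * x = algebraMap B (FractionRing B) c) :
    algebraMap B S b * evalFun hJ x = algebraMap B S c := (exists_eval hJ x).choose_spec b c h

lemma evalFun_algebraMap (hJ : J.map (algebraMap B S) = ⊤) (b : B) :
    evalFun hJ (algebraMap B (awayIdeal B J) b) = algebraMap B S b := by
  have h := evalFun_spec (S := S) hJ (algebraMap B (awayIdeal B J) b) (b := 1) (c := b)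
    (by rw [map_one, one_mul]; rfl)
  rwa [map_one, one_mul] at h

/-- If `J` generates the unit ideal of the `B`-algebra `S`, the structure homomorphism `B → S`
extends (uniquely) to `B[J⁻¹] → S`. -/
def evalAway (hJ : J.map (algebraMap B S) = ⊤) : awayIdeal B J →ₐ[B] S where
  toFun := evalFun hJ
  map_one' := by rw [← map_one (algebraMap B (awayIdeal B J)), evalFun_algebraMap, map_one]
  map_zero' := by rw [← map_zero (algebraMap B (awayIdeal B J)), evalFun_algebraMap, map_zero]
  map_mul' := by
    intro x y
    obtain ⟨n, hx⟩ := x.2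
    obtain ⟨m, hy⟩ := y.2
    rw [← sub_eq_zero]
    refine eq_zero_of_pow_mul hJ (n := n) (m := m) fun b₁ h₁ b₂ h₂ => ?_
    obtain ⟨c₁, e₁⟩ := hx b₁ h₁
    obtain ⟨c₂, e₂⟩ := hy b₂ h₂
    have e : algebraMap B (FractionRing B) (b₁ * b₂) * (x * y : awayIdeal B J) =
        algebraMap B (FractionRing B) (c₁ * c₂) := by
      rw [map_mul, map_mul, ← e₁, ← e₂, Subalgebra.coe_mul]; ring
    rw [mul_sub, evalFun_spec hJ _ e, map_mul, map_mul, ← evalFun_spec hJ x e₁,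
      ← evalFun_spec hJ y e₂]
    ring
  map_add' := by
    intro x y
    obtain ⟨n, hx⟩ := x.2
    obtain ⟨m, hy⟩ := y.2
    rw [← sub_eq_zero]
    refine eq_zero_of_pow_mul hJ (n := n) (m := m) fun b₁ h₁ b₂ h₂ => ?_
    obtain ⟨c₁, e₁⟩ := hx b₁ h₁
    obtain ⟨c₂, e₂⟩ := hy b₂ h₂
    have e : algebraMap B (FractionRing B) (b₁ * b₂) * (x + y : awayIdeal B J) =
        algebraMap B (FractionRing B) (b₂ * c₁ + b₁ * c₂) := by
      rw [map_mul, map_add, map_mul, map_mul, ← e₁, ← e₂, Subalgebra.coe_add]; ring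
    rw [mul_sub, evalFun_spec hJ _ e, map_add, map_mul, map_mul, map_mul,
      ← evalFun_spec hJ x e₁, ← evalFun_spec hJ y e₂]
    ring
  commutes' := evalFun_algebraMap hJ

lemma evalAway_unique (hJ : J.map (algebraMap B S) = ⊤) (f : awayIdeal B J →ₐ[B] S)
    (x : awayIdeal B J) : f x = evalAway hJ x := by
  obtain ⟨n, hx⟩ := x.2
  rw [← sub_eq_zero]
  refine eq_zero_of_pow_mul hJ (n := n) (m := 0) fun b₁ h₁ b₂ _ => ?_
  obtain ⟨c, e⟩ := hx b₁ h₁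
  have key : ∀ g : awayIdeal B J →ₐ[B] S, algebraMap B S b₁ * g x = algebraMap B S c := by
    intro g
    rw [← g.commutes b₁, ← map_mul, ← g.commutes c]
    exact congrArg g (Subtype.ext e)
  rw [map_mul, mul_right_comm, mul_sub, key f, key (evalAway hJ), sub_self, zero_mul]

variable {M : Type*} [AddCommGroup M] [Module B M] {τ : B →+* B}

/-- The map `m ↦ f (τ^* m)` from `M` to `S ⊗ M` induced by a map `f` from `τ^* M` to `M` over
`Spec B ∖ V(J)`, when `J` generates the unit ideal of `S`. -/
def awayGen (hJ : J.map (algebraMap B S) = ⊤)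
    (f : AwayTwist B J τ ⊗[B] M →ₗ[awayIdeal B J] awayIdeal B J ⊗[B] M) : M →+ S ⊗[B] M :=
  (LinearMap.rTensor M (evalAway hJ).toLinearMap).toAddMonoidHom.comp
    (f.toAddMonoidHom.comp (TensorProduct.mk B (AwayTwist B J τ) M 1).toAddMonoidHom)

lemma awayGen_apply (hJ : J.map (algebraMap B S) = ⊤)
    (f : AwayTwist B J τ ⊗[B] M →ₗ[awayIdeal B J] awayIdeal B J ⊗[B] M) (m : M) :
    awayGen hJ f m = LinearMap.rTensor M (evalAway hJ).toLinearMap (f (1 ⊗ₜ m)) := rfl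

lemma awayGen_smul (hJ : J.map (algebraMap B S) = ⊤)
    (f : AwayTwist B J τ ⊗[B] M →ₗ[awayIdeal B J] awayIdeal B J ⊗[B] M) (b : B) (m : M) :
    awayGen hJ f (b • m) = algebraMap B S (τ b) • awayGen hJ f m := by
  have h : (1 : AwayTwist B J τ) ⊗ₜ[B] (b • m) =
      algebraMap B (awayIdeal B J) (τ b) • ((1 : AwayTwist B J τ) ⊗ₜ[B] m) := by
    rw [← TensorProduct.smul_tmul, TensorProduct.smul_tmul', Algebra.smul_def, Algebra.smul_def,
      AwayTwist.algebraMap_apply]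
  rw [awayGen_apply, awayGen_apply, h, map_smul, algebraMap_smul, map_smul, algebraMap_smul]

lemma rTensor_awayGen {S' : Type*} [CommRing S'] [Algebra B S']
    (hJ : J.map (algebraMap B S) = ⊤) (hJ' : J.map (algebraMap B S') = ⊤) (φ : S →ₐ[B] S')
    (f : AwayTwist B J τ ⊗[B] M →ₗ[awayIdeal B J] awayIdeal B J ⊗[B] M) (m : M) :
    LinearMap.rTensor M φ.toLinearMap (awayGen hJ f m) = awayGen hJ' f m := by
  have h : φ.comp (evalAway hJ) = evalAway hJ' := AlgHom.ext fun x => evalAway_unique hJ' _ x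
  rw [awayGen_apply, awayGen_apply, ← h, AlgHom.comp_toLinearMap, LinearMap.rTensor_comp]
  rfl

end Away

/-! ### `L⟨A⟩` as an algebra over `A ⊗ K` -/

section Scalars

variable {F A K L : Type*} [Field F] [CommRing A] [Algebra F A] [Field K] [Algebra F K]
  [NormedField L] [Algebra F L]

instance : Algebra A (Tate F A L) :=
  ((toTate F A L).comp Algebra.TensorProduct.includeLeftRingHom).toAlgebra

lemma algebraMap_tate_left (a : A) : algebraMap A (Tate F A L) a = toTate F A L (a ⊗ₜ 1) := rfl

lemma continuous_frobenius [Fintype F] : Continuous (FiniteField.frobeniusAlgHom F L) :=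
  continuous_pow (Fintype.card F)

variable (F A L) in
/-- The continuous extension `τ : L⟨A⟩ → L⟨A⟩` of `a ⊗ ℓ ↦ a ⊗ ℓ ^ q`. -/
def tateTau [Fintype F] : Tate F A L →+* Tate F A L :=
  tateMap A (FiniteField.frobeniusAlgHom F L) continuous_frobenius

variable (F A K) in
/-- The ring endomorphism `a ⊗ r ↦ a ⊗ r ^ q` of `A ⊗ K`. -/
def tau [Fintype F] : A ⊗[F] K →+* A ⊗[F] K :=
  (Algebra.TensorProduct.map (AlgHom.id F A) (FiniteField.frobeniusAlgHom F K)).toRingHom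

lemma tateTau_algebraMap_left [Fintype F] (a : A) :
    tateTau F A L (algebraMap A (Tate F A L) a) = algebraMap _ _ a := by
  rw [tateTau, algebraMap_tate_left, tateMap_toTate]
  simp

variable [Algebra K L] [IsScalarTower F K L]

instance : Algebra (A ⊗[F] K) (Tate F A L) :=
  ((toTate F A L).comp (Algebra.TensorProduct.map (AlgHom.id F A)
    (IsScalarTower.toAlgHom F K L)).toRingHom).toAlgebra

lemma algebraMap_tate (x : A ⊗[F] K) : algebraMap (A ⊗[F] K) (Tate F A L) x =
    toTate F A L (Algebra.TensorProduct.map (AlgHom.id F A) (IsScalarTower.toAlgHom F K L) x) := rfl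

instance : IsScalarTower A (A ⊗[F] K) (Tate F A L) := IsScalarTower.of_algebraMap_eq fun a => by
  rw [algebraMap_tate, algebraMap_tate_left, Algebra.TensorProduct.algebraMap_apply,
    Algebra.algebraMap_self_apply, Algebra.TensorProduct.map_tmul, map_one, AlgHom.id_apply]

lemma tateTau_algebraMap [Fintype F] (x : A ⊗[F] K) :
    tateTau F A L (algebraMap (A ⊗[F] K) (Tate F A L) x) = algebraMap _ _ (tau F A K x) := by
  rw [tateTau, algebraMap_tate, tateMap_toTate, algebraMap_tate, tau]
  congr 1
  induction x using TensorProduct.induction_on with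
  | zero => simp
  | tmul a r => simp
  | add x y hx hy => simp only [map_add, hx, hy]

section Shortcuts

variable (M : Type*) [AddCommGroup M] [Module (A ⊗[F] K) M]

instance : Module A (Tate F A L ⊗[A ⊗[F] K] M) := TensorProduct.leftModule

instance : Module (Tate F A L) (Tate F A L ⊗[A ⊗[F] K] M) := TensorProduct.leftModule

instance : IsScalarTower A (Tate F A L) (Tate F A L ⊗[A ⊗[F] K] M) :=
  TensorProduct.isScalarTower_left

end Shortcuts

variable {L' : Type*} [NormedField L'] [Algebra F L'] [Algebra K L'] [IsScalarTower F K L']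

lemma continuous_restrictScalars {φ : L →ₐ[K] L'} (hφ : Continuous φ) :
    Continuous (φ.restrictScalars F) := hφ

variable (F A) in
/-- The homomorphism `L⟨A⟩ → L'⟨A⟩` of `A ⊗ K`-algebras induced by a continuous homomorphism
`L → L'` of `K`-algebras. -/
def tateAlgHom (φ : L →ₐ[K] L') (hφ : Continuous φ) : Tate F A L →ₐ[A ⊗[F] K] Tate F A L' where
  toRingHom := tateMap A (φ.restrictScalars F) (continuous_restrictScalars hφ)
  commutes' x := by
    change tateMap A (φ.restrictScalars F) (continuous_restrictScalars hφ) _ = _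
    rw [algebraMap_tate, tateMap_toTate, algebraMap_tate]
    congr 1
    induction x using TensorProduct.induction_on with
    | zero => simp
    | tmul a r => simp
    | add x y hx hy => simp only [map_add, hx, hy]

lemma tateAlgHom_apply (φ : L →ₐ[K] L') (hφ : Continuous φ) (x : Tate F A L) :
    tateAlgHom F A φ hφ x = tateMap A (φ.restrictScalars F) (continuous_restrictScalars hφ) x := rfl

lemma tateAlgHom_tateTau [Fintype F] (φ : L →ₐ[K] L') (hφ : Continuous φ) (x : Tate F A L) :
    tateAlgHom F A φ hφ (tateTau F A L x) = tateTau F A L' (tateAlgHom F A φ hφ x) := by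
  rw [tateAlgHom_apply, tateAlgHom_apply, tateTau, tateTau, tateMap_comp, tateMap_comp]
  have h : (φ.restrictScalars F).comp (FiniteField.frobeniusAlgHom F L) =
      (FiniteField.frobeniusAlgHom F L').comp (φ.restrictScalars F) := by
    ext ℓ; simp
  · simp only [h]
  · exact continuous_frobenius.comp (continuous_restrictScalars (F := F) hφ)
  · exact (continuous_restrictScalars (F := F) hφ).comp (continuous_frobenius (F := F))

lemma tateAlgHom_comp {L'' : Type*} [NormedField L''] [Algebra F L''] [Algebra K L'']
    [IsScalarTower F K L''] (ψ : L' →ₐ[K] L'') (hψ : Continuous ψ) (φ : L →ₐ[K] L')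
    (hφ : Continuous φ) (h : Continuous (ψ.comp φ)) :
    (tateAlgHom F A ψ hψ).comp (tateAlgHom F A φ hφ) = tateAlgHom F A (ψ.comp φ) h :=
  AlgHom.ext fun x => tateMap_comp A (ψ.restrictScalars F) (continuous_restrictScalars hψ)
    (φ.restrictScalars F) (continuous_restrictScalars hφ) (continuous_restrictScalars h) x

lemma tateAlgHom_id (h : Continuous (AlgHom.id K L)) :
    tateAlgHom F A (AlgHom.id K L) h = AlgHom.id _ _ :=
  AlgHom.ext fun x => tateMap_id A (continuous_restrictScalars h) x

variable (F A) in
/-- The map `L⟨A⟩ ⊗ M → L'⟨A⟩ ⊗ M` induced by a continuous homomorphism `L → L'` of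
`K`-algebras. -/
def moduleMap (M : Type*) [AddCommGroup M] [Module (A ⊗[F] K) M] (φ : L →ₐ[K] L')
    (hφ : Continuous φ) :
    Tate F A L ⊗[A ⊗[F] K] M →ₗ[A] Tate F A L' ⊗[A ⊗[F] K] M :=
  (LinearMap.rTensor M (tateAlgHom F A φ hφ).toLinearMap).restrictScalars A

variable {M : Type*} [AddCommGroup M] [Module (A ⊗[F] K) M]

lemma moduleMap_tmul (φ : L →ₐ[K] L') (hφ : Continuous φ) (s : Tate F A L) (m : M) :
    moduleMap F A M φ hφ (s ⊗ₜ m) = tateAlgHom F A φ hφ s ⊗ₜ m := rfl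

lemma moduleMap_comp {L'' : Type*} [NormedField L''] [Algebra F L''] [Algebra K L'']
    [IsScalarTower F K L''] (ψ : L' →ₐ[K] L'') (hψ : Continuous ψ) (φ : L →ₐ[K] L')
    (hφ : Continuous φ) (h : Continuous (ψ.comp φ)) (x : Tate F A L ⊗[A ⊗[F] K] M) :
    moduleMap F A M ψ hψ (moduleMap F A M φ hφ x) = moduleMap F A M (ψ.comp φ) h x := by
  induction x using TensorProduct.induction_on with
  | zero => simp only [map_zero]
  | tmul s m =>
    rw [moduleMap_tmul, moduleMap_tmul, moduleMap_tmul, ← tateAlgHom_comp ψ hψ φ hφ h]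
    rfl
  | add x y hx hy => simp only [map_add, hx, hy]

lemma moduleMap_id (h : Continuous (AlgHom.id K L)) (x : Tate F A L ⊗[A ⊗[F] K] M) :
    moduleMap F A M (AlgHom.id K L) h x = x := by
  induction x using TensorProduct.induction_on with
  | zero => simp only [map_zero]
  | tmul s m => rw [moduleMap_tmul, tateAlgHom_id h]; rfl
  | add x y hx hy => simp only [map_add, hx, hy]

lemma moduleMap_smul (φ : L →ₐ[K] L') (hφ : Continuous φ) (s : Tate F A L)
    (x : Tate F A L ⊗[A ⊗[F] K] M) :
    moduleMap F A M φ hφ (s • x) = tateAlgHom F A φ hφ s • moduleMap F A M φ hφ x := by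
  induction x using TensorProduct.induction_on with
  | zero => simp
  | tmul t m =>
    rw [TensorProduct.smul_tmul', moduleMap_tmul, moduleMap_tmul, TensorProduct.smul_tmul',
      smul_eq_mul, map_mul, smul_eq_mul]
  | add x y hx hy => rw [smul_add, map_add, map_add, hx, hy, smul_add]

end Scalars

/-! ### `A`-motives -/

section Motive

variable (F A K : Type*) [Field F] [CommRing A] [Algebra F A] [Field K] [Algebra F K]
  [Algebra A K] [IsScalarTower F A K]

/-- The ideal `𝔧` of `A ⊗ K`: the kernel of the multiplication map `A ⊗ K → K`. -/
def jIdeal : Ideal (A ⊗[F] K) :=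
  RingHom.ker (Algebra.TensorProduct.productMap (IsScalarTower.toAlgHom F A K) (AlgHom.id F K))

/-- The ideal `𝔧` generates the unit ideal of `L⟨A⟩`. -/
def JInvertible (L : Type*) [NormedField L] [Algebra F L] [Algebra K L] [IsScalarTower F K L] :
    Prop :=
  (jIdeal F A K).map (algebraMap (A ⊗[F] K) (Tate F A L)) = ⊤

/-- An `A`-motive over `K` with underlying `A ⊗ K`-module `M`: `M` is finite locally free, and it is
endowed with an isomorphism from `τ^* M` to `M` over `Spec (A ⊗ K) ∖ V(𝔧)`. -/
structure AMotive [Fintype F] (M : Type*) [AddCommGroup M] [Module (A ⊗[F] K) M] where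
  finite : Module.Finite (A ⊗[F] K) M
  projective : Module.Projective (A ⊗[F] K) M
  frob : AwayTwist (A ⊗[F] K) (jIdeal F A K) (tau F A K) ⊗[A ⊗[F] K] M
    ≃ₗ[awayIdeal (A ⊗[F] K) (jIdeal F A K)]
      awayIdeal (A ⊗[F] K) (jIdeal F A K) ⊗[A ⊗[F] K] M

variable {F A K}

namespace AMotive

variable [Fintype F] {M : Type*} [AddCommGroup M] [Module (A ⊗[F] K) M] (𝔐 : AMotive F A K M)
  {L : Type*} [NormedField L] [Algebra F L] [Algebra K L] [IsScalarTower F K L]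

/-- The map `m ↦ τ_M (τ^* m)` from `M` to `L⟨A⟩ ⊗ M`. -/
def frobGen (hL : JInvertible F A K L) : M →+ Tate F A L ⊗[A ⊗[F] K] M :=
  awayGen hL 𝔐.frob.toLinearMap

lemma frobGen_smul (hL : JInvertible F A K L) (b : A ⊗[F] K) (m : M) :
    𝔐.frobGen hL (b • m) =
      algebraMap (A ⊗[F] K) (Tate F A L) (tau F A K b) • 𝔐.frobGen hL m :=
  awayGen_smul hL _ b m

/-- The map `f ↦ τ_M (τ^* f)` on `L⟨A⟩ ⊗ M`, for `L⟨A⟩` in which `𝔧` generates the unit ideal; it is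
given by `s ⊗ m ↦ τ(s) τ_M (τ^* m)`. -/
def frobTate (hL : JInvertible F A K L) :
    Tate F A L ⊗[A ⊗[F] K] M →ₗ[A] Tate F A L ⊗[A ⊗[F] K] M where
  toFun := TensorProduct.liftAddHom
    (((smulAddHom (Tate F A L) (Tate F A L ⊗[A ⊗[F] K] M)).comp
      (tateTau F A L).toAddMonoidHom).compl₂ (𝔐.frobGen hL)) (by
      intro b s m
      change tateTau F A L (b • s) • 𝔐.frobGen hL m = tateTau F A L s • 𝔐.frobGen hL (b • m)
      rw [frobGen_smul, Algebra.smul_def, map_mul, tateTau_algebraMap, smul_smul, mul_comm])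
  map_add' := map_add _
  map_smul' a x := by
    induction x using TensorProduct.induction_on with
    | zero => simp
    | tmul s m =>
      change tateTau F A L (a • s) • 𝔐.frobGen hL m = a • tateTau F A L s • 𝔐.frobGen hL m
      rw [Algebra.smul_def, map_mul, tateTau_algebraMap_left, mul_smul, algebraMap_smul]
    | add x y hx hy => rw [smul_add, map_add, map_add, hx, hy, smul_add]

lemma frobTate_tmul (hL : JInvertible F A K L) (s : Tate F A L) (m : M) :
    𝔐.frobTate hL (s ⊗ₜ m) = tateTau F A L s • 𝔐.frobGen hL m := rfl

variable {L' : Type*} [NormedField L'] [Algebra F L'] [Algebra K L'] [IsScalarTower F K L']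

lemma moduleMap_frobGen (hL : JInvertible F A K L) (hL' : JInvertible F A K L') (φ : L →ₐ[K] L')
    (hφ : Continuous φ) (m : M) : moduleMap F A M φ hφ (𝔐.frobGen hL m) = 𝔐.frobGen hL' m :=
  rTensor_awayGen hL hL' (tateAlgHom F A φ hφ) _ m

lemma moduleMap_frobTate (hL : JInvertible F A K L) (hL' : JInvertible F A K L') (φ : L →ₐ[K] L')
    (hφ : Continuous φ) (x : Tate F A L ⊗[A ⊗[F] K] M) :
    moduleMap F A M φ hφ (𝔐.frobTate hL x) = 𝔐.frobTate hL' (moduleMap F A M φ hφ x) := by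
  induction x using TensorProduct.induction_on with
  | zero => simp
  | tmul s m =>
    rw [frobTate_tmul, moduleMap_smul, moduleMap_tmul, frobTate_tmul, tateAlgHom_tateTau,
      moduleMap_frobGen 𝔐 hL hL']
  | add x y hx hy => simp only [map_add, hx, hy]

end AMotive

end Motive

/-! ### Continuous cohomology in degree one -/

section Cohomology

variable {A G V : Type*} [CommRing A] [Group G] [TopologicalSpace G] [AddCommGroup V] [Module A V]
  (ρ : Representation A G V)

/-- Continuous `1`-cocycles with values in the discrete module `V`. -/
def contCocycles : Submodule A (G → V) where
  carrier := {c | IsLocallyConstant c ∧ ∀ σ σ' : G, c (σ * σ') = c σ + ρ σ (c σ')}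
  add_mem' := by
    rintro c d ⟨hc, hc'⟩ ⟨hd, hd'⟩
    refine ⟨hc.add hd, fun σ σ' => ?_⟩
    simp only [Pi.add_apply, hc', hd', map_add]
    abel
  zero_mem' := ⟨IsLocallyConstant.const 0, fun σ σ' => by simp⟩
  smul_mem' := by
    rintro a c ⟨hc, hc'⟩
    refine ⟨hc.comp (a • ·), fun σ σ' => ?_⟩
    simp only [Pi.smul_apply, hc', map_smul, smul_add]

/-- The map sending `v` to the coboundary `σ ↦ σ v - v`. -/
def coboundary : V →ₗ[A] G → V := LinearMap.pi fun σ => ρ σ - LinearMap.id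

/-- The first continuous cohomology group `H¹(G, V)` of the discrete `G`-module `V`: continuous
cocycles modulo coboundaries. -/
def ContH1 : Type _ :=
  contCocycles ρ ⧸ (LinearMap.range (coboundary ρ)).comap (contCocycles ρ).subtype

instance : AddCommGroup (ContH1 ρ) :=
  inferInstanceAs (AddCommGroup
    (contCocycles ρ ⧸ (LinearMap.range (coboundary ρ)).comap (contCocycles ρ).subtype))

instance : Module A (ContH1 ρ) :=
  inferInstanceAs (Module A
    (contCocycles ρ ⧸ (LinearMap.range (coboundary ρ)).comap (contCocycles ρ).subtype))

/-- The class in `H¹(G, V)` of a continuous cocycle. -/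
def ContH1.mk : contCocycles ρ →ₗ[A] ContH1 ρ :=
  Submodule.mkQ ((LinearMap.range (coboundary ρ)).comap (contCocycles ρ).subtype)

variable {ρ} in
/-- The class `h` in `H¹(G, V)` is the class of `c`, a continuous cocycle. -/
def ContH1.IsClassOf (h : ContH1 ρ) (c : G → V) : Prop :=
  ∃ hc : c ∈ contCocycles ρ, h = ContH1.mk ρ ⟨c, hc⟩

end Cohomology

/-! ### The Betti realization -/

section Betti

variable {F K : Type*} [Field F] [Fintype F] [Field K] [Algebra F K] (P : ClosedPoint F K)

instance : IsScalarTower F K (LocalField P) := inferInstance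

instance : IsScalarTower K (LocalField P) (LocalSep P) := inferInstance

instance : IsScalarTower F K (LocalSep P) := by
  refine IsScalarTower.of_algebraMap_eq (R := F) (S := K) (A := LocalSep P) fun x => ?_
  rw [IsScalarTower.algebraMap_apply F (LocalField P) (LocalSep P),
    IsScalarTower.algebraMap_apply K (LocalField P) (LocalSep P),
    ← IsScalarTower.algebraMap_apply F K (LocalField P)]

instance : IsScalarTower K (LocalField P) (LocalComplex P) := inferInstance

instance : IsScalarTower F K (LocalComplex P) := inferInstance

lemma continuous_gal (σ : LocalGal P) : Continuous (σ : LocalSep P →+* LocalSep P) := by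
  refine (AddMonoidHomClass.isometry_of_norm (σ : LocalSep P →+* LocalSep P) fun x => ?_).continuous
  exact (spectralNorm_eq_of_equiv σ x).symm

/-- The continuous extension to `ℂ_∞` of an element of `G_∞`. -/
def galComplex (σ : LocalGal P) : LocalComplex P →ₐ[K] LocalComplex P where
  toRingHom := UniformSpace.Completion.mapRingHom (σ : LocalSep P →+* LocalSep P)
    (continuous_gal P σ)
  commutes' x := by
    refine (UniformSpace.Completion.mapRingHom_coe (continuous_gal P σ)
      (algebraMap (LocalField P) (LocalSep P) (algebraMap K (LocalField P) x))).trans ?_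
    exact congrArg _ (σ.commutes (algebraMap K (LocalField P) x))

lemma continuous_galComplex (σ : LocalGal P) : Continuous (galComplex P σ) :=
  UniformSpace.Completion.continuous_map

lemma galComplex_one : galComplex P 1 = AlgHom.id K (LocalComplex P) :=
  AlgHom.ext fun x => congrArg (fun f => f x)
    (UniformSpace.Completion.mapRingHom_id (α := LocalSep P))

lemma galComplex_mul (σ σ' : LocalGal P) :
    galComplex P (σ * σ') = (galComplex P σ).comp (galComplex P σ') :=
  AlgHom.ext fun x => (congrArg (fun f => f x) (UniformSpace.Completion.mapRingHom_comp
    (continuous_gal P σ) (continuous_gal P σ'))).symm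

variable (M : Type*) [AddCommGroup M] [Module ((CoordRing P) ⊗[F] K) M]

/-- The module `M ⊗ K_∞⟨A⟩`. -/
def LocalMod : Type _ := Tate F (CoordRing P) (LocalField P) ⊗[(CoordRing P) ⊗[F] K] M

instance : AddCommGroup (LocalMod P M) := inferInstanceAs
  (AddCommGroup (Tate F (CoordRing P) (LocalField P) ⊗[(CoordRing P) ⊗[F] K] M))

instance : Module (CoordRing P) (LocalMod P M) := inferInstanceAs
  (Module (CoordRing P) (Tate F (CoordRing P) (LocalField P) ⊗[(CoordRing P) ⊗[F] K] M))

/-- The module `M ⊗ ℂ_∞⟨A⟩`. -/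
def ComplexMod : Type _ := Tate F (CoordRing P) (LocalComplex P) ⊗[(CoordRing P) ⊗[F] K] M

instance : AddCommGroup (ComplexMod P M) := inferInstanceAs
  (AddCommGroup (Tate F (CoordRing P) (LocalComplex P) ⊗[(CoordRing P) ⊗[F] K] M))

instance : Module (CoordRing P) (ComplexMod P M) := inferInstanceAs
  (Module (CoordRing P) (Tate F (CoordRing P) (LocalComplex P) ⊗[(CoordRing P) ⊗[F] K] M))

instance : Module (Tate F (CoordRing P) (LocalComplex P)) (ComplexMod P M) := inferInstanceAs
  (Module (Tate F (CoordRing P) (LocalComplex P))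
    (Tate F (CoordRing P) (LocalComplex P) ⊗[(CoordRing P) ⊗[F] K] M))

instance : IsScalarTower (CoordRing P) (Tate F (CoordRing P) (LocalComplex P)) (ComplexMod P M) :=
  inferInstanceAs (IsScalarTower (CoordRing P) (Tate F (CoordRing P) (LocalComplex P))
    (Tate F (CoordRing P) (LocalComplex P) ⊗[(CoordRing P) ⊗[F] K] M))

/-- The action of `G_∞` on `ℂ_∞⟨A⟩ ⊗ M` through the first factor. -/
def galRep : Representation (CoordRing P) (LocalGal P) (ComplexMod P M) where
  toFun σ := moduleMap F (CoordRing P) M (galComplex P σ) (continuous_galComplex P σ)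
  map_one' := LinearMap.ext fun x => by
    simp only [galComplex_one]
    exact moduleMap_id _ x
  map_mul' σ σ' := LinearMap.ext fun x => by
    simp only [galComplex_mul]
    exact (moduleMap_comp _ (continuous_galComplex P σ) _ (continuous_galComplex P σ') _ x).symm

lemma continuous_localField : Continuous
    (IsScalarTower.toAlgHom K (LocalField P) (LocalComplex P)) := by
  refine (AddMonoidHomClass.isometry_of_norm
    (IsScalarTower.toAlgHom K (LocalField P) (LocalComplex P)) fun x => ?_).continuous
  exact (UniformSpace.Completion.norm_coe (algebraMap (LocalField P) (LocalSep P) x)).trans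
    (spectralNorm_extends x)

/-- The canonical map `K_∞⟨A⟩ ⊗ M → ℂ_∞⟨A⟩ ⊗ M`. -/
def localToComplex : LocalMod P M →ₗ[CoordRing P] ComplexMod P M :=
  moduleMap F (CoordRing P) M (IsScalarTower.toAlgHom K (LocalField P) (LocalComplex P))
    (continuous_localField P)

namespace AMotive

variable {P M} (𝔐 : AMotive F (CoordRing P) K M)
  (hC : JInvertible F (CoordRing P) K (LocalComplex P))

/-- The map `f ↦ τ_M (τ^* f)` on `M ⊗ K_∞⟨A⟩`. -/
def frobLocal (hL : JInvertible F (CoordRing P) K (LocalField P)) :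
    LocalMod P M →ₗ[CoordRing P] LocalMod P M := 𝔐.frobTate hL

/-- The map `f ↦ τ_M (τ^* f)` on `M ⊗ ℂ_∞⟨A⟩`. -/
def frobComplex : ComplexMod P M →ₗ[CoordRing P] ComplexMod P M := 𝔐.frobTate hC

/-- The map `id - τ_M` on `M ⊗ K_∞⟨A⟩`. -/
def idSubFrobLocal (hL : JInvertible F (CoordRing P) K (LocalField P)) :
    LocalMod P M →ₗ[CoordRing P] LocalMod P M := LinearMap.id - 𝔐.frobLocal hL

/-- The map `id - τ_M` on `M ⊗ ℂ_∞⟨A⟩`. -/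
def idSubFrobComplex : ComplexMod P M →ₗ[CoordRing P] ComplexMod P M :=
  LinearMap.id - 𝔐.frobComplex hC

/-- The Betti realization `M_B` of an `A`-motive: the `ω` in `M ⊗ ℂ_∞⟨A⟩` with `ω = τ_M (τ^* ω)`. -/
def betti : Submodule (CoordRing P) (ComplexMod P M) :=
  LinearMap.eqLocus LinearMap.id (𝔐.frobComplex hC)

lemma mem_betti {ω : ComplexMod P M} : ω ∈ 𝔐.betti hC ↔ ω = 𝔐.frobComplex hC ω := Iff.rfl

lemma galRep_mem_betti (σ : LocalGal P)
    (ω : ComplexMod P M) (h : ω ∈ 𝔐.betti hC) :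
    galRep P M σ ω ∈ 𝔐.betti hC := by
  rw [mem_betti] at h ⊢
  conv_lhs => rw [h]
  exact 𝔐.moduleMap_frobTate hC hC (galComplex P σ) (continuous_galComplex P σ) ω

/-- The action of `G_∞` on the Betti realization. -/
def bettiRep : Representation (CoordRing P) (LocalGal P) (𝔐.betti hC) where
  toFun σ := (galRep P M σ).restrict (𝔐.galRep_mem_betti hC σ)
  map_one' := LinearMap.ext fun ω => Subtype.ext <| by
    change galRep P M 1 ω = ω
    rw [map_one]; rfl
  map_mul' σ σ' := LinearMap.ext fun ω => Subtype.ext <| by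
    change galRep P M (σ * σ') ω = galRep P M σ (galRep P M σ' ω)
    rw [map_mul]; rfl

/-- An `A`-motive is rigid analytically trivial if the multiplication map
`ℂ_∞⟨A⟩ ⊗_A M_B → ℂ_∞⟨A⟩ ⊗ M` is bijective. -/
def IsRigidAnalyticallyTrivial : Prop :=
  Function.Bijective (LinearMap.liftBaseChange (Tate F (CoordRing P) (LocalComplex P))
    (𝔐.betti hC).subtype)

end AMotive

end Betti

end

end AMot

namespace AMot

/-! ### Function fields in one variable: linear relations and values of polynomials -/

section FunctionField

open scoped IntermediateField
open Polynomial

/-! Everything comes from Galois descent between `M ⊗ K_∞⟨A⟩` and `M ⊗ ℂ_∞⟨A⟩`, combined with the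
contracting behaviour of `τ_M` near `0`. Descent cannot be applied to arbitrary invariant elements:
in characteristic `p` the invariants of `G_∞` in `ℂ_∞` form the completed perfect closure of `K_∞`,
which is larger than `K_∞`. It does apply to elements of finite level, those in the `E`-span of `M ⊗
K_∞⟨A⟩` for some finite Galois `E/K_∞` (`mem_of_mem_levelSpan_of_forall_map_eq`).

The Frobenius equation supplies the finite level. Let `ξ` have an open stabiliser, with `ξ - τ_M ξ =
f` defined over `K_∞`. Start from an element `n₀` of finite level close to `ξ` and iterate `n ↦ f +
τ_M n`. The iterates stay at one level, and `ξ - n_k = τ_M^k (ξ - n₀)` tends to `0`, since `τ_M`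
raises norms to the power `q` up to a constant. The trace criterion
`mem_levelSpan_of_levelTrace_mem` and the closedness of `M ⊗ K_∞⟨A⟩` then show that `ξ` has finite
level (`exists_mem_complexLevel`). The stabiliser is open as soon as all `σξ - ξ` lie in `M_B`: they
are small for `σ` close to `1`, whereas `M_B` is discrete (`exists_level_galRep_eq`). The case `f =
0` gives the continuity of the action on `M_B`.

Surjectivity of `id - τ_M` over `ℂ_∞` reduces by rigid analytic triviality to `id - τ` on `ℂ_∞⟨A⟩`.
There, elements of norm `< 1` are handled by a geometric series, and the remaining element of `A ⊗
K_∞^s` by Artin–Schreier equations (`exists_sub_tateTau_eq`).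

The long exact sequence is then the usual one. Exactness at its middle terms is descent for
solutions of `ξ - τ_M ξ = f`. For surjectivity of `δ`, a trace-one element of a finite level turns a
continuous cocycle into the coboundary of an explicit `ξ` of finite level, and `ξ - τ_M ξ` descends
to `K_∞` (`connecting_surjective`).

That `𝔧` becomes the unit ideal requires some `a ∈ A` with `|a| > 1`. Such a function is produced by
a Riemann-type dimension count (`exists_mem_ringAway_one_lt_val`); then `a ⊗ 1 - 1 ⊗ a` is a unit.
-/

lemma IsCurveFunctionField.trdeg_eq_one {F K : Type*} [Field F] [Field K] [Algebra F K]
    (hK : IsCurveFunctionField F K) : Algebra.trdeg F K = 1 := by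
  obtain ⟨x, hx, hfin⟩ := hK.exists_transcendental
  have h : IsTranscendenceBasis F (fun _ : Unit => x) := by
    rw [isTranscendenceBasis_iff_algebraicIndependent_isAlgebraic]
    refine ⟨algebraicIndependent_unique_type_iff.2 hx, ?_⟩
    rw [Set.range_const]
    open scoped IntermediateField.algebraAdjoinAdjoin in
    exact (IsFractionRing.comap_isAlgebraic_iff (A := Algebra.adjoin F {x}) (K := F⟮x⟯) (C := K)).2
      inferInstance
  simpa using h.lift_cardinalMk_eq_trdeg.symm

/-- In transcendence degree one, `t` is already a transcendence basis, so `K/F(t)` is algebraic;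
being also essentially of finite type, it is finite. -/
lemma IsCurveFunctionField.finiteDimensional_adjoin {F K : Type*} [Field F] [Field K] [Algebra F K]
    (hK : IsCurveFunctionField F K) {t : K} (ht : Transcendental F t) :
    FiniteDimensional F⟮t⟯ K := by
  have h1 : IsTranscendenceBasis F (fun _ : Unit => t) :=
    (algebraicIndependent_unique_type_iff.2 ht).isTranscendenceBasis_of_lift_trdeg_le_of_finite
      (by simp [hK.trdeg_eq_one])
  have h4 : Algebra.IsAlgebraic F⟮t⟯ K := by
    have h := h1.isAlgebraic_field
    rwa [Set.range_const] at h
  obtain ⟨x, hx, hfin⟩ := hK.exists_transcendental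
  have h2 : Algebra.EssFiniteType F K :=
    have : Algebra.EssFiniteType F F⟮x⟯ :=
      IntermediateField.essFiniteType_iff.2
        (IntermediateField.fg_adjoin_of_finite (Set.finite_singleton x))
    Algebra.EssFiniteType.comp F F⟮x⟯ K
  have h3 : Algebra.EssFiniteType F⟮t⟯ K := .of_comp F _ _
  exact Algebra.finite_of_essFiniteType_of_isAlgebraic

/-- As long as every coefficient vanishes at `0`, the relation can be divided by `t`. The degree of
a fixed nonzero coefficient drops each time, so this stops. -/
lemma exists_coeff_zero_ne_zero_of_relation {F K ι : Type*} [Field F] [Field K] [Algebra F K]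
    [Fintype ι] {t : K} (ht : t ≠ 0) (v : ι → K) (N : ℕ) (c : ι → F[X])
    (hc : ∑ i, aeval t (c i) * v i = 0) (hN : ∃ i, c i ≠ 0 ∧ (c i).natDegree ≤ N) :
    ∃ c : ι → F[X], ∑ i, aeval t (c i) * v i = 0 ∧ ∃ i, (c i).coeff 0 ≠ 0 := by
  induction N generalizing c with
  | zero =>
    obtain ⟨i, hi, hd⟩ := hN
    refine ⟨c, hc, i, fun h => hi ?_⟩
    rw [Polynomial.eq_C_of_natDegree_le_zero hd, h, C_0]
  | succ N ih =>
    by_cases h0 : ∃ i, (c i).coeff 0 ≠ 0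
    · exact ⟨c, hc, h0⟩
    push Not at h0
    have hX : ∀ i, c i = (c i).divX * X := fun i => by
      conv_lhs => rw [← divX_mul_X_add (c i), h0 i, C_0, add_zero]
    refine ih (fun i => (c i).divX) ?_ ?_
    · refine (mul_eq_zero.1 (?_ : t * _ = 0)).resolve_left ht
      rw [Finset.mul_sum, ← hc]
      refine Finset.sum_congr rfl fun i _ => ?_
      conv_rhs => rw [hX i, map_mul, aeval_X]
      ring
    · obtain ⟨i, hi, hd⟩ := hN
      refine ⟨i, fun h => hi (by rw [hX i, h, zero_mul]), ?_⟩
      rw [natDegree_divX_eq_natDegree_tsub_one]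
      omega

/-- More than `[K : F(t)]` elements of `K` satisfy a relation with coefficients in `F[t]`, not all
of which vanish at `t = 0`. -/
lemma exists_relation {F K ι : Type*} [Field F] [Field K] [Algebra F K] [Fintype ι] {t : K}
    (ht : t ≠ 0) [FiniteDimensional F⟮t⟯ K] (v : ι → K)
    (hn : Module.finrank F⟮t⟯ K < Fintype.card ι) :
    ∃ c : ι → F[X], ∑ i, aeval t (c i) * v i = 0 ∧ ∃ i, (c i).coeff 0 ≠ 0 := by
  classical
  obtain ⟨g, hg, i, hi⟩ : ∃ g : ι → F⟮t⟯, ∑ j, g j • v j = 0 ∧ ∃ i, g i ≠ 0 := by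
    by_contra! h
    exact hn.not_ge (Fintype.linearIndependent_iff.2 h).fintype_card_le_finrank
  choose r s hrs using fun j => (IntermediateField.mem_adjoin_simple_iff F _).1 (g j).2
  -- The presentation `g j = r / s` allows a denominator vanishing at `t`, in which case `g j = 0`;
  -- such a fraction is replaced by `0 / 1`.
  let s' : ι → F[X] := fun j => if aeval t (s j) = 0 then 1 else s j
  let r' : ι → F[X] := fun j => if aeval t (s j) = 0 then 0 else r j
  have hs' : ∀ j, aeval t (s' j) ≠ 0 := fun j => by
    by_cases h : aeval t (s j) = 0 <;> simp [s', h]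
  have hr' : ∀ j, (g j : K) * aeval t (s' j) = aeval t (r' j) := fun j => by
    rw [hrs j]
    by_cases h : aeval t (s j) = 0 <;> simp [s', r', h]
  have hval : ∀ j, aeval t (r' j * ∏ k ∈ Finset.univ.erase j, s' k) =
      (∏ k, aeval t (s' k)) * (g j : K) := fun j => by
    rw [map_mul, ← hr', map_prod, ← Finset.mul_prod_erase _ _ (Finset.mem_univ j)]
    ring
  refine exists_coeff_zero_ne_zero_of_relation ht v _
    (fun j => r' j * ∏ k ∈ Finset.univ.erase j, s' k) ?_ ⟨i, ?_, le_rfl⟩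
  · simp_rw [hval, mul_assoc, ← Finset.mul_sum]
    rw [mul_eq_zero]
    exact Or.inr (by simpa [Algebra.smul_def] using hg)
  · intro h
    have := hval i
    rw [h, map_zero, eq_comm, mul_eq_zero] at this
    rcases this with h | h
    · exact Finset.prod_ne_zero_iff.2 (fun k _ => hs' k) h
    · exact hi (by exact_mod_cast h)

namespace ClosedPoint

variable {F K : Type*} [Field F] [Field K] [Algebra F K] (Q : ClosedPoint F K)

lemma val_algebraMap_le_one (c : F) : Q.val (algebraMap F K c) ≤ 1 := by
  rcases eq_or_ne c 0 with rfl | hc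
  · simp
  · exact (Q.val_const c hc).le

lemma val_aeval_le_one {t : K} (ht : Q.val t ≤ 1) (c : F[X]) : Q.val (aeval t c) ≤ 1 := by
  induction c using Polynomial.induction_on' with
  | add p q hp hq => rw [map_add]; exact (Q.val.map_add _ _).trans (max_le hp hq)
  | monomial n a =>
    rw [aeval_monomial, map_mul, map_pow]
    exact mul_le_one' (Q.val_algebraMap_le_one a) (pow_le_one' ht n)

lemma val_aeval_le {t : K} (ht : Q.val t ≤ 1) {c : F[X]} (hc : c.coeff 0 = 0) :
    Q.val (aeval t c) ≤ Q.val t := by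
  rw [← divX_mul_X_add c, hc, C_0, add_zero, map_mul, aeval_X, map_mul]
  exact mul_le_of_le_one_left' (Q.val_aeval_le_one ht _)

/-- The constant term is a unit and strictly dominates the rest, which is divisible by `t`. Together
with `val_aeval_le`, this makes the relations of `exists_relation` usable modulo `t`. -/
lemma val_aeval_eq_one {t : K} (ht : Q.val t < 1) {c : F[X]} (hc : c.coeff 0 ≠ 0) :
    Q.val (aeval t c) = 1 := by
  rw [← divX_mul_X_add c, map_add, aeval_C, ← Q.val_const _ hc]
  refine Q.val.map_add_eq_of_lt_right ?_
  rw [Q.val_const _ hc, map_mul, aeval_X, map_mul]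
  exact (mul_le_of_le_one_left' (Q.val_aeval_le_one ht.le _)).trans_lt ht

lemma transcendental_of_one_lt_val (hK : IsCurveFunctionField F K) {x : K} (hx : 1 < Q.val x) :
    Transcendental F x := fun h => by
  obtain ⟨c, rfl⟩ := hK.mem_range_of_isAlgebraic x h
  exact hx.not_ge (Q.val_algebraMap_le_one c)

end ClosedPoint

/-! ### Valuation rings containing the constants, and existence of poles -/

section

variable {F K : Type*} [Field F] [Field K] [Algebra F K]
open IsDedekindDomain
variable (O : ValuationSubring K)

/-- A valuation subring of `K` containing the constants takes only finitely many values between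
the value of a given nonzero nonunit and `1`. -/
lemma finite_values (hK : IsCurveFunctionField F K) (hO : ∀ c : F, algebraMap F K c ∈ O) {t : K}
    (ht0 : t ≠ 0) (ht : O.valuation t < 1) :
    {γ : O.ValueGroup | O.valuation t ≤ γ ∧ γ < 1}.Finite := by
  classical
  have hconst : ∀ c : F, c ≠ 0 → O.valuation (algebraMap F K c) = 1 := fun c hc => by
    refine le_antisymm ((O.valuation_le_one_iff _).2 (hO c)) ?_
    have h := (O.valuation_le_one_iff _).2 (hO c⁻¹)
    rw [map_inv₀, map_inv₀] at h
    exact (inv_le_one₀ (by simpa [zero_lt_iff] using hc)).1 h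
  have htr : Transcendental F t := fun h => by
    obtain ⟨c, rfl⟩ := hK.mem_range_of_isAlgebraic t h
    refine ht.ne (hconst c ?_)
    rintro rfl
    simp at ht0
  have := hK.finiteDimensional_adjoin htr
  have hle : ∀ c : F[X], O.valuation (aeval t c) ≤ 1 := fun c => by
    rw [O.valuation_le_one_iff]
    induction c using Polynomial.induction_on' with
    | add p q hp hq => rw [map_add]; exact add_mem hp hq
    | monomial n a =>
      rw [aeval_monomial]
      exact mul_mem (hO a) (pow_mem ((O.valuation_le_one_iff _).1 ht.le) n)
  have hle' : ∀ c : F[X], c.coeff 0 = 0 → O.valuation (aeval t c) ≤ O.valuation t := fun c hc => by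
    rw [← divX_mul_X_add c, hc, C_0, add_zero, map_mul, aeval_X, map_mul]
    exact mul_le_of_le_one_left' (hle _)
  have heq : ∀ c : F[X], c.coeff 0 ≠ 0 → O.valuation (aeval t c) = 1 := fun c hc => by
    rw [← divX_mul_X_add c, map_add, aeval_C, ← hconst _ hc]
    refine O.valuation.map_add_eq_of_lt_right ?_
    rw [hconst _ hc, map_mul, aeval_X, map_mul]
    exact (mul_le_of_le_one_left' (hle _)).trans_lt ht
  by_contra hinf
  obtain ⟨S, hS, hcard⟩ := Set.Infinite.exists_subset_card_eq hinf (Module.finrank F⟮t⟯ K + 1)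
  choose v hv using fun γ : S => O.valuation_surjective γ.1
  obtain ⟨c, hc, i₀, hi₀⟩ := exists_relation (F := F) ht0 v (by rw [Fintype.card_coe, hcard]; omega)
  -- Among the terms whose coefficient has nonzero constant term, the one of largest value strictly
  -- dominates the whole relation: if `c j` vanishes at `0`, its term has value at most `v(t) v(v j)
  -- < v(t) ≤ v(v i)`.
  obtain ⟨i, hi, hmax⟩ := Finset.exists_max_image
    (Finset.univ.filter fun i : S => (c i).coeff 0 ≠ 0) (fun i => i.1) ⟨i₀, by simpa using hi₀⟩
  rw [Finset.mem_filter_univ] at hi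
  rw [← Finset.add_sum_erase _ _ (Finset.mem_univ i), add_eq_zero_iff_eq_neg] at hc
  have h1 := congrArg O.valuation hc
  rw [Valuation.map_neg, map_mul, heq _ hi, one_mul, hv] at h1
  have hpos : ∀ j : S, (0 : O.ValueGroup) < j.1 := fun j =>
    lt_of_lt_of_le (by simpa [zero_lt_iff] using ht0) (hS j.2).1
  refine h1.symm.not_lt (O.valuation.map_sum_lt (hpos i).ne' fun j hj => ?_)
  rw [map_mul, hv]
  by_cases h0 : (c j).coeff 0 = 0
  · calc _ ≤ O.valuation t * j.1 := mul_le_mul_left (hle' _ h0) _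
      _ < O.valuation t * 1 := by
        exact mul_lt_mul_of_pos_left (hS j.2).2 (by simpa [zero_lt_iff] using ht0)
      _ ≤ i.1 := by rw [mul_one]; exact (hS i.2).1
  · rw [heq _ h0, one_mul]
    exact lt_of_le_of_ne (hmax j (by simpa using h0))
      fun h => (Finset.ne_of_mem_erase hj) (Subtype.ext h)

/-- By `finite_values` there is a largest value below `1` among those at least `v(t)`; an element
`π` with this value is a uniformiser. -/
lemma isDiscreteValuationRing_of_const_mem (hK : IsCurveFunctionField F K)
    (hO : ∀ c : F, algebraMap F K c ∈ O) {t : K} (ht0 : t ≠ 0) (ht : O.valuation t < 1) :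
    IsDiscreteValuationRing O := by
  obtain ⟨γ, ⟨hγt, hγ⟩, hmax⟩ := (finite_values O hK hO ht0 ht).exists_maximal ⟨_, le_rfl, ht⟩
  obtain ⟨π, rfl⟩ := O.valuation_surjective γ
  have hpos : ∀ {x : K}, x ≠ 0 → 0 < O.valuation x := fun hx => by simpa [zero_lt_iff] using hx
  have hπ0 : π ≠ 0 := fun h => by
    rw [h, map_zero] at hγt
    exact (hpos ht0).not_ge hγt
  have htop : ∀ x : K, O.valuation π < O.valuation x → O.valuation x ≤ 1 → O.valuation x = 1 := by
    intro x h1 h2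
    by_contra h
    exact (hmax ⟨hγt.trans h1.le, lt_of_le_of_ne h2 h⟩ h1.le).not_gt h1
  let p : O := ⟨π, (O.valuation_le_one_iff _).1 hγ.le⟩
  refine IsDiscreteValuationRing.ofHasUnitMulPowIrreducibleFactorization ⟨p, ?_, fun {x} hx => ?_⟩
  · refine irreducible_iff.2 ⟨fun h => hγ.ne ((O.valuation_eq_one_iff p).1 h), fun a b hab => ?_⟩
    by_contra! h
    rw [O.valuation_eq_one_iff, O.valuation_eq_one_iff] at h
    have hab' : π = a * b := congrArg Subtype.val hab
    refine h.1 (htop a ?_ ((O.valuation_le_one_iff _).2 a.2))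
    rw [hab', map_mul]
    refine mul_lt_of_lt_one_right (hpos ?_) (lt_of_le_of_ne ((O.valuation_le_one_iff _).2 b.2) h.2)
    rintro h0
    rw [h0, zero_mul] at hab'
    exact hπ0 hab'
  · have hx' : (x : K) ≠ 0 := by exact_mod_cast hx
    -- If all powers of `π` divided `x`, the values `v(π) ^ (n + 1)` would be infinitely many
    -- between `v(x)` and `1`.
    have hex : ∃ n : ℕ, ¬ p ^ n ∣ x := by
      by_contra! h
      have hle : ∀ n : ℕ, O.valuation x ≤ O.valuation π ^ n := fun n => by
        obtain ⟨y, hy⟩ := h n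
        rw [hy]
        change O.valuation (π ^ n * y) ≤ _
        rw [map_mul, map_pow]
        exact mul_le_of_le_one_right' ((O.valuation_le_one_iff _).2 y.2)
      refine Set.not_infinite.2 (finite_values O hK hO hx' ((hle 1).trans_lt (by rwa [pow_one])))
        (Set.infinite_of_injective_forall_mem (f := fun n : ℕ => O.valuation π ^ (n + 1))
          (fun a b hab => Nat.succ_injective
            ((pow_right_strictAnti₀ (hpos hπ0) hγ).injective hab)) fun n =>
          ⟨hle (n + 1), pow_lt_one₀ zero_le hγ (Nat.succ_ne_zero n)⟩)
    classical
    obtain ⟨n, hn⟩ : ∃ n, Nat.find hex = n + 1 := Nat.exists_eq_succ_of_ne_zero fun h0 => by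
      have := Nat.find_spec hex
      rw [h0, pow_zero] at this
      exact this (one_dvd x)
    have h1 : ¬ p ^ (n + 1) ∣ x := hn ▸ Nat.find_spec hex
    obtain ⟨u, hu⟩ : p ^ n ∣ x := not_not.1 (Nat.find_min hex (hn ▸ Nat.lt_succ_self n))
    refine ⟨n, (associated_mul_unit_right (p ^ n) u ?_).trans (by rw [hu])⟩
    rw [O.valuation_eq_one_iff]
    refine htop u (not_le.1 fun hle => h1 ?_) ((O.valuation_le_one_iff _).2 u.2)
    have hq : u.1 / π ∈ O := by
      rw [← O.valuation_le_one_iff, map_div₀]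
      exact (div_le_one₀ (hpos hπ0)).2 hle
    refine ⟨⟨u.1 / π, hq⟩, ?_⟩
    rw [hu, pow_succ, mul_assoc]
    congr 1
    exact Subtype.ext (mul_div_cancel₀ u.1 hπ0).symm

/-- Every non-constant rational function has a pole. -/
lemma exists_one_lt_val (hK : IsCurveFunctionField F K) {f : K}
    (hf : f ∉ Set.range (algebraMap F K)) : ∃ Q : ClosedPoint F K, 1 < Q.val f := by
  -- The valuation rings containing `F` intersect in the integral closure of `F`, which consists of
  -- constants since `F` is algebraically closed in `K`.
  obtain ⟨O, hO, hfO⟩ : ∃ O : ValuationSubring K, (∀ c : F, algebraMap F K c ∈ O) ∧ f ∉ O := by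
    by_contra! h
    have h1 : f ∈ ⨅ V : {V : ValuationSubring K // Set.range (algebraMap F K) ⊆ V.toSubring},
        V.1.toSubring := Subring.mem_iInf.2 fun V => h V.1 fun c => V.2 ⟨c, rfl⟩
    rw [iInf_valuationSubring_superset] at h1
    have h2 : IsIntegral (Subring.closure (Set.range (algebraMap F K))) f := h1
    have h3 : Subring.closure (Set.range (algebraMap F K)) = (algebraMap F K).range := by
      rw [← RingHom.coe_range, Subring.closure_eq]
    rw [h3] at h2
    refine hf (hK.mem_range_of_isAlgebraic f (IsIntegral.isAlgebraic ?_))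
    obtain ⟨p, hp, hpf⟩ := h2
    obtain ⟨p', rfl, -, hp'⟩ :=
      lifts_and_natDegree_eq_and_monic (f := (algebraMap F K).rangeRestrict)
      ((lifts_iff_coeff_lifts p).2 fun n => (algebraMap F K).rangeRestrict_surjective _) hp
    refine ⟨p', hp', ?_⟩
    rwa [eval₂_map] at hpf
  have hf0 : f ≠ 0 := fun h => hf ⟨0, by rw [h, map_zero]⟩
  have hf1 : O.valuation f⁻¹ < 1 := by
    rw [map_inv₀]
    exact inv_lt_one_of_one_lt₀ (not_le.1 fun h => hfO ((O.valuation_le_one_iff _).1 h))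
  have := isDiscreteValuationRing_of_const_mem O hK hO (inv_ne_zero hf0) hf1
  let v := (IsDiscreteValuationRing.maximalIdeal O).valuation K
  have hv : ∀ x : O, v x ≤ 1 := HeightOneSpectrum.valuation_le_one _
  refine ⟨⟨v, fun c hc => le_antisymm (hv ⟨_, hO c⟩) ?_,
    HeightOneSpectrum.valuation_surjective K _⟩, ?_⟩
  · have h := hv ⟨_, hO c⁻¹⟩
    simp only [map_inv₀] at h
    exact (inv_le_one₀ (by simpa [zero_lt_iff] using hc)).1 h
  · have h : v f⁻¹ < 1 := (HeightOneSpectrum.valuation_lt_one_iff_mem (K := K)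
      (IsDiscreteValuationRing.maximalIdeal O) ⟨f⁻¹, (O.valuation_le_one_iff _).1 hf1.le⟩).2
      ((O.valuation_lt_one_iff _).2 hf1)
    rw [map_inv₀] at h
    exact (inv_lt_one₀ (by simpa [zero_lt_iff] using hf0)).1 h

end

/-! ### Separating points, weak approximation, and finiteness of the set of poles -/

namespace ClosedPoint

section

variable {F K : Type*} [Field F] [Field K] [Algebra F K]

/-- The open unit ball determines the units, hence the valuation up to its value on a uniformiser;
surjectivity onto `ℤᵐ⁰` fixes that value. -/
lemma eq_of_val_lt_one_iff {P Q : ClosedPoint F K} (h : ∀ x, P.val x < 1 ↔ Q.val x < 1) :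
    P = Q := by
  have h1 : ∀ x, P.val x = 1 → Q.val x = 1 := fun x hx => by
    have hx0 : x ≠ 0 := fun h0 => by simp [h0] at hx
    refine le_antisymm ?_ (not_lt.1 fun hlt => ((h x).2 hlt).ne hx)
    refine not_lt.1 fun hlt => ((h x⁻¹).2 ?_).ne (by rw [map_inv₀, hx, inv_one])
    rw [map_inv₀]
    exact inv_lt_one_of_one_lt₀ hlt
  obtain ⟨π, hπ⟩ := P.surjective (WithZero.exp (-1))
  have hπ0 : π ≠ 0 := fun h0 => by
    rw [h0, map_zero] at hπ
    exact WithZero.exp_ne_zero hπ.symm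
  have key : ∀ (x : K) (k : ℤ), P.val x = WithZero.exp k → Q.val x = Q.val π ^ (-k) := by
    intro x k hx
    have h2 := h1 (x * π ^ k) (by
      rw [map_mul, hx, map_zpow₀, hπ, ← WithZero.exp_zsmul, ← WithZero.exp_add]; simp)
    rw [map_mul, map_zpow₀] at h2
    rw [zpow_neg]
    exact eq_inv_of_mul_eq_one_left h2
  have hexp : ∀ {R : ClosedPoint F K} {x : K}, x ≠ 0 → ∃ k : ℤ, R.val x = WithZero.exp k :=
    fun {R x} hx => ⟨_, (WithZero.exp_log ((Valuation.ne_zero_iff _).2 hx)).symm⟩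
  have hQπ : Q.val π = WithZero.exp (-1) := by
    obtain ⟨j, hj⟩ := hexp (R := Q) hπ0
    obtain ⟨x, hx⟩ := Q.surjective (WithZero.exp (-1))
    have hx0 : x ≠ 0 := fun h0 => by
      rw [h0, map_zero] at hx
      exact WithZero.exp_ne_zero hx.symm
    obtain ⟨k, hk⟩ := hexp (R := P) hx0
    have h2 := key x k hk
    rw [hx, hj, ← WithZero.exp_zsmul, WithZero.exp_inj] at h2
    have h3 : Q.val π < 1 := (h π).1 (by rw [hπ]; decide)
    rw [hj, ← WithZero.exp_zero, WithZero.exp_lt_exp] at h3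
    rw [hj, WithZero.exp_inj]
    -- A `Q`-uniformiser `x` with `P.val x = exp k` gives `j * k = 1`; since `j < 0`, this leaves `j
    -- = -1`.
    have h4 : j ∣ 1 := ⟨k, by simp at h2; linarith⟩
    rcases Int.isUnit_iff.1 (isUnit_of_dvd_one h4) with h | h <;> omega
  obtain ⟨v, hv, hv'⟩ := P
  obtain ⟨w, hw, hw'⟩ := Q
  congr
  ext x
  rcases eq_or_ne x 0 with rfl | hx
  · simp
  obtain ⟨k, hk⟩ := hexp (R := ⟨v, hv, hv'⟩) hx
  have := key x k hk
  simp only at hk this hQπ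
  rw [hk, this, hQπ, ← WithZero.exp_zsmul]
  simp

variable [Fintype F]

lemma absVal_lt_one_iff (P : ClosedPoint F K) (x : K) : P.absVal x < 1 ↔ P.val x < 1 := by
  have h := (WithZeroMulInt.toNNReal_strictMono (one_lt_card_nnreal F)).lt_iff_lt
    (a := P.val x) (b := 1)
  rw [map_one] at h
  rw [← h]
  exact NNReal.coe_lt_one

lemma one_lt_absVal_iff (P : ClosedPoint F K) (x : K) : 1 < P.absVal x ↔ 1 < P.val x := by
  have h := (WithZeroMulInt.toNNReal_strictMono (one_lt_card_nnreal F)).lt_iff_lt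
    (a := 1) (b := P.val x)
  rw [map_one] at h
  rw [← h]
  exact NNReal.one_lt_coe

/-- Weak approximation. -/
lemma exists_one_lt_val_lt_one {ι : Type*} [Finite ι] {Q : ι → ClosedPoint F K}
    (hQ : Function.Injective Q) (i : ι) :
    ∃ e : K, 1 < (Q i).val e ∧ ∀ j ≠ i, (Q j).val e < 1 := by
  have hnt : ∀ i, ((Q i).absVal).IsNontrivial := fun i => by
    obtain ⟨x, hx⟩ := (Q i).surjective (WithZero.exp 1)
    have h1 : 1 < (Q i).absVal x := by rw [one_lt_absVal_iff, hx]; decide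
    refine ⟨x, fun h => ?_, h1.ne'⟩
    rw [h, map_zero] at h1
    exact absurd h1 (by norm_num)
  have hne : Pairwise fun i j => ¬((Q i).absVal).IsEquiv (Q j).absVal := fun i j hij h => by
    refine hij (hQ (eq_of_val_lt_one_iff fun x => ?_))
    rw [← absVal_lt_one_iff, ← absVal_lt_one_iff]
    exact AbsoluteValue.isEquiv_iff_lt_one_iff.1 h x
  obtain ⟨e, he, he'⟩ := AbsoluteValue.exists_one_lt_lt_one_pi_of_not_isEquiv hnt hne i
  exact ⟨e, ((Q i).one_lt_absVal_iff e).1 he, fun j hj => ((Q j).absVal_lt_one_iff e).1 (he' j hj)⟩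

/-- A non-constant rational function has finitely many poles. -/
lemma finite_poles (hK : IsCurveFunctionField F K) (x : K) :
    {Q : ClosedPoint F K | 1 < Q.val x}.Finite := by
  classical
  by_contra hinf
  obtain ⟨Q₀, hQ₀⟩ := Set.Infinite.nonempty hinf
  have hx := Q₀.transcendental_of_one_lt_val hK hQ₀
  have hx0 : x ≠ 0 := fun h => hx (h ▸ isAlgebraic_zero)
  have hy : Transcendental F x⁻¹ := fun h => hx (by simpa using h.inv)
  have := hK.finiteDimensional_adjoin hy
  obtain ⟨S, hS, hcard⟩ := Set.Infinite.exists_subset_card_eq hinf (Module.finrank F⟮x⁻¹⟯ K + 1)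
  -- Each `e Q` has a pole at `Q` and is small at the other chosen points. In a relation over
  -- `F[x⁻¹]` whose coefficient at `Q` is a unit there, the term of `e Q` has value `> 1` at `Q` and
  -- all others have value `< 1`, which is impossible.
  choose e he he' using exists_one_lt_val_lt_one (Q := fun Q : S => Q.1) Subtype.val_injective
  obtain ⟨c, hc, i, hi⟩ := exists_relation (F := F) (inv_ne_zero hx0) e
    (by rw [Fintype.card_coe, hcard]; omega)
  have hy1 : i.1.val x⁻¹ < 1 := by
    rw [map_inv₀]
    exact inv_lt_one_of_one_lt₀ (hS i.2)
  rw [← Finset.add_sum_erase _ _ (Finset.mem_univ i), add_eq_zero_iff_eq_neg] at hc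
  have h1 := congrArg i.1.val hc
  rw [Valuation.map_neg, map_mul, i.1.val_aeval_eq_one hy1 hi, one_mul] at h1
  refine h1.not_gt ((i.1.val.map_sum_lt one_ne_zero fun j hj => ?_).trans (he i))
  rw [map_mul]
  exact (mul_le_of_le_one_left' (i.1.val_aeval_le_one hy1.le _)).trans_lt
    (he' j i (Finset.ne_of_mem_erase hj).symm)

end
end ClosedPoint

/-! ### A dimension count of Riemann type: a function whose only pole is at a given point -/

namespace ClosedPoint

section

variable {F K : Type*} [Field F] [Field K] [Algebra F K]

lemma exists_lt_pow_withZeroInt {a : ℤᵐ⁰} (ha : 1 < a) (b : ℤᵐ⁰) : ∃ n : ℕ, b < a ^ n := by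
  rcases eq_or_ne b 0 with rfl | hb
  · exact ⟨0, by simp⟩
  have ha0 : a ≠ 0 := (zero_lt_one.trans ha).ne'
  rw [← WithZero.exp_log ha0, ← WithZero.exp_zero, WithZero.exp_lt_exp] at ha
  refine ⟨b.log.toNat + 1, ?_⟩
  rw [← WithZero.exp_log hb, ← WithZero.exp_log ha0, ← WithZero.exp_nsmul, WithZero.exp_lt_exp]
  simp only [WithZero.log_exp, nsmul_eq_mul]
  have h1 := Int.self_le_toNat b.log
  push_cast
  nlinarith [Int.natCast_nonneg b.log.toNat]

/-- The functions whose poles at the poles of `x` other than `P` are bounded by those of `x ^ k`. -/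
def poleSpace (P : ClosedPoint F K) (x : K) (k : ℕ) : Submodule F K where
  carrier := {f | ∀ Q : ClosedPoint F K, 1 < Q.val x → Q ≠ P → Q.val f ≤ Q.val x ^ k}
  zero_mem' Q _ _ := by simp
  add_mem' hf hg Q h h' := (Q.val.map_add _ _).trans (max_le (hf Q h h') (hg Q h h'))
  smul_mem' c f hf Q h h' := by
    rw [Algebra.smul_def, map_mul]
    exact (mul_le_of_le_one_left' (Q.val_algebraMap_le_one c)).trans (hf Q h h')

variable (F) in
/-- The functions all of whose poles are poles of `x`. -/
def regularSpace (x : K) : Submodule F K where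
  carrier := {f | ∀ Q : ClosedPoint F K, Q.val x ≤ 1 → Q.val f ≤ 1}
  zero_mem' Q _ := by simp
  add_mem' hf hg Q h := (Q.val.map_add _ _).trans (max_le (hf Q h) (hg Q h))
  smul_mem' c f hf Q h := by
    rw [Algebra.smul_def, map_mul]
    exact mul_le_one' (Q.val_algebraMap_le_one c) (hf Q h)

/-- There is a basis of `K` over `F(x)` consisting of functions all of whose poles are poles of
`x`. -/
lemma exists_linearIndependent_regular (hK : IsCurveFunctionField F K) {x : K}
    (htr : Transcendental F x) (hxE : x ∈ F⟮x⁻¹⟯) :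
    ∃ u : Fin (Module.finrank F⟮x⁻¹⟯ K) → K, LinearIndependent F⟮x⁻¹⟯ u ∧
      ∀ i, ∀ Q : ClosedPoint F K, Q.val x ≤ 1 → Q.val (u i) ≤ 1 := by
  have hy : Transcendental F x⁻¹ := fun h => htr (by simpa using h.inv)
  have := hK.finiteDimensional_adjoin hy
  have hle : Algebra.adjoin F {x} ≤ F⟮x⁻¹⟯.toSubalgebra :=
    Algebra.adjoin_le (by simpa using hxE)
  have hadj : ∀ Q : ClosedPoint F K, Q.val x ≤ 1 → ∀ z ∈ Algebra.adjoin F {x}, Q.val z ≤ 1 := by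
    intro Q hQ z hz
    obtain ⟨p, rfl⟩ := (Algebra.adjoin_singleton_eq_range_aeval F x ▸ hz :)
    exact Q.val_aeval_le_one hQ p
  have halg : Algebra.IsAlgebraic (Algebra.adjoin F {x}) K := by
    have := hK.finiteDimensional_adjoin htr
    open scoped IntermediateField.algebraAdjoinAdjoin in
    exact (IsFractionRing.comap_isAlgebraic_iff (A := Algebra.adjoin F {x}) (K := F⟮x⟯)
      (C := K)).2
      inferInstance
  -- A nonzero multiplier from `F[x]` makes each basis vector integral over `F[x]`, hence regular
  -- wherever `x` is.
  choose y hy0 hy using fun i =>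
    (halg.isAlgebraic (Module.finBasis F⟮x⁻¹⟯ K i)).exists_integral_multiple
  refine ⟨fun i => y i • Module.finBasis F⟮x⁻¹⟯ K i, ?_, fun i Q hQ => ?_⟩
  · exact (Module.finBasis F⟮x⁻¹⟯ K).linearIndependent.units_smul fun i =>
      Units.mk0 ⟨y i, hle (y i).2⟩ fun h =>
        hy0 i (Subtype.ext (congrArg (fun z : F⟮x⁻¹⟯ => (z : K)) h))
  · refine Valuation.Integers.mem_of_integral (Valuation.integer.integers Q.val) ?_
    obtain ⟨p, hp, hp0⟩ := hy i
    let φ : Algebra.adjoin F {x} →+* Q.val.integer :=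
      (algebraMap (Algebra.adjoin F {x}) K).codRestrict _ fun z => hadj Q hQ z z.2
    refine ⟨p.map φ, hp.map φ, ?_⟩
    rw [eval₂_map]
    exact hp0

lemma linearIndependent_pow_of_transcendental {x : K} (htr : Transcendental F x) :
    LinearIndependent F fun i : ℕ => x ^ i := by
  have h := (basisMonomials F).linearIndependent.map' (aeval x).toLinearMap
    (LinearMap.ker_eq_bot.2 (transcendental_iff_injective.1 htr))
  have h' : (fun i : ℕ => x ^ i) = (aeval x).toLinearMap ∘ basisMonomials F := by
    ext i
    simp [aeval_monomial]
  rw [h']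
  exact h

variable [Fintype F]

/-- One step of the pole filtration costs at most `[K : F(x⁻¹)] - 1` dimensions. The saving of one,
without which the count would yield nothing, comes from leaving the pole `P` of `x` unconstrained.
-/
lemma exists_combination_mem_poleSpace (hK : IsCurveFunctionField F K) {P : ClosedPoint F K}
    {x : K} (hx : 1 < P.val x) (k : ℕ) (u : Fin (Module.finrank F⟮x⁻¹⟯ K) → K)
    (hu : ∀ i, u i ∈ poleSpace P x (k + 1)) :
    ∃ c : Fin (Module.finrank F⟮x⁻¹⟯ K) → F, c ≠ 0 ∧ ∑ i, c i • u i ∈ poleSpace P x k := by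
  classical
  have htr := P.transcendental_of_one_lt_val hK hx
  have hx0 : x ≠ 0 := fun h => htr (h ▸ isAlgebraic_zero)
  have hy0 := inv_ne_zero hx0
  have hy : Transcendental F x⁻¹ := fun h => htr (by simpa using h.inv)
  have hylt : ∀ {Q : ClosedPoint F K}, 1 < Q.val x → Q.val x⁻¹ < 1 := fun {Q} hQ => by
    rw [map_inv₀]; exact inv_lt_one_of_one_lt₀ hQ
  have := hK.finiteDimensional_adjoin hy
  obtain ⟨e, he, he'⟩ : ∃ e : K, 1 < P.val e ∧
      ∀ Q : ClosedPoint F K, 1 < Q.val x → Q ≠ P → Q.val e ≤ 1 := by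
    have := (finite_poles hK x).to_subtype
    obtain ⟨e, he, he'⟩ := exists_one_lt_val_lt_one
      (Q := fun Q : {Q : ClosedPoint F K | 1 < Q.val x} => Q.1) Subtype.val_injective ⟨P, hx⟩
    exact ⟨e, he, fun Q hQ hne => (he' ⟨Q, hQ⟩ fun h => hne (congrArg Subtype.val h)).le⟩
  let u' := fun i => u i * x⁻¹ ^ (k + 1)
  have hu' : ∀ i (Q : ClosedPoint F K), 1 < Q.val x → Q ≠ P → Q.val (u' i) ≤ 1 := by
    intro i Q hQ hne
    have h1 : (Q.val x) ^ (k + 1) ≠ 0 := pow_ne_zero _ (zero_lt_one.trans hQ).ne'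
    calc Q.val (u' i) = Q.val (u i) * (Q.val x ^ (k + 1))⁻¹ := by simp [u']
      _ ≤ Q.val x ^ (k + 1) * (Q.val x ^ (k + 1))⁻¹ := mul_le_mul_left (hu i Q hQ hne) _
      _ = 1 := mul_inv_cancel₀ h1
  -- The extra element `e ^ N` beats all `u' i` at `P` and is regular at the other poles of `x`. It
  -- brings the number of vectors to `[K : F(x⁻¹)] + 1`, so a relation exists.
  obtain ⟨N, hN⟩ : ∃ N : ℕ, ∀ i, P.val (u' i) < P.val e ^ N := by
    choose N hN using fun i => exists_lt_pow_withZeroInt he (P.val (u' i))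
    exact ⟨Finset.univ.sup N, fun i => (hN i).trans_le
      (pow_le_pow_right₀ he.le (Finset.le_sup (Finset.mem_univ i)))⟩
  obtain ⟨c, hc, i₀, hi₀⟩ := exists_relation (F := F) hy0
    (fun o : Option (Fin (Module.finrank F⟮x⁻¹⟯ K)) => o.elim (e ^ N) u') (by simp)
  rw [Fintype.sum_option] at hc
  simp only [Option.elim] at hc
  -- Otherwise the term of `e ^ N` would strictly dominate at `P`; so the unit coefficient belongs
  -- to one of the `u' i`.
  have hnone : (c none).coeff 0 = 0 := by
    by_contra h0
    rw [add_eq_zero_iff_eq_neg] at hc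
    have h1 := congrArg P.val hc
    rw [Valuation.map_neg, map_mul, P.val_aeval_eq_one (hylt hx) h0, one_mul, map_pow] at h1
    refine h1.not_gt (P.val.map_sum_lt (pow_ne_zero _ (zero_lt_one.trans he).ne') fun j _ => ?_)
    rw [map_mul]
    exact (mul_le_of_le_one_left' (P.val_aeval_le_one (hylt hx).le _)).trans_lt (hN j)
  obtain ⟨i, hi⟩ : ∃ i, (c (some i)).coeff 0 ≠ 0 := by
    rcases i₀ with _ | i
    exacts [absurd hnone hi₀, ⟨i, hi₀⟩]
  refine ⟨fun j => (c (some j)).coeff 0, fun h => hi (congrFun h i), fun Q hQ hne => ?_⟩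
  -- Replacing the coefficients by their constant terms changes the relation by multiples of `x⁻¹`;
  -- after multiplication by `x ^ (k + 1)`, the pole order is bounded by that of `x ^ k`.
  have hsum : ∑ j, (c (some j)).coeff 0 • u j = -(x ^ (k + 1) * (aeval x⁻¹ (c none) * e ^ N +
      ∑ j, aeval x⁻¹ (c (some j) - C ((c (some j)).coeff 0)) * u' j)) := by
    have h1 : ∀ j, aeval x⁻¹ (c (some j) - C ((c (some j)).coeff 0)) * u' j =
        aeval x⁻¹ (c (some j)) * u' j - x⁻¹ ^ (k + 1) * ((c (some j)).coeff 0 • u j) := fun j => by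
      rw [map_sub, aeval_C, Algebra.smul_def]
      simp only [u']
      ring
    simp_rw [h1]
    rw [Finset.sum_sub_distrib, ← add_sub_assoc, hc, zero_sub, mul_neg, neg_neg, ← Finset.mul_sum,
      ← mul_assoc, ← mul_pow, mul_inv_cancel₀ hx0, one_pow, one_mul]
  have hyle : ∀ (d : F[X]) (w : K), d.coeff 0 = 0 → Q.val w ≤ 1 →
      Q.val (aeval x⁻¹ d * w) ≤ Q.val x⁻¹ := fun d w hd hw => by
    rw [map_mul]
    exact (mul_le_of_le_one_right' hw).trans (Q.val_aeval_le (hylt hQ).le hd)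
  have hbd : Q.val (aeval x⁻¹ (c none) * e ^ N +
      ∑ j, aeval x⁻¹ (c (some j) - C ((c (some j)).coeff 0)) * u' j) ≤ Q.val x⁻¹ := by
    refine (Q.val.map_add _ _).trans (max_le (hyle _ _ hnone ?_) (Q.val.map_sum_le fun j _ =>
      hyle _ _ (by simp) (hu' j Q hQ hne)))
    rw [map_pow]
    exact pow_le_one' (he' Q hQ hne) N
  have hxQ : Q.val x ≠ 0 := (zero_lt_one.trans hQ).ne'
  calc _ = Q.val x ^ (k + 1) * Q.val (aeval x⁻¹ (c none) * e ^ N +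
      ∑ j, aeval x⁻¹ (c (some j) - C ((c (some j)).coeff 0)) * u' j) := by
        rw [hsum, Valuation.map_neg, map_mul, map_pow]
    _ ≤ Q.val x ^ (k + 1) * Q.val x⁻¹ := mul_le_mul_right hbd _
    _ = Q.val x ^ k := by rw [map_inv₀, pow_succ, mul_assoc, mul_inv_cancel₀ hxQ, mul_one]

/-- Induction on `k`: by `exists_combination_mem_poleSpace`, no `[K : F(x⁻¹)]` vectors of `V` are
independent modulo `poleSpace P x k`. -/
lemma finrank_le_of_le_poleSpace (hK : IsCurveFunctionField F K) {P : ClosedPoint F K}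
    {x : K} (hx : 1 < P.val x) (k : ℕ) (V : Submodule F K) [FiniteDimensional F V]
    (hV : V ≤ poleSpace P x k) : Module.finrank F V ≤
      Module.finrank F (V ⊓ poleSpace P x 0 : Submodule F K) +
        k * (Module.finrank F⟮x⁻¹⟯ K - 1) := by
  induction k generalizing V with
  | zero => rw [inf_eq_left.2 hV]; simp
  | succ k ih =>
    have h1 := ih (V ⊓ poleSpace P x k) inf_le_right
    have h2 : (V ⊓ poleSpace P x k) ⊓ poleSpace P x 0 ≤ V ⊓ poleSpace P x 0 :=
      inf_le_inf_right _ inf_le_left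
    have h3 := Submodule.finrank_mono h2
    have h4 := Submodule.finrank_quotient_add_finrank ((poleSpace P x k).comap V.subtype)
    have h5 : Module.finrank F ((poleSpace P x k).comap V.subtype) =
        Module.finrank F (V ⊓ poleSpace P x k : Submodule F K) := by
      rw [← Submodule.map_comap_subtype]
      exact (LinearEquiv.finrank_eq (Submodule.equivMapOfInjective _ V.subtype_injective _))
    have h6 : Module.finrank F (V ⧸ (poleSpace P x k).comap V.subtype) <
        Module.finrank F⟮x⁻¹⟯ K := by
      by_contra! hle
      let b := Module.finBasis F (V ⧸ (poleSpace P x k).comap V.subtype)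
      choose u hu using fun i => Submodule.mkQ_surjective _ (b (Fin.castLE hle i))
      obtain ⟨c, hc, hmem⟩ := exists_combination_mem_poleSpace hK hx k (fun i => (u i : K))
        fun i => hV (u i).2
      refine hc (funext (Fintype.linearIndependent_iff.1
        (b.linearIndependent.comp _ (Fin.castLE_injective hle)) c ?_))
      simp only [Function.comp_apply, ← hu, ← map_smul, ← map_sum]
      rw [Submodule.mkQ_apply, Submodule.Quotient.mk_eq_zero, Submodule.mem_comap]
      simpa using hmem
    have h7 : (k + 1) * (Module.finrank F⟮x⁻¹⟯ K - 1) =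
      k * (Module.finrank F⟮x⁻¹⟯ K - 1) + (Module.finrank F⟮x⁻¹⟯ K - 1) := by ring
    omega

/-- There is a non-constant function that is regular away from a given point. -/
lemma exists_mem_ringAway_not_const (hK : IsCurveFunctionField F K) (P : ClosedPoint F K) :
    ∃ f ∈ P.ringAway, f ∉ Set.range (algebraMap F K) := by
  classical
  obtain ⟨x, hx'⟩ := P.surjective (WithZero.exp 1)
  have hx : 1 < P.val x := by rw [hx']; decide
  have htr := P.transcendental_of_one_lt_val hK hx
  have hx0 : x ≠ 0 := fun h => htr (h ▸ isAlgebraic_zero)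
  have hy : Transcendental F x⁻¹ := fun h => htr (by simpa using h.inv)
  have := hK.finiteDimensional_adjoin hy
  have hxE : x ∈ F⟮x⁻¹⟯ := by
    simpa using inv_mem (IntermediateField.mem_adjoin_simple_self F x⁻¹)
  have hn0 : 0 < Module.finrank F⟮x⁻¹⟯ K := Module.finrank_pos
  obtain ⟨u, hu, hint⟩ := exists_linearIndependent_regular hK htr hxE
  obtain ⟨n, hn⟩ := Nat.exists_eq_succ_of_ne_zero hn0.ne'
  obtain ⟨c, hc⟩ : ∃ c : ℕ, ∀ i, u i ∈ poleSpace P x c := by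
    choose N hN using fun (Q : ClosedPoint F K) (i : Fin (Module.finrank F⟮x⁻¹⟯ K))
        (hQ : 1 < Q.val x) =>
      exists_lt_pow_withZeroInt hQ (Q.val (u i))
    have hfin := finite_poles hK x
    refine ⟨hfin.toFinset.attach.sup fun Q => Finset.univ.sup fun i =>
      N Q.1 i (hfin.mem_toFinset.1 Q.2), fun i Q hQ _ => (hN Q i hQ).le.trans
        (pow_le_pow_right₀ hQ.le ?_)⟩
    refine le_trans ?_ (Finset.le_sup (Finset.mem_attach _ ⟨Q, hfin.mem_toFinset.2 hQ⟩))
    exact Finset.le_sup (f := fun i => N Q i hQ) (Finset.mem_univ i)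
  -- With `d = [K : F(x⁻¹)]`, the `m d` products `x ^ i * u j` leave dimension at least `m d - (m +
  -- c)(d - 1) = m - c(d - 1)` in `poleSpace P x 0`. This choice makes it `c + 2`, more than the one
  -- dimension of the constants.
  obtain ⟨m, hm⟩ : ∃ m, m = c * Module.finrank F⟮x⁻¹⟯ K + 2 := ⟨_, rfl⟩
  let w : Fin m × Fin (Module.finrank F⟮x⁻¹⟯ K) → K := fun p => x ^ (p.1 : ℕ) * u p.2
  have hw : LinearIndependent F w := by
    have h1 : LinearIndependent F fun i : Fin m => (⟨x, hxE⟩ : F⟮x⁻¹⟯) ^ (i : ℕ) := by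
      refine LinearIndependent.of_comp F⟮x⁻¹⟯.val.toLinearMap ?_
      exact (linearIndependent_pow_of_transcendental htr).comp _ Fin.val_injective
    exact linearIndependent_smul h1 hu
  have hreg : Submodule.span F (Set.range w) ≤ regularSpace F x := by
    rw [Submodule.span_le]
    rintro _ ⟨p, rfl⟩ Q hQ
    change Q.val (x ^ (p.1 : ℕ) * u p.2) ≤ 1
    rw [map_mul, map_pow]
    exact mul_le_one' (pow_le_one' hQ _) (hint _ Q hQ)
  have hV : Submodule.span F (Set.range w) ≤ poleSpace P x (m + c) := by
    rw [Submodule.span_le]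
    rintro _ ⟨p, rfl⟩ Q hQ hne
    change Q.val (x ^ (p.1 : ℕ) * u p.2) ≤ _
    rw [map_mul, map_pow, pow_add]
    exact mul_le_mul' (pow_le_pow_right₀ hQ.le p.1.2.le) (hc _ Q hQ hne)
  have : FiniteDimensional F (Submodule.span F (Set.range w)) :=
    FiniteDimensional.span_of_finite F (Set.finite_range w)
  have hfr := finrank_le_of_le_poleSpace hK hx (m + c) _ hV
  rw [finrank_span_eq_card hw, Fintype.card_prod, Fintype.card_fin, Fintype.card_fin] at hfr
  have h2 : 2 ≤ Module.finrank F
      (Submodule.span F (Set.range w) ⊓ poleSpace P x 0 : Submodule F K) := by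
    have h3 : m * Module.finrank F⟮x⁻¹⟯ K = m * n + m := by rw [hn, Nat.mul_succ]
    have h4 : (m + c) * (Module.finrank F⟮x⁻¹⟯ K - 1) = m * n + c * n := by
      rw [hn, Nat.succ_sub_one]; ring
    have h5 : c * Module.finrank F⟮x⁻¹⟯ K = c * n + c := by rw [hn, Nat.mul_succ]
    omega
  by_contra! hcon
  have hle : (Submodule.span F (Set.range w) ⊓ poleSpace P x 0 : Submodule F K) ≤ F ∙ (1 : K) := by
    rintro f ⟨hf, hf'⟩
    obtain ⟨a, rfl⟩ := hcon f fun Q hQ => by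
      rcases le_or_gt (Q.val x) 1 with h | h
      · exact hreg hf Q h
      · simpa using hf' Q h hQ
    exact Submodule.mem_span_singleton.2 ⟨a, (Algebra.algebraMap_eq_smul_one a).symm⟩
  have := (Submodule.finrank_mono hle).trans
    (finrank_span_singleton (K := F) (one_ne_zero (α := K))).le
  omega

/-- Some function regular away from `P` has a pole at `P`. -/
lemma exists_mem_ringAway_one_lt_val (hK : IsCurveFunctionField F K) (P : ClosedPoint F K) :
    ∃ f ∈ P.ringAway, 1 < P.val f := by
  obtain ⟨f, hf, hf'⟩ := exists_mem_ringAway_not_const hK P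
  obtain ⟨Q, hQ⟩ := exists_one_lt_val hK hf'
  rcases eq_or_ne Q P with rfl | hne
  · exact ⟨f, hf, hQ⟩
  · exact absurd (hf Q hne) hQ.not_ge

end
end ClosedPoint

end FunctionField

/-! ### Gauss norms in coordinates, and the operator `id - τ` on Tate algebras -/

section GaussNorm

/-- Nonzero constants are roots of unity. -/
lemma norm_algebraMap_le_one (F : Type*) {L : Type*} [Field F] [Fintype F] [NormedField L]
    [Algebra F L] (c : F) : ‖algebraMap F L c‖ ≤ 1 := by
  rcases eq_or_ne c 0 with rfl | hc
  · simp
  have h : ‖algebraMap F L c‖ ^ (Fintype.card F - 1) = 1 := by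
    rw [← norm_pow, ← map_pow, FiniteField.pow_card_sub_one_eq_one c hc, map_one, norm_one]
  refine (pow_le_one_iff_of_nonneg (norm_nonneg _) (n := Fintype.card F - 1) ?_).1 h.le
  have := Fintype.one_lt_card (α := F)
  omega

variable {F A L : Type*} [Field F] [CommRing A] [Algebra F A] [NormedField L] [Algebra F L]

/-- With `mem_gaussBall_of_norm_equivFinsupp_le`, this identifies Gauss balls with coordinatewise
balls for an `F`-basis of `A`. Constants have norm at most `1`, so expanding the `a_i` in the basis
does not increase norms. -/
lemma norm_equivFinsupp_le [Fintype F] [IsUltrametricDist L] {ι : Type*} [DecidableEq ι]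
    (b : Module.Basis ι F A) {r : ℝ} (hr : 0 ≤ r) {x : Gauss F A L}
    (hx : x ∈ gaussBall F A L r) (i : ι) :
    ‖TensorProduct.equivFinsuppOfBasisLeft (N := L) b ((toGauss F A L).symm x) i‖ ≤ r := by
  refine AddSubgroup.closure_induction ?_ ?_ ?_ ?_ hx
  · rintro _ ⟨a, ℓ, hℓ, rfl⟩
    rw [RingEquiv.symm_apply_apply, TensorProduct.equivFinsuppOfBasisLeft_apply_tmul_apply,
      Algebra.smul_def, norm_mul]
    exact (mul_le_of_le_one_left (norm_nonneg _) (norm_algebraMap_le_one F _)).trans hℓ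
  · simpa using hr
  · intro x y _ _ hx hy
    rw [map_add, map_add, Finsupp.add_apply]
    exact (IsUltrametricDist.norm_add_le_max _ _).trans (max_le hx hy)
  · intro x _ hx
    rwa [map_neg, map_neg, Finsupp.neg_apply, norm_neg]

lemma mem_gaussBall_of_norm_equivFinsupp_le {ι : Type*} [DecidableEq ι]
    (b : Module.Basis ι F A) {r : ℝ} {x : Gauss F A L}
    (hx : ∀ i, ‖TensorProduct.equivFinsuppOfBasisLeft (N := L) b ((toGauss F A L).symm x) i‖ ≤ r) :
    x ∈ gaussBall F A L r := by
  have h : x = toGauss F A L ((TensorProduct.equivFinsuppOfBasisLeft (N := L) b).symm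
      (TensorProduct.equivFinsuppOfBasisLeft b ((toGauss F A L).symm x))) := by
    rw [LinearEquiv.symm_apply_apply, RingEquiv.apply_symm_apply]
  rw [h, TensorProduct.equivFinsuppOfBasisLeft_symm_apply, Finsupp.sum, map_sum]
  exact sum_mem fun i _ => AddSubgroup.subset_closure ⟨b i, _, hx i, rfl⟩

variable {L' : Type*} [NormedField L'] [Algebra F L']

/-- The map acts on coordinates through `φ`, and Gauss balls are read off from coordinates. This
gives the isometric embedding of `K_∞⟨A⟩` in `ℂ_∞⟨A⟩` and the isometric action of `G_∞`. -/
lemma isometry_gaussMap [Fintype F] [IsUltrametricDist L'] (φ : L →ₐ[F] L')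
    (hφ : ∀ x, ‖φ x‖ = ‖x‖) : Isometry (gaussMap A φ) := by
  classical
  refine AddMonoidHomClass.isometry_of_norm _ fun x => ?_
  let b := Module.Basis.ofVectorSpace F A
  have hco : ∀ i, TensorProduct.equivFinsuppOfBasisLeft (N := L') b
      ((toGauss F A L').symm (gaussMap A φ x)) i =
      φ (TensorProduct.equivFinsuppOfBasisLeft (N := L) b ((toGauss F A L).symm x) i) := by
    intro i
    obtain ⟨x, rfl⟩ := (toGauss F A L).surjective x
    rw [gaussMap_toGauss, RingEquiv.symm_apply_apply, RingEquiv.symm_apply_apply]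
    induction x using TensorProduct.induction_on with
    | zero => simp
    | tmul a ℓ => simp
    | add x y hx hy => simp only [map_add, Finsupp.add_apply, hx, hy]
  refine le_antisymm (le_of_forall_gt_imp_ge_of_dense fun r hr => ?_)
    (le_of_forall_gt_imp_ge_of_dense fun r hr => ?_)
  · refine gaussNorm_le ((norm_nonneg x).trans hr.le) ?_
    have hx : x ∈ gaussBall F A L r := mem_gaussBall_of_lt hr
    refine AddSubgroup.closure_induction ?_ ?_ ?_ ?_ hx
    · rintro _ ⟨a, ℓ, hℓ, rfl⟩
      exact AddSubgroup.subset_closure ⟨a, φ ℓ, (hφ ℓ).trans_le hℓ, by simp [gaussMap_toGauss]⟩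
    · rw [map_zero]; exact zero_mem _
    · intro u v _ _ hu hv; rw [map_add]; exact add_mem hu hv
    · intro u _ hu; rw [map_neg]; exact neg_mem hu
  · have hr' := (norm_nonneg (gaussMap A φ x)).trans hr.le
    refine gaussNorm_le hr' (mem_gaussBall_of_norm_equivFinsupp_le b fun i => ?_)
    rw [← hφ, ← hco]
    exact norm_equivFinsupp_le b hr' (mem_gaussBall_of_lt hr) i

lemma isometry_tateMap [Fintype F] [IsUltrametricDist L'] (φ : L →ₐ[F] L') (hφ : Continuous φ)
    (hφ' : ∀ x, ‖φ x‖ = ‖x‖) : Isometry (tateMap A φ hφ) :=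
  (isometry_gaussMap φ hφ').completion_map

instance : CompleteSpace (Tate F A L) :=
  inferInstanceAs (CompleteSpace (UniformSpace.Completion (Gauss F A L)))

lemma continuous_tateMap (φ : L →ₐ[F] L') (hφ : Continuous φ) : Continuous (tateMap A φ hφ) :=
  UniformSpace.Completion.continuous_map

lemma norm_toTate (x : A ⊗[F] L) : ‖toTate F A L x‖ = gaussNorm (toGauss F A L x) :=
  UniformSpace.Completion.norm_coe (toGauss F A L x)

lemma norm_toTate_tmul_le (a : A) (ℓ : L) : ‖toTate F A L (a ⊗ₜ ℓ)‖ ≤ ‖ℓ‖ := by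
  rw [norm_toTate]
  exact gaussNorm_le (norm_nonneg _) (AddSubgroup.subset_closure ⟨a, ℓ, le_rfl, rfl⟩)

@[elab_as_elim]
lemma Tate.induction_on {p : Tate F A L → Prop} (s : Tate F A L) (hp : IsClosed {s | p s})
    (h : ∀ x : A ⊗[F] L, p (toTate F A L x)) : p s :=
  UniformSpace.Completion.induction_on s hp h

lemma exists_norm_sub_toTate_lt (s : Tate F A L) {ε : ℝ} (hε : 0 < ε) :
    ∃ x : A ⊗[F] L, ‖s - toTate F A L x‖ < ε := by
  have hd : DenseRange ((↑) : Gauss F A L → UniformSpace.Completion (Gauss F A L)) :=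
    UniformSpace.Completion.denseRange_coe
  obtain ⟨x, hx⟩ := Metric.denseRange_iff.1 hd s ε hε
  exact ⟨(toGauss F A L).symm x, by rw [← dist_eq_norm]; exact hx⟩

lemma exists_norm_sub_toTate_map_lt (φ : L →ₐ[F] L') (hφ : DenseRange φ) (s : Tate F A L')
    {ε : ℝ} (hε : 0 < ε) :
    ∃ x : A ⊗[F] L,
      ‖s - toTate F A L' (Algebra.TensorProduct.map (AlgHom.id F A) φ x)‖ < ε := by
  obtain ⟨y, hy⟩ := exists_norm_sub_toTate_lt s (half_pos hε)
  suffices h : ∀ ε > 0, ∃ x : A ⊗[F] L,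
      ‖toTate F A L' y - toTate F A L' (Algebra.TensorProduct.map (AlgHom.id F A) φ x)‖ < ε by
    obtain ⟨x, hx⟩ := h _ (half_pos hε)
    refine ⟨x, ?_⟩
    rw [← sub_add_sub_cancel s (toTate F A L' y)]
    exact (norm_add_le _ _).trans_lt (by linarith)
  clear hy
  induction y using TensorProduct.induction_on with
  | zero => exact fun ε hε => ⟨0, by simpa using hε⟩
  | tmul a c =>
    intro ε hε
    obtain ⟨d, hd⟩ := Metric.denseRange_iff.1 hφ c ε hε
    refine ⟨a ⊗ₜ d, ?_⟩
    rw [Algebra.TensorProduct.map_tmul, AlgHom.id_apply, ← map_sub, ← TensorProduct.tmul_sub]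
    exact (norm_toTate_tmul_le _ _).trans_lt (by rwa [← dist_eq_norm])
  | add u v hu hv =>
    intro ε hε
    obtain ⟨x, hx⟩ := hu _ (half_pos hε)
    obtain ⟨y, hy⟩ := hv _ (half_pos hε)
    refine ⟨x + y, ?_⟩
    rw [map_add, map_add, map_add, add_sub_add_comm]
    exact (norm_add_le _ _).trans_lt (by linarith)

variable (F A L) in
/-- The homomorphism `L → L⟨A⟩`, `ℓ ↦ 1 ⊗ ℓ`. -/
noncomputable def tateScalar : L →+* Tate F A L :=
  (toTate F A L).comp (Algebra.TensorProduct.includeRight : L →ₐ[F] A ⊗[F] L).toRingHom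

lemma tateScalar_apply (ℓ : L) : tateScalar F A L ℓ = toTate F A L (1 ⊗ₜ ℓ) := rfl
lemma tateMap_tateScalar (φ : L →ₐ[F] L') (hφ : Continuous φ) (ℓ : L) :
    tateMap A φ hφ (tateScalar F A L ℓ) = tateScalar F A L' (φ ℓ) := by
  rw [tateScalar_apply, tateMap_toTate, Algebra.TensorProduct.map_tmul, map_one, tateScalar_apply]

variable [Fintype F]

lemma tateTau_tateScalar (ℓ : L) :
    tateTau F A L (tateScalar F A L ℓ) = tateScalar F A L (ℓ ^ Fintype.card F) :=
  tateMap_tateScalar _ _ _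

lemma continuous_tateTau : Continuous (tateTau F A L) := continuous_tateMap _ _

lemma norm_tateTau_le (s : Tate F A L) : ‖tateTau F A L s‖ ≤ ‖s‖ ^ Fintype.card F := by
  induction s using Tate.induction_on with
  | hp => exact isClosed_le continuous_tateTau.norm (continuous_norm.pow _)
  | h x =>
    rw [tateTau, tateMap_toTate, norm_toTate, norm_toTate, ← gaussMap_toGauss]
    -- The infimum defining the Gauss norm need not be attained, so the bound is proved for every
    -- larger `r` and passed to the limit.
    have hlim : Filter.Tendsto (fun r : ℝ => r ^ Fintype.card F)
        (nhdsWithin (gaussNorm (toGauss F A L x)) (Set.Ioi (gaussNorm (toGauss F A L x))))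
        (nhds (gaussNorm (toGauss F A L x) ^ Fintype.card F)) :=
      ((continuous_pow _).tendsto _).mono_left nhdsWithin_le_nhds
    refine ge_of_tendsto hlim (Filter.eventually_of_mem self_mem_nhdsWithin fun r hr => ?_)
    have hr0 : 0 ≤ r := (gaussNorm_nonneg _).trans (le_of_lt hr)
    refine gaussNorm_le (pow_nonneg hr0 _) ?_
    refine AddSubgroup.closure_induction ?_ ?_ ?_ ?_ (mem_gaussBall_of_lt hr)
    · rintro _ ⟨a, ℓ, hℓ, rfl⟩
      refine AddSubgroup.subset_closure ⟨a, ℓ ^ Fintype.card F, ?_, by simp [gaussMap_toGauss]⟩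
      rw [norm_pow]
      exact pow_le_pow_left₀ (norm_nonneg _) hℓ _
    · rw [map_zero]; exact zero_mem _
    · intro u v _ _ hu hv; rw [map_add]; exact add_mem hu hv
    · intro u _ hu; rw [map_neg]; exact neg_mem hu

/-- The solution is `∑ τ^k s`, which converges because `τ` raises norms to the power `q` at least as
a bound. -/
lemma exists_sub_tateTau_eq_of_norm_lt_one {s : Tate F A L} (hs : ‖s‖ < 1) :
    ∃ t, t - tateTau F A L t = s := by
  have hq : 2 ≤ Fintype.card F := Fintype.one_lt_card
  have hle : ∀ k : ℕ, ‖(tateTau F A L)^[k] s‖ ≤ ‖s‖ ^ (k + 1) := by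
    intro k
    induction k with
    | zero => simp
    | succ k ih =>
      rw [Function.iterate_succ_apply']
      calc _ ≤ ‖(tateTau F A L)^[k] s‖ ^ Fintype.card F := norm_tateTau_le _
        _ ≤ (‖s‖ ^ (k + 1)) ^ Fintype.card F := pow_le_pow_left₀ (norm_nonneg _) ih _
        _ = ‖s‖ ^ ((k + 1) * Fintype.card F) := by rw [pow_mul]
        _ ≤ ‖s‖ ^ (k + 1 + 1) := pow_le_pow_of_le_one (norm_nonneg _) hs.le (by nlinarith)
  have hsum : Summable fun k : ℕ => (tateTau F A L)^[k] s :=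
    .of_norm_bounded ((summable_nat_add_iff 1).2
      (summable_geometric_of_lt_one (norm_nonneg s) hs)) hle
  refine ⟨∑' k, (tateTau F A L)^[k] s, ?_⟩
  rw [hsum.map_tsum (tateTau F A L) continuous_tateTau, hsum.tsum_eq_zero_add]
  simp only [Function.iterate_succ_apply', Function.iterate_zero, id_eq, add_sub_cancel_right]

end GaussNorm

/-! ### Invertibility of `𝔧` on Tate algebras -/

section JInvertible

variable {F A K : Type*} [Field F] [CommRing A] [Algebra F A] [Field K] [Algebra F K]
  [Algebra A K] [IsScalarTower F A K] {L : Type*} [NormedField L] [Algebra F L] [Algebra K L]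
  [IsScalarTower F K L]

/-- For `α` the image of `a`, the element `a ⊗ 1 - 1 ⊗ α = -(1 ⊗ α)(1 - a ⊗ α⁻¹)` is a unit by the
geometric series. -/
lemma jInvertible_of_one_lt_norm (a : A) (ha : 1 < ‖algebraMap K L (algebraMap A K a)‖) :
    JInvertible F A K L := by
  have hj : a ⊗ₜ[F] (1 : K) - 1 ⊗ₜ algebraMap A K a ∈ jIdeal F A K := by
    rw [jIdeal, RingHom.mem_ker]
    simp
  refine Ideal.eq_top_of_isUnit_mem _ (Ideal.mem_map_of_mem _ hj) ?_
  set α := algebraMap K L (algebraMap A K a) with hα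
  have hα0 : α ≠ 0 := by
    intro h
    rw [h, norm_zero] at ha
    exact absurd ha (by norm_num)
  have h1 : algebraMap (A ⊗[F] K) (Tate F A L) (a ⊗ₜ[F] (1 : K) - 1 ⊗ₜ algebraMap A K a) =
      -(tateScalar F A L α * (1 - toTate F A L (a ⊗ₜ α⁻¹))) := by
    rw [algebraMap_tate, tateScalar_apply, mul_sub, ← map_mul, Algebra.TensorProduct.tmul_mul_tmul,
      mul_inv_cancel₀ hα0, map_sub, map_sub]
    simp [hα]
  rw [h1, IsUnit.neg_iff]
  refine ((isUnit_iff_ne_zero.2 hα0).map _).mul (isUnit_one_sub_of_norm_lt_one ?_)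
  refine (norm_toTate_tmul_le _ _).trans_lt ?_
  rw [norm_inv]
  exact inv_lt_one_of_one_lt₀ ha

end JInvertible

/-- The polynomial `X^q - X + c` has derivative `-1`, hence is separable and has a root. -/
lemma exists_sub_pow_eq_of_isSepClosed {L : Type*} [Field L] [IsSepClosed L] {q : ℕ} (hq : 1 < q)
    (hcard : (q : L) = 0) (c : L) : ∃ d : L, d - d ^ q = c := by
  let p : Polynomial (L) := Polynomial.X ^ q - Polynomial.X + Polynomial.C c
  have hder : p.derivative = -1 := by
    simp [p, Polynomial.derivative_X_pow, hcard]
  have hsep : p.Separable := ⟨0, -1, by rw [hder]; simp⟩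
  have hdeg : p.degree ≠ 0 := by
    have h : p.degree = (q : ℕ) := by
      have h1 : (-Polynomial.X + Polynomial.C c : Polynomial (L)).degree <
          (q : ℕ) := by
        refine lt_of_le_of_lt (b := (1 : WithBot ℕ)) (by compute_degree) (by exact_mod_cast hq)
      rw [← Polynomial.degree_X_pow (R := L)] at h1
      have h2 := Polynomial.degree_add_eq_left_of_degree_lt h1
      rw [Polynomial.degree_X_pow] at h2
      rw [← h2]
      congr 1
      simp only [p]
      ring
    rw [h]
    exact_mod_cast (zero_lt_one.trans hq).ne'
  obtain ⟨d, hd⟩ := IsSepClosed.exists_root p hdeg hsep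
  refine ⟨d, ?_⟩
  simp only [p, Polynomial.IsRoot.def, Polynomial.eval_add, Polynomial.eval_sub,
    Polynomial.eval_pow, Polynomial.eval_X, Polynomial.eval_C] at hd
  linear_combination -hd

/-! ### The fields `K_∞ ⊆ K_∞^s ⊆ ℂ_∞` -/

section LocalFields

variable {F K : Type*} [Field F] [Fintype F] [Field K] [Algebra F K] (P : ClosedPoint F K)

instance : IsUltrametricDist (LocalSep P) :=
  IsUltrametricDist.isUltrametricDist_of_forall_norm_add_le_max_norm
    isNonarchimedean_spectralNorm

instance : IsUltrametricDist (LocalComplex P) :=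
  IsUltrametricDist.isUltrametricDist_of_forall_norm_add_le_max_norm fun x y => by
    induction x, y using UniformSpace.Completion.induction_on₂ with
    | hp => exact isClosed_le (by fun_prop) (by fun_prop)
    | ih x y =>
      rw [← UniformSpace.Completion.coe_add]
      simp only [UniformSpace.Completion.norm_coe]
      exact IsUltrametricDist.norm_add_le_max x y

/-- The inclusion of `K_∞^s` in `ℂ_∞`. -/
noncomputable def sepToComplex : LocalSep P →ₐ[K] LocalComplex P where
  toRingHom := UniformSpace.Completion.coeRingHom
  commutes' _ := rfl

lemma sepToComplex_apply (x : LocalSep P) : sepToComplex P x = (x : LocalComplex P) := rfl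

lemma denseRange_sepToComplex : DenseRange (sepToComplex P) :=
  UniformSpace.Completion.denseRange_coe
lemma galComplex_sepToComplex (σ : LocalGal P) (x : LocalSep P) :
    galComplex P σ (sepToComplex P x) = sepToComplex P (σ x) :=
  UniformSpace.Completion.mapRingHom_coe (continuous_gal P σ) x

lemma sepToComplex_algebraMap (x : LocalField P) :
    sepToComplex P (algebraMap (LocalField P) (LocalSep P) x) =
      algebraMap (LocalField P) (LocalComplex P) x := rfl

lemma norm_algebraMap_localComplex (x : LocalField P) :
    ‖algebraMap (LocalField P) (LocalComplex P) x‖ = ‖x‖ :=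
  (UniformSpace.Completion.norm_coe (algebraMap (LocalField P) (LocalSep P) x)).trans
    (spectralNorm_extends x)

lemma norm_algebraMap_localField (x : K) : ‖algebraMap K (LocalField P) x‖ = P.absVal x :=
  UniformSpace.Completion.norm_coe (WithAbs.toAbs P.absVal x)

lemma jInvertible_localField (hK : IsCurveFunctionField F K) :
    JInvertible F (CoordRing P) K (LocalField P) := by
  obtain ⟨f, hf, hf'⟩ := ClosedPoint.exists_mem_ringAway_one_lt_val hK P
  refine jInvertible_of_one_lt_norm (⟨f, hf⟩ : CoordRing P) ?_
  rw [norm_algebraMap_localField, ClosedPoint.one_lt_absVal_iff]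
  exact hf'

lemma jInvertible_localComplex (hK : IsCurveFunctionField F K) :
    JInvertible F (CoordRing P) K (LocalComplex P) := by
  obtain ⟨f, hf, hf'⟩ := ClosedPoint.exists_mem_ringAway_one_lt_val hK P
  refine jInvertible_of_one_lt_norm (⟨f, hf⟩ : CoordRing P) ?_
  rw [IsScalarTower.algebraMap_apply K (LocalField P) (LocalComplex P),
    norm_algebraMap_localComplex, norm_algebraMap_localField, ClosedPoint.one_lt_absVal_iff]
  exact hf'

lemma exists_sub_pow_card_eq (c : LocalSep P) : ∃ d : LocalSep P, d - d ^ Fintype.card F = c :=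
  exists_sub_pow_eq_of_isSepClosed Fintype.one_lt_card (by
    rw [← map_natCast (algebraMap F (LocalSep P)), FiniteField.cast_card_eq_zero, map_zero]) c

/-- The map `id - τ` is surjective on `ℂ_∞⟨A⟩`. -/
lemma exists_sub_tateTau_eq (A : Type*) [CommRing A] [Algebra F A]
    (s : Tate F A (LocalComplex P)) : ∃ t, t - tateTau F A (LocalComplex P) t = s := by
  obtain ⟨x, hx⟩ := exists_norm_sub_toTate_map_lt ((sepToComplex P).restrictScalars F)
    (denseRange_sepToComplex P) s one_pos
  obtain ⟨t, ht⟩ := exists_sub_tateTau_eq_of_norm_lt_one hx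
  -- The remainder of norm `< 1` is already solved; the approximant lies in `A ⊗ K_∞^s` and is
  -- treated one pure tensor at a time.
  suffices h : ∃ u, u - tateTau F A (LocalComplex P) u = toTate F A (LocalComplex P)
      (Algebra.TensorProduct.map (AlgHom.id F A) ((sepToComplex P).restrictScalars F) x) by
    obtain ⟨u, hu⟩ := h
    refine ⟨t + u, ?_⟩
    rw [map_add, add_sub_add_comm, ht, hu, sub_add_cancel]
  clear hx ht t
  induction x using TensorProduct.induction_on with
  | zero => exact ⟨0, by simp⟩
  | tmul a c =>
    obtain ⟨d, rfl⟩ := exists_sub_pow_card_eq P c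
    refine ⟨toTate F A (LocalComplex P) (a ⊗ₜ sepToComplex P d), ?_⟩
    rw [tateTau, tateMap_toTate, ← map_sub]
    simp [TensorProduct.tmul_sub]
  | add x y hx hy =>
    obtain ⟨u, hu⟩ := hx
    obtain ⟨v, hv⟩ := hy
    refine ⟨u + v, ?_⟩
    rw [map_add, add_sub_add_comm, hu, hv, map_add, map_add]

end LocalFields

/-- A finite family of elements `m i` of `M` and of linear forms `φ i` on `M` such that
`x = ∑ φ i x • m i` for all `x`. -/
structure DualFrame (B M : Type*) [CommRing B] [AddCommGroup M] [Module B M] where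
  card : ℕ
  gen : Fin card → M
  form : Fin card → M →ₗ[B] B
  sum_eq : ∀ x, ∑ i, form i x • gen i = x

lemma nonempty_dualFrame (B M : Type*) [CommRing B] [AddCommGroup M] [Module B M]
    [Module.Finite B M] [Module.Projective B M] : Nonempty (DualFrame B M) := by
  obtain ⟨n, f, g, -, -, h⟩ := Module.Finite.exists_comp_eq_id_of_projective B M
  refine ⟨⟨n, fun i => f (Pi.single i 1), fun i => LinearMap.proj i ∘ₗ g, fun x => ?_⟩⟩
  conv_rhs => rw [← LinearMap.id_apply (R := B) x, ← h, LinearMap.comp_apply,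
    ← Finset.univ_sum_single (g x), map_sum]
  refine Finset.sum_congr rfl fun i _ => ?_
  rw [LinearMap.comp_apply, LinearMap.proj_apply, ← map_smul, ← Pi.single_smul, smul_eq_mul,
    mul_one]

/-! ### Coordinate norms on `L⟨A⟩ ⊗ M` and the contraction by `τ_M` -/

section Frame

variable {F A K L M : Type*} [Field F] [CommRing A] [Algebra F A] [Field K] [Algebra F K]
  [NormedField L] [Algebra F L] [Algebra K L] [IsScalarTower F K L]
  [AddCommGroup M] [Module (A ⊗[F] K) M] (D : DualFrame (A ⊗[F] K) M)

namespace DualFrame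

variable (L) in
/-- The coordinates of elements of `L⟨A⟩ ⊗ M`. -/
noncomputable def coord : Tate F A L ⊗[A ⊗[F] K] M →ₗ[Tate F A L] (Fin D.card → Tate F A L) :=
  LinearMap.pi fun i =>
    LinearMap.liftBaseChange (Tate F A L) (Algebra.linearMap (A ⊗[F] K) (Tate F A L) ∘ₗ D.form i)

lemma coord_tmul (s : Tate F A L) (m : M) (i : Fin D.card) :
    D.coord L (s ⊗ₜ m) i = s * algebraMap (A ⊗[F] K) (Tate F A L) (D.form i m) := by
  simp [coord]

lemma sum_coord_smul (x : Tate F A L ⊗[A ⊗[F] K] M) :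
    ∑ i, D.coord L x i • ((1 : Tate F A L) ⊗ₜ[A ⊗[F] K] D.gen i) = x := by
  induction x using TensorProduct.induction_on with
  | zero => simp
  | tmul s m =>
    conv_rhs => rw [← D.sum_eq m, TensorProduct.tmul_sum]
    refine Finset.sum_congr rfl fun i _ => ?_
    rw [coord_tmul, TensorProduct.smul_tmul', smul_eq_mul, mul_one, TensorProduct.tmul_smul,
      TensorProduct.smul_tmul', Algebra.smul_def, mul_comm]
  | add x y hx hy => simp only [map_add, Pi.add_apply, add_smul, Finset.sum_add_distrib, hx, hy]

lemma coord_injective : Function.Injective (D.coord L) := fun x y h => by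
  rw [← D.sum_coord_smul x, h, D.sum_coord_smul]

variable {L' : Type*} [NormedField L'] [Algebra F L'] [Algebra K L'] [IsScalarTower F K L']

lemma coord_moduleMap (φ : L →ₐ[K] L') (hφ : Continuous φ) (x : Tate F A L ⊗[A ⊗[F] K] M)
    (i : Fin D.card) : D.coord L' (moduleMap F A M φ hφ x) i =
      tateAlgHom F A φ hφ (D.coord L x i) := by
  induction x using TensorProduct.induction_on with
  | zero => simp
  | tmul s m => rw [moduleMap_tmul, coord_tmul, coord_tmul, map_mul, AlgHom.commutes]
  | add x y hx hy => simp only [map_add, Pi.add_apply, hx, hy]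

lemma _root_.AMot.isometry_tateAlgHom [Fintype F] [IsUltrametricDist L'] (φ : L →ₐ[K] L')
    (hφ : Continuous φ) (hφ' : ∀ x, ‖φ x‖ = ‖x‖) : Isometry (tateAlgHom F A φ hφ) :=
  isometry_tateMap (φ.restrictScalars F) (continuous_restrictScalars hφ) hφ'

lemma norm_coord_moduleMap [Fintype F] [IsUltrametricDist L'] (φ : L →ₐ[K] L') (hφ : Continuous φ)
    (hφ' : ∀ x, ‖φ x‖ = ‖x‖) (x : Tate F A L ⊗[A ⊗[F] K] M) :
    ‖D.coord L' (moduleMap F A M φ hφ x)‖ = ‖D.coord L x‖ := by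
  have h : ∀ s, ‖tateAlgHom F A φ hφ s‖ = ‖s‖ :=
    (AddMonoidHomClass.isometry_iff_norm _).1 (isometry_tateAlgHom φ hφ hφ')
  have h' : ∀ i, ‖D.coord L' (moduleMap F A M φ hφ x) i‖ = ‖D.coord L x i‖ := fun i => by
    rw [coord_moduleMap, h]
  refine le_antisymm ((pi_norm_le_iff_of_nonneg (norm_nonneg _)).2 fun i => ?_)
    ((pi_norm_le_iff_of_nonneg (norm_nonneg _)).2 fun i => ?_)
  · rw [h']; exact norm_le_pi_norm _ i
  · rw [← h']; exact norm_le_pi_norm _ i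

/-- A limit of elements of `L⟨A⟩ ⊗ M` in `L'⟨A⟩ ⊗ M` lies in `L⟨A⟩ ⊗ M`. -/
lemma exists_moduleMap_eq [Fintype F] [IsUltrametricDist L'] (φ : L →ₐ[K] L') (hφ : Continuous φ)
    (hφ' : ∀ x, ‖φ x‖ = ‖x‖) (x : Tate F A L' ⊗[A ⊗[F] K] M)
    (h : ∀ ε > 0, ∃ y, ‖D.coord L' (x - moduleMap F A M φ hφ y)‖ < ε) :
    ∃ y, moduleMap F A M φ hφ y = x := by
  have hiso := isometry_tateAlgHom (F := F) (A := A) φ hφ hφ'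
  -- The range is closed, being the isometric image of a complete space.
  have hc : ∀ i, D.coord L' x i ∈ Set.range (tateAlgHom F A φ hφ) := fun i => by
    rw [← hiso.isClosedEmbedding.isClosed_range.closure_eq, Metric.mem_closure_iff]
    intro ε hε
    obtain ⟨y, hy⟩ := h ε hε
    refine ⟨_, ⟨D.coord L y i, rfl⟩, ?_⟩
    rw [dist_eq_norm, ← coord_moduleMap, ← Pi.sub_apply, ← map_sub]
    exact (norm_le_pi_norm _ i).trans_lt hy
  choose t ht using hc
  refine ⟨∑ i, t i • ((1 : Tate F A L) ⊗ₜ[A ⊗[F] K] D.gen i), ?_⟩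
  rw [map_sum]
  conv_rhs => rw [← D.sum_coord_smul x]
  refine Finset.sum_congr rfl fun i _ => ?_
  rw [moduleMap_smul, ht, moduleMap_tmul, map_one]

/-- The map preserves the norm of the coordinate vector, and the coordinates are injective. -/
lemma moduleMap_injective (D : DualFrame (A ⊗[F] K) M) [Fintype F] [IsUltrametricDist L']
    (φ : L →ₐ[K] L') (hφ : Continuous φ) (hφ' : ∀ x, ‖φ x‖ = ‖x‖) :
    Function.Injective (moduleMap F A M φ hφ) := by
  rw [injective_iff_map_eq_zero]
  intro x hx
  have h := D.norm_coord_moduleMap φ hφ hφ' x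
  rw [hx, map_zero, norm_zero, eq_comm, norm_eq_zero] at h
  exact D.coord_injective (h.trans (map_zero _).symm)

end DualFrame

namespace AMotive

variable [Fintype F] [Algebra A K] [IsScalarTower F A K] (𝔐 : AMotive F A K M)
  (hL : JInvertible F A K L)

lemma frobTate_smul (s : Tate F A L) (x : Tate F A L ⊗[A ⊗[F] K] M) :
    𝔐.frobTate hL (s • x) = tateTau F A L s • 𝔐.frobTate hL x := by
  induction x using TensorProduct.induction_on with
  | zero => simp
  | tmul t m =>
    rw [TensorProduct.smul_tmul', frobTate_tmul, frobTate_tmul, smul_eq_mul, map_mul, mul_smul]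
  | add x y hx hy => rw [smul_add, map_add, map_add, hx, hy, smul_add]

/-- `τ_M` is bounded of degree `q`. -/
lemma exists_norm_coord_frobTate_le : ∃ C : ℝ, 0 < C ∧ ∀ x,
    ‖D.coord L (𝔐.frobTate hL x)‖ ≤ C * ‖D.coord L x‖ ^ Fintype.card F := by
  refine ⟨1 + ∑ i, ‖D.coord L (𝔐.frobTate hL (1 ⊗ₜ D.gen i))‖,
    by positivity, fun x => ?_⟩
  conv_lhs => rw [← D.sum_coord_smul x, map_sum, map_sum]
  refine (norm_sum_le _ _).trans ?_
  rw [add_mul, one_mul, Finset.sum_mul]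
  refine le_add_of_nonneg_of_le (by positivity) (Finset.sum_le_sum fun i _ => ?_)
  rw [frobTate_smul, map_smul, mul_comm]
  refine (norm_smul_le _ _).trans (mul_le_mul_of_nonneg_right ?_ (norm_nonneg _))
  exact (norm_tateTau_le _).trans
    (pow_le_pow_left₀ (norm_nonneg _) (norm_le_pi_norm _ i) _)

/-- `τ_M` is contracting near `0`. -/
lemma exists_tendsto_frobTate_iterate : ∃ ε : ℝ, 0 < ε ∧ ∀ x, ‖D.coord L x‖ < ε →
    Filter.Tendsto (fun k : ℕ => ‖D.coord L ((𝔐.frobTate hL)^[k] x)‖) Filter.atTop (nhds 0) := by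
  obtain ⟨C, hC, h⟩ := 𝔐.exists_norm_coord_frobTate_le D hL
  -- Below `1` the power `q ≥ 2` may be replaced by `2`, and below `C⁻¹ / 2` one gets `C‖y‖² ≤ ‖y‖ /
  -- 2`, so each application of `τ_M` at least halves the norm.
  refine ⟨min 1 (C⁻¹ / 2), by positivity, fun x hx => ?_⟩
  have hle : ∀ y, ‖D.coord L y‖ < min 1 (C⁻¹ / 2) →
      ‖D.coord L (𝔐.frobTate hL y)‖ ≤ ‖D.coord L y‖ / 2 := by
    intro y hy
    obtain ⟨hy1, hy2⟩ := lt_min_iff.1 hy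
    have hn := norm_nonneg (D.coord L y)
    calc _ ≤ C * ‖D.coord L y‖ ^ Fintype.card F := h y
      _ ≤ C * ‖D.coord L y‖ ^ 2 := mul_le_mul_of_nonneg_left
          (pow_le_pow_of_le_one hn hy1.le Fintype.one_lt_card) hC.le
      _ = C * ‖D.coord L y‖ * ‖D.coord L y‖ := by ring
      _ ≤ C * (C⁻¹ / 2) * ‖D.coord L y‖ := by gcongr
      _ = ‖D.coord L y‖ / 2 := by rw [← mul_div_assoc, mul_inv_cancel₀ hC.ne']; ring
  have hk : ∀ k : ℕ, ‖D.coord L ((𝔐.frobTate hL)^[k] x)‖ ≤ ‖D.coord L x‖ * (1 / 2) ^ k := by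
    intro k
    induction k with
    | zero => simp
    | succ k ih =>
      rw [Function.iterate_succ_apply']
      refine (hle _ (ih.trans_lt (lt_of_le_of_lt ?_ hx))).trans ?_
      · exact mul_le_of_le_one_right (norm_nonneg _) (pow_le_one₀ (by norm_num) (by norm_num))
      · rw [pow_succ]; linarith
  refine squeeze_zero (fun _ => norm_nonneg _) hk ?_
  have := (tendsto_pow_atTop_nhds_zero_of_lt_one (r := (1 / 2 : ℝ)) (by norm_num)
    (by norm_num)).const_mul ‖D.coord L x‖
  rwa [mul_zero] at this

/-- The elements fixed by `τ_M` form a discrete subgroup. -/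
lemma exists_eq_zero_of_norm_coord_lt : ∃ ε : ℝ, 0 < ε ∧ ∀ x, ‖D.coord L x‖ < ε →
    x = 𝔐.frobTate hL x → x = 0 := by
  obtain ⟨ε, hε, h⟩ := 𝔐.exists_tendsto_frobTate_iterate D hL
  refine ⟨ε, hε, fun x hx hfix => ?_⟩
  have h1 := h x hx
  simp only [fun k => Function.iterate_fixed hfix.symm k] at h1
  have h2 := tendsto_nhds_unique h1 tendsto_const_nhds
  exact D.coord_injective ((norm_eq_zero.1 h2.symm).trans (map_zero _).symm)

end AMotive

end Frame

/-! ### Galois descent and additive Hilbert 90 at a finite level -/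

section Galois

variable {k Ω : Type*} [Field k] [Field Ω] [Algebra k Ω]

/-- A finite family of pairs `(e, e')` with `∑ e γ(e') = 1` for `γ = 1` and `0` for other `γ`. -/
lemma exists_dual_family (E : Type*) [Field E] [Algebra k E] [FiniteDimensional k E]
    [IsGalois k E] : ∃ (n : ℕ) (e e' : Fin n → E),
      ∑ j, e j * e' j = 1 ∧ ∀ γ : Gal(E/k), γ ≠ 1 → ∑ j, e j * γ (e' j) = 0 := by
  classical
  let b := Module.finBasis k E
  suffices hs : ∀ γ : Gal(E/k), ∑ j, b.traceDual j * γ (b j) = if γ = 1 then 1 else 0 from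
    ⟨_, b.traceDual, b, by simpa using hs 1, fun γ hγ => by rw [hs, if_neg hγ]⟩
  intro γ
  -- Expanding `x` in the trace-dual basis writes the identity as a linear combination of the
  -- automorphisms; by their linear independence its coefficients are forced to be `1` at the
  -- identity and `0` elsewhere.
  have h : ∀ x : E, ∑ δ : Gal(E/k), (∑ j, b.traceDual j * δ (b j)) * δ x = x := fun x => by
    conv_rhs => rw [← b.traceDual.sum_repr x]
    simp_rw [Finset.sum_mul]
    rw [Finset.sum_comm]
    refine Finset.sum_congr rfl fun j _ => ?_
    rw [Module.Basis.traceDual_repr_apply, Algebra.traceForm_apply, Algebra.smul_def,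
      trace_eq_sum_automorphisms, Finset.sum_mul]
    refine Finset.sum_congr rfl fun δ _ => ?_
    rw [map_mul]
    ring
  have hli : LinearIndependent E fun δ : Gal(E/k) => (δ : E →ₐ[k] E).toLinearMap :=
    (linearIndependent_toLinearMap k E E).comp (fun δ : Gal(E/k) => (δ : E →ₐ[k] E))
      fun _ _ h => AlgEquiv.ext fun x => DFunLike.congr_fun h x
  have h0 := Fintype.linearIndependent_iff.1 hli
    (fun δ => ∑ j, b.traceDual j * δ (b j) - if δ = 1 then 1 else 0) (by
      ext x
      simp only [LinearMap.sum_apply, LinearMap.smul_apply, smul_eq_mul, sub_mul,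
        Finset.sum_sub_distrib, LinearMap.zero_apply, AlgHom.toLinearMap_apply,
        ite_mul, one_mul, zero_mul, Finset.sum_ite_eq', Finset.mem_univ, if_true]
      exact sub_eq_zero.2 (h x)) γ
  exact sub_eq_zero.1 h0

namespace FiniteGalois

variable (E : FiniteGaloisIntermediateField k Ω)

/-- The restriction `Gal(Ω/k) → Gal(E/k)`. -/
noncomputable abbrev res : Gal(Ω/k) →* Gal(E/k) := AlgEquiv.restrictNormalHom E

/-- A set-theoretic section of the restriction `Gal(Ω/k) → Gal(E/k)`. -/
noncomputable def lift [IsGalois k Ω] : Gal(E/k) → Gal(Ω/k) :=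
  Function.surjInv (AlgEquiv.restrictNormalHom_surjective (F := k) (K₁ := E) Ω)

lemma res_lift [IsGalois k Ω] (γ : Gal(E/k)) : res E (lift E γ) = γ := Function.surjInv_eq _ γ

lemma coe_res_apply (σ : Gal(Ω/k)) (x : E) : ((res E σ x : E) : Ω) = σ x :=
  AlgEquiv.restrictNormalHom_apply _ σ x

lemma lift_apply [IsGalois k Ω] (γ : Gal(E/k)) (x : E) : lift E γ (x : Ω) = (γ x : E) := by
  rw [← coe_res_apply, res_lift]

end FiniteGalois

open FiniteGalois

variable {A V S : Type*} [CommRing A] [AddCommGroup V] [Module A V]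
  [CommRing S] [Module S V] (ρ : Representation A Gal(Ω/k) V) (θ : Ω →+* S)

/-- The action of `Gal(Ω/k)` on `V` is semilinear. -/
def IsSemilinearRep : Prop := ∀ σ ℓ x, ρ σ (θ ℓ • x) = θ (σ ℓ) • ρ σ x

/-- `W` is a `k`-subspace of `V` all of whose elements are invariant. -/
structure IsInvariantForm (W : AddSubgroup V) : Prop where
  smul_mem : ∀ (c : k), ∀ w ∈ W, θ (algebraMap k Ω c) • w ∈ W
  map_eq : ∀ σ, ∀ w ∈ W, ρ σ w = w

/-- The `E`-subspace spanned by `W`. -/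
def levelSpan (W : AddSubgroup V) (E : FiniteGaloisIntermediateField k Ω) : AddSubgroup V :=
  AddSubgroup.closure {x | ∃ e : E, ∃ w ∈ W, x = θ e • w}

/-- The trace from level `E`. -/
noncomputable def levelTrace [IsGalois k Ω] (E : FiniteGaloisIntermediateField k Ω) (x : V) : V :=
  ∑ γ : Gal(E/k), ρ (lift E γ) x

variable {ρ θ} {W : AddSubgroup V} {E : FiniteGaloisIntermediateField k Ω}

lemma map_eq_of_res_eq {x : V} (hx : ∀ σ, res E σ = 1 → ρ σ x = x) {σ σ' : Gal(Ω/k)}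
    (h : res E σ = res E σ') : ρ σ x = ρ σ' x := by
  have h1 := hx (σ'⁻¹ * σ) (by rw [map_mul, map_inv, h, inv_mul_cancel])
  rw [map_mul, Module.End.mul_apply] at h1
  calc ρ σ x = ρ σ' (ρ σ'⁻¹ (ρ σ x)) := by
        rw [← Module.End.mul_apply, ← map_mul, mul_inv_cancel, map_one, Module.End.one_apply]
    _ = ρ σ' x := by rw [h1]

lemma smul_mem_levelSpan (e : E) {x : V} (hx : x ∈ levelSpan θ W E) :
    θ e • x ∈ levelSpan θ W E := by
  refine AddSubgroup.closure_induction ?_ ?_ ?_ ?_ hx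
  · rintro _ ⟨e', w, hw, rfl⟩
    exact AddSubgroup.subset_closure ⟨e * e', w, hw, by rw [smul_smul, ← map_mul]; rfl⟩
  · rw [smul_zero]; exact zero_mem _
  · intro u v _ _ hu hv; rw [smul_add]; exact add_mem hu hv
  · intro u _ hu; rw [smul_neg]; exact neg_mem hu

lemma le_levelSpan : W ≤ levelSpan θ W E := fun w hw =>
  AddSubgroup.subset_closure ⟨1, w, hw, by
    rw [show ((1 : E) : Ω) = 1 from rfl, map_one, one_smul]⟩

lemma levelSpan_mono {E' : FiniteGaloisIntermediateField k Ω} (h : E ≤ E') :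
    levelSpan θ W E ≤ levelSpan θ W E' :=
  AddSubgroup.closure_mono fun _ ⟨e, w, hw, hx⟩ => ⟨⟨e, h e.2⟩, w, hw, hx⟩
lemma map_eq_of_mem_levelSpan (hρ : IsSemilinearRep ρ θ) (hW : IsInvariantForm ρ θ W)
    {x : V} (hx : x ∈ levelSpan θ W E) (σ : Gal(Ω/k)) (hσ : res E σ = 1) : ρ σ x = x := by
  refine AddSubgroup.closure_induction ?_ ?_ ?_ ?_ hx
  · rintro _ ⟨e, w, hw, rfl⟩
    rw [hρ, hW.map_eq σ w hw, ← coe_res_apply, hσ, AlgEquiv.one_apply]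
  · rw [map_zero]
  · intro u v _ _ hu hv; rw [map_add, hu, hv]
  · intro u _ hu; rw [map_neg, hu]

variable [IsGalois k Ω]

/-- On a generator `e • w` the sum over the Galois group is `Tr(e) • w`, with `Tr(e)` in `k`. -/
lemma levelTrace_mem (hρ : IsSemilinearRep ρ θ) (hW : IsInvariantForm ρ θ W)
    {x : V} (hx : x ∈ levelSpan θ W E) : levelTrace ρ E x ∈ W := by
  refine AddSubgroup.closure_induction ?_ ?_ ?_ ?_ hx
  · rintro _ ⟨e, w, hw, rfl⟩
    have h : levelTrace ρ E (θ e • w) = θ (algebraMap k Ω (Algebra.trace k E e)) • w := by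
      simp_rw [levelTrace, hρ _ _ _, hW.map_eq _ w hw, lift_apply]
      rw [← Finset.sum_smul, ← map_sum, IsScalarTower.algebraMap_apply k E Ω,
        trace_eq_sum_automorphisms, map_sum (algebraMap E Ω)]
      rfl
    rw [h]
    exact hW.smul_mem _ w hw
  · simp only [levelTrace, map_zero, Finset.sum_const_zero]; exact zero_mem _
  · intro u v _ _ hu hv
    simp only [levelTrace, map_add, Finset.sum_add_distrib] at hu hv ⊢
    exact add_mem hu hv
  · intro u _ hu
    simp only [levelTrace, map_neg, Finset.sum_neg_distrib] at hu ⊢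
    exact neg_mem hu

/-- A dual family recovers `x` from its traces: `x = ∑ e_j Tr(e'_j x)`. Membership at level `E` thus
becomes a condition on traces, which is stable under limits once `W` is closed. -/
lemma mem_levelSpan_of_levelTrace_mem (hρ : IsSemilinearRep ρ θ) {x : V}
    (hx : ∀ σ, res E σ = 1 → ρ σ x = x) (h : ∀ e : E, levelTrace ρ E (θ e • x) ∈ W) :
    x ∈ levelSpan θ W E := by
  obtain ⟨n, e, e', he, he'⟩ := exists_dual_family (k := k) E
  have key : ∑ j, θ (e j) • levelTrace ρ E (θ (e' j) • x) = x := by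
    simp_rw [levelTrace, hρ _ _ _, Finset.smul_sum, smul_smul, lift_apply]
    rw [Finset.sum_comm]
    simp_rw [← map_mul, ← Finset.sum_smul, ← map_sum]
    have h1 : ∀ γ : Gal(E/k), ∑ j, (e j : Ω) * (γ (e' j) : E) = ((∑ j, e j * γ (e' j) : E) : Ω) :=
      fun γ => (map_sum (algebraMap E Ω) (fun j => e j * γ (e' j)) Finset.univ).symm
    simp_rw [h1]
    rw [Finset.sum_eq_single 1
      (fun γ _ hγ => by rw [he' γ hγ, ZeroMemClass.coe_zero, map_zero, zero_smul])
      (fun h => absurd (Finset.mem_univ _) h)]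
    simp_rw [AlgEquiv.one_apply]
    rw [he, OneMemClass.coe_one, map_one, one_smul]
    exact hx _ (res_lift E 1)
  rw [← key]
  exact sum_mem fun j _ => AddSubgroup.subset_closure ⟨e j, _, h _, rfl⟩

/-- There is an element of trace `1`. -/
lemma exists_sum_lift_eq_one (E : FiniteGaloisIntermediateField k Ω) :
    ∃ z : E, ∑ γ : Gal(E/k), ((γ z : E) : Ω) = 1 := by
  obtain ⟨z, hz⟩ := Algebra.trace_surjective k E 1
  refine ⟨z, ?_⟩
  have h := trace_eq_sum_automorphisms (K := k) z
  rw [hz, map_one] at h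
  refine ((map_sum (algebraMap E Ω) (fun γ : Gal(E/k) => γ z) Finset.univ).symm.trans ?_)
  rw [← h, map_one]

/-- For `z` of trace `1` and `x` invariant, `x = Tr(z x)`. -/
lemma mem_of_mem_levelSpan_of_forall_map_eq (hρ : IsSemilinearRep ρ θ)
    (hW : IsInvariantForm ρ θ W) {x : V} (hx : x ∈ levelSpan θ W E) (h : ∀ σ, ρ σ x = x) :
    x ∈ W := by
  obtain ⟨z, hz⟩ := exists_sum_lift_eq_one E
  have h1 := levelTrace_mem hρ hW (smul_mem_levelSpan z hx)
  simp_rw [levelTrace, hρ _ _ _, h, lift_apply] at h1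
  rwa [← Finset.sum_smul, ← map_sum, hz, map_one, one_smul] at h1

/-- A cocycle that vanishes on an open subgroup is the coboundary of an explicit element. -/
lemma exists_map_sub_eq (hρ : IsSemilinearRep ρ θ) {c : Gal(Ω/k) → V}
    (hc : ∀ σ σ', c (σ * σ') = c σ + ρ σ (c σ')) (h0 : ∀ σ, res E σ = 1 → c σ = 0) :
    ∃ z : E, ∀ σ, c σ = ρ σ (-∑ γ : Gal(E/k), θ (γ z : E) • c (lift E γ)) -
      (-∑ γ : Gal(E/k), θ (γ z : E) • c (lift E γ)) := by
  obtain ⟨z, hz⟩ := exists_sum_lift_eq_one E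
  refine ⟨z, fun σ => ?_⟩
  have hres : ∀ {σ σ' : Gal(Ω/k)}, res E σ = res E σ' → c σ = c σ' := fun {σ σ'} h => by
    have h1 : σ = σ' * (σ'⁻¹ * σ) := by group
    rw [h1, hc, h0 (σ'⁻¹ * σ) (by rw [map_mul, map_inv, h, inv_mul_cancel]), map_zero, add_zero]
  -- The cocycle relation gives `σ c(γ) = c(σγ) - c(σ)`. Summing over `γ` reindexes the first part
  -- and, as `z` has trace `1`, leaves exactly `-c(σ)` from the second.
  have h1 : ∀ γ : Gal(E/k), ρ σ (θ (γ z : E) • c (lift E γ)) =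
      θ ((res E σ * γ) z : E) • c (lift E (res E σ * γ)) - θ ((res E σ * γ) z : E) • c σ := by
    intro γ
    rw [hρ, ← coe_res_apply, ← smul_sub]
    congr 1
    rw [eq_sub_iff_add_eq, add_comm, ← hc]
    exact hres (by rw [map_mul, res_lift, res_lift])
  rw [map_neg, map_sum]
  simp_rw [h1]
  rw [Finset.sum_sub_distrib,
    Fintype.sum_equiv (Equiv.mulLeft (res E σ)) (fun γ => θ ((res E σ * γ) z : E) •
      c (lift E (res E σ * γ))) (fun γ => θ (γ z : E) • c (lift E γ)) (fun _ => rfl),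
    Fintype.sum_equiv (Equiv.mulLeft (res E σ)) (fun γ => θ ((res E σ * γ) z : E) • c σ)
      (fun γ => θ (γ z : E) • c σ) (fun _ => rfl), ← Finset.sum_smul, ← map_sum, hz, map_one,
    one_smul]
  abel

end Galois

open FiniteGalois

/-! ### The Galois action on `M ⊗ ℂ_∞⟨A⟩` and density of the elements of finite level -/

section ComplexMod

variable {F K : Type*} [Field F] [Fintype F] [Field K] [Algebra F K] (P : ClosedPoint F K)
  (M : Type*) [AddCommGroup M] [Module ((CoordRing P) ⊗[F] K) M]

noncomputable instance :
    Module (Tate F (CoordRing P) (LocalField P)) (LocalMod P M) := inferInstanceAs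
  (Module (Tate F (CoordRing P) (LocalField P))
    (Tate F (CoordRing P) (LocalField P) ⊗[(CoordRing P) ⊗[F] K] M))

/-- The finite Galois extensions of `K_∞` in `K_∞^s`. -/
abbrev LocalLevel : Type _ := FiniteGaloisIntermediateField (LocalField P) (LocalSep P)

/-- The homomorphism `K_∞^s → ℂ_∞⟨A⟩`. -/
noncomputable def sepScalar : LocalSep P →+* Tate F (CoordRing P) (LocalComplex P) :=
  (tateScalar F (CoordRing P) (LocalComplex P)).comp (sepToComplex P).toRingHom

/-- The image of `M ⊗ K_∞⟨A⟩` in `M ⊗ ℂ_∞⟨A⟩`. -/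
noncomputable def localForm : AddSubgroup (ComplexMod P M) :=
  (localToComplex P M).range.toAddSubgroup

/-- The `E`-subspace of `M ⊗ ℂ_∞⟨A⟩` spanned by `M ⊗ K_∞⟨A⟩`. -/
noncomputable abbrev complexLevel (E : LocalLevel P) : AddSubgroup (ComplexMod P M) :=
  levelSpan (k := LocalField P) (sepScalar P) (localForm P M) E

variable {P M}
lemma norm_galComplex (σ : LocalGal P) (x : LocalComplex P) : ‖galComplex P σ x‖ = ‖x‖ := by
  induction x using UniformSpace.Completion.induction_on with
  | hp => exact isClosed_eq (continuous_galComplex P σ).norm continuous_norm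
  | ih x =>
    rw [← sepToComplex_apply, galComplex_sepToComplex]
    exact (UniformSpace.Completion.norm_coe (σ x)).trans
      ((spectralNorm_eq_of_equiv σ x).symm.trans (UniformSpace.Completion.norm_coe x).symm)

lemma norm_toAlgHom_localComplex (x : LocalField P) :
    ‖IsScalarTower.toAlgHom K (LocalField P) (LocalComplex P) x‖ = ‖x‖ :=
  norm_algebraMap_localComplex P x

lemma galRep_smul (σ : LocalGal P) (s : Tate F (CoordRing P) (LocalComplex P))
    (x : ComplexMod P M) : galRep P M σ (s • x) =
      tateAlgHom F (CoordRing P) (galComplex P σ) (continuous_galComplex P σ) s • galRep P M σ x :=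
  moduleMap_smul _ _ _ _

lemma isSemilinearRep_galRep : IsSemilinearRep (galRep P M) (sepScalar P) := fun σ ℓ x => by
  rw [galRep_smul]
  congr 1
  refine (tateMap_tateScalar ((galComplex P σ).restrictScalars F)
    (continuous_restrictScalars (continuous_galComplex P σ)) _).trans ?_
  exact congrArg (tateScalar F (CoordRing P) (LocalComplex P)) (galComplex_sepToComplex P σ ℓ)

lemma galRep_localToComplex (σ : LocalGal P) (y : LocalMod P M) :
    galRep P M σ (localToComplex P M y) = localToComplex P M y := by
  have h : (galComplex P σ).comp (IsScalarTower.toAlgHom K (LocalField P) (LocalComplex P)) =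
      IsScalarTower.toAlgHom K (LocalField P) (LocalComplex P) := AlgHom.ext fun x => by
    change galComplex P σ (algebraMap (LocalField P) (LocalComplex P) x) =
      algebraMap (LocalField P) (LocalComplex P) x
    rw [← sepToComplex_algebraMap, galComplex_sepToComplex, AlgEquiv.commutes]
  refine (moduleMap_comp (galComplex P σ) (continuous_galComplex P σ) _ (continuous_localField P)
    (by rw [h]; exact continuous_localField P) y).trans ?_
  simp only [h]
  rfl

lemma isInvariantForm_localForm :
    IsInvariantForm (galRep P M) (sepScalar P) (localForm P M) where
  smul_mem c := by
    rintro _ ⟨y, rfl⟩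
    refine ⟨tateScalar F (CoordRing P) (LocalField P) c • y, ?_⟩
    refine (moduleMap_smul _ (continuous_localField P) _ _).trans ?_
    congr 1
    exact tateMap_tateScalar _ (continuous_restrictScalars (continuous_localField P)) _
  map_eq σ := by
    rintro _ ⟨y, rfl⟩
    exact galRep_localToComplex σ y

variable (D : DualFrame ((CoordRing P) ⊗[F] K) M)

/-- The norm on `M ⊗ ℂ_∞⟨A⟩` given by the coordinates. -/
noncomputable def complexNorm (x : ComplexMod P M) : ℝ := ‖D.coord (LocalComplex P) x‖

lemma complexNorm_nonneg (x : ComplexMod P M) : 0 ≤ complexNorm D x := norm_nonneg _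

lemma complexNorm_zero : complexNorm D 0 = 0 :=
  (congrArg norm (map_zero (D.coord (LocalComplex P)))).trans norm_zero

lemma complexNorm_add_le (x y : ComplexMod P M) :
    complexNorm D (x + y) ≤ complexNorm D x + complexNorm D y :=
  (congrArg norm (map_add (D.coord (LocalComplex P)) x y)).trans_le (norm_add_le _ _)

lemma complexNorm_sub_le (x y : ComplexMod P M) :
    complexNorm D (x - y) ≤ complexNorm D x + complexNorm D y :=
  (congrArg norm (map_sub (D.coord (LocalComplex P)) x y)).trans_le (norm_sub_le _ _)

lemma complexNorm_sum_le {ι : Type*} (s : Finset ι) (f : ι → ComplexMod P M) :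
    complexNorm D (∑ i ∈ s, f i) ≤ ∑ i ∈ s, complexNorm D (f i) :=
  (congrArg norm (map_sum (D.coord (LocalComplex P)) f s)).trans_le (norm_sum_le _ _)

lemma complexNorm_smul_le (s : Tate F (CoordRing P) (LocalComplex P)) (x : ComplexMod P M) :
    complexNorm D (s • x) ≤ ‖s‖ * complexNorm D x :=
  (congrArg norm (map_smul (D.coord (LocalComplex P)) s x)).trans_le (norm_smul_le _ _)

lemma complexNorm_galRep (σ : LocalGal P) (x : ComplexMod P M) :
    complexNorm D (galRep P M σ x) = complexNorm D x :=
  D.norm_coord_moduleMap _ (continuous_galComplex P σ) (norm_galComplex σ) x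

/-- `M ⊗ K_∞⟨A⟩` is closed in `M ⊗ ℂ_∞⟨A⟩` for the coordinate norm. -/
lemma mem_localForm_of_approx (x : ComplexMod P M)
    (h : ∀ ε > 0, ∃ y ∈ localForm P M, complexNorm D (x - y) < ε) : x ∈ localForm P M := by
  refine D.exists_moduleMap_eq _ (continuous_localField P) norm_toAlgHom_localComplex x
    fun ε hε => ?_
  obtain ⟨_, ⟨y, rfl⟩, hy⟩ := h ε hε
  exact ⟨y, hy⟩

lemma localToComplex_injective (D : DualFrame ((CoordRing P) ⊗[F] K) M) :
    Function.Injective (localToComplex P M) :=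
  D.moduleMap_injective _ (continuous_localField P) norm_toAlgHom_localComplex

lemma exists_mem_levelSpan_add {x y : ComplexMod P M}
    (hx : ∃ E, x ∈ complexLevel P M E)
    (hy : ∃ E, y ∈ complexLevel P M E) :
    ∃ E, x + y ∈ complexLevel P M E := by
  obtain ⟨E, hx⟩ := hx
  obtain ⟨E', hy⟩ := hy
  exact ⟨E ⊔ E', add_mem (levelSpan_mono le_sup_left hx) (levelSpan_mono le_sup_right hy)⟩

lemma exists_mem_levelSpan_smul {x : ComplexMod P M} (ℓ : LocalSep P)
    (hx : ∃ E, x ∈ complexLevel P M E) :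
    ∃ E, sepScalar P ℓ • x ∈ complexLevel P M E := by
  obtain ⟨E, hx⟩ := hx
  have hℓ : ℓ ∈ (FiniteGaloisIntermediateField.adjoin (LocalField P) {ℓ}).toIntermediateField :=
    FiniteGaloisIntermediateField.subset_adjoin _ _ rfl
  exact ⟨E ⊔ FiniteGaloisIntermediateField.adjoin (LocalField P) {ℓ}, smul_mem_levelSpan
    ⟨ℓ, (FiniteGaloisIntermediateField.le_iff _ _).1 le_sup_right hℓ⟩
    (levelSpan_mono le_sup_left hx)⟩

/-- Only finitely many elements of `K_∞^s` occur in `y`, and they lie in a common finite Galois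
extension. -/
lemma exists_toTate_tmul_mem_levelSpan (y : (CoordRing P) ⊗[F] (LocalSep P)) (m : M) :
    ∃ E, (show ComplexMod P M from toTate F (CoordRing P) (LocalComplex P)
      (Algebra.TensorProduct.map (AlgHom.id F (CoordRing P))
        ((sepToComplex P).restrictScalars F) y) ⊗ₜ m) ∈
          complexLevel P M E := by
  induction y using TensorProduct.induction_on with
  | zero =>
    refine ⟨⊥, ?_⟩
    rw [map_zero, map_zero, TensorProduct.zero_tmul]
    exact zero_mem _
  | tmul a ℓ =>
    have h : (show ComplexMod P M from toTate F (CoordRing P) (LocalComplex P)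
      (Algebra.TensorProduct.map (AlgHom.id F (CoordRing P))
        ((sepToComplex P).restrictScalars F) (a ⊗ₜ ℓ)) ⊗ₜ m) = sepScalar P ℓ •
          localToComplex P M (toTate F (CoordRing P) (LocalField P) (a ⊗ₜ 1) ⊗ₜ m) := by
      have h1 : localToComplex P M (toTate F (CoordRing P) (LocalField P) (a ⊗ₜ 1) ⊗ₜ m) =
          toTate F (CoordRing P) (LocalComplex P) (a ⊗ₜ 1) ⊗ₜ m := by
        refine (moduleMap_tmul _ _ _ _).trans ?_
        rw [tateAlgHom_apply, tateMap_toTate, Algebra.TensorProduct.map_tmul, map_one]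
        rfl
      rw [h1]
      refine Eq.trans ?_ (TensorProduct.smul_tmul' _ _ _).symm
      rw [smul_eq_mul]
      change _ = (toTate F (CoordRing P) (LocalComplex P) (1 ⊗ₜ sepToComplex P ℓ) * _) ⊗ₜ[_] m
      rw [← map_mul, Algebra.TensorProduct.tmul_mul_tmul, one_mul, mul_one]
      rfl
    rw [h]
    exact exists_mem_levelSpan_smul ℓ ⟨⊥, le_levelSpan ⟨_, rfl⟩⟩
  | add x y hx hy =>
    rw [map_add, map_add, TensorProduct.add_tmul]
    exact exists_mem_levelSpan_add hx hy

/-- The elements of finite level are dense in `M ⊗ ℂ_∞⟨A⟩`. -/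
lemma exists_mem_levelSpan_complexNorm_lt (x : ComplexMod P M) {ε : ℝ} (hε : 0 < ε) :
    ∃ E, ∃ n ∈ complexLevel P M E, complexNorm D (x - n) < ε := by
  suffices h : ∀ (x : Tate F (CoordRing P) (LocalComplex P) ⊗[(CoordRing P) ⊗[F] K] M), ∀ ε > 0,
      ∃ n : ComplexMod P M, (∃ E, n ∈ complexLevel P M E) ∧
        complexNorm D ((show ComplexMod P M from x) - n) < ε by
    obtain ⟨n, ⟨E, hn⟩, hlt⟩ := h x ε hε
    exact ⟨E, n, hn, hlt⟩
  intro x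
  induction x using TensorProduct.induction_on with
  | zero =>
    exact fun ε hε => ⟨0, ⟨⊥, zero_mem _⟩, by
      rw [sub_zero]; exact (complexNorm_zero D).trans_lt hε⟩
  | tmul s m =>
    intro ε hε
    have hC := complexNorm_nonneg D
      (show ComplexMod P M from (1 : Tate F (CoordRing P) (LocalComplex P)) ⊗ₜ m)
    set C := complexNorm D
      (show ComplexMod P M from (1 : Tate F (CoordRing P) (LocalComplex P)) ⊗ₜ m) with hCdef
    -- Dividing by `C + 1` rather than `C` covers the case `C = 0`.
    obtain ⟨y, hy⟩ := exists_norm_sub_toTate_map_lt ((sepToComplex P).restrictScalars F)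
      (denseRange_sepToComplex P) s (ε := ε / (C + 1)) (by positivity)
    refine ⟨_, exists_toTate_tmul_mem_levelSpan y m, ?_⟩
    set t := toTate F (CoordRing P) (LocalComplex P) (Algebra.TensorProduct.map
      (AlgHom.id F (CoordRing P)) ((sepToComplex P).restrictScalars F) y)
    have h1 : (show ComplexMod P M from s ⊗ₜ m) - (show ComplexMod P M from t ⊗ₜ m) =
        (s - t) • (show ComplexMod P M from
          (1 : Tate F (CoordRing P) (LocalComplex P)) ⊗ₜ m) := by
      refine (TensorProduct.sub_tmul s t m).symm.trans ?_
      refine Eq.trans ?_ (TensorProduct.smul_tmul' _ _ _).symm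
      rw [smul_eq_mul, mul_one]
    rw [h1]
    calc _ ≤ ‖s - t‖ * C := complexNorm_smul_le D _ _
      _ ≤ ε / (C + 1) * C := mul_le_mul_of_nonneg_right hy.le hC
      _ < ε := by
        rw [div_mul_eq_mul_div, div_lt_iff₀ (by positivity)]
        nlinarith
  | add x y hx hy =>
    intro ε hε
    obtain ⟨n, hn, hn'⟩ := hx _ (half_pos hε)
    obtain ⟨n', hm, hm'⟩ := hy _ (half_pos hε)
    refine ⟨n + n', exists_mem_levelSpan_add hn hm, ?_⟩
    have h1 : (show ComplexMod P M from x + y) - (n + n') =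
      ((show ComplexMod P M from x) - n) + ((show ComplexMod P M from y) - n') :=
        add_sub_add_comm (show ComplexMod P M from x) (show ComplexMod P M from y) n n'
    rw [h1]
    exact (complexNorm_add_le D _ _).trans_lt (by linarith)

end ComplexMod

/-! ### Finite levels and the Krull topology -/

section LevelTopology

variable {F K : Type*} [Field F] [Fintype F] [Field K] [Algebra F K] {P : ClosedPoint F K}

lemma res_eq_one_of_le {E E' : LocalLevel P} (h : E ≤ E') {σ : LocalGal P} (hσ : res E' σ = 1) :
    res E σ = 1 := by
  rw [← FiniteGaloisIntermediateField.mem_fixingSubgroup_iff] at hσ ⊢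
  exact IntermediateField.fixingSubgroup_antitone
    ((FiniteGaloisIntermediateField.le_iff _ _).1 h) hσ

lemma isLocallyConstant_of_res {X : Type*} {f : LocalGal P → X} (E : LocalLevel P)
    (h : ∀ σ σ', res E σ = res E σ' → f σ = f σ') : IsLocallyConstant f := by
  rw [IsLocallyConstant.iff_eventually_eq]
  intro σ
  have h1 : ∀ᶠ u in nhds (1 : LocalGal P), res E u = 1 := by
    filter_upwards [(IntermediateField.fixingSubgroup_isOpen E.toIntermediateField).mem_nhds
      (one_mem _)] with u hu
    exact (FiniteGaloisIntermediateField.mem_fixingSubgroup_iff u E).1 hu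
  have h2 : Filter.Tendsto (fun σ' : LocalGal P => σ⁻¹ * σ') (nhds σ) (nhds 1) := by
    have := (continuous_const_mul (σ⁻¹ : LocalGal P)).tendsto σ
    rwa [inv_mul_cancel] at this
  filter_upwards [h2.eventually h1] with σ' hσ'
  refine h _ _ ?_
  rw [map_mul, map_inv] at hσ'
  exact (inv_mul_eq_one.1 hσ').symm

lemma exists_level_of_isLocallyConstant {X : Type*} {f : LocalGal P → X}
    (hf : IsLocallyConstant f) : ∃ E : LocalLevel P, ∀ σ, res E σ = 1 → f σ = f 1 := by
  have h := (IsLocallyConstant.iff_eventually_eq f).1 hf 1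
  obtain ⟨E, hE⟩ := (InfiniteGalois.krullTopology_mem_nhds_one_iff_of_isGalois _).1 h
  exact ⟨E, fun σ hσ => hE ((FiniteGaloisIntermediateField.mem_fixingSubgroup_iff σ E).2 hσ)⟩

end LevelTopology

/-! ### Passage to the limit at a fixed level, and compatibility of `τ_M` with levels -/

section Descent

variable {F K : Type*} [Field F] [Fintype F] [Field K] [Algebra F K] {P : ClosedPoint F K}
  {M : Type*} [AddCommGroup M] [Module ((CoordRing P) ⊗[F] K) M]
  (D : DualFrame ((CoordRing P) ⊗[F] K) M)

/-- Continuity of the orbit map at `1`: `x` is close to an element of finite level, which is fixed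
by an open subgroup, and `G_∞` acts by isometries. -/
lemma exists_level_complexNorm_galRep_sub_lt (x : ComplexMod P M) {ε : ℝ} (hε : 0 < ε) :
    ∃ E : LocalLevel P, ∀ σ, res E σ = 1 → complexNorm D (galRep P M σ x - x) < ε := by
  obtain ⟨E, n, hn, hlt⟩ := exists_mem_levelSpan_complexNorm_lt D x (half_pos hε)
  refine ⟨E, fun σ hσ => ?_⟩
  have h := map_eq_of_mem_levelSpan isSemilinearRep_galRep isInvariantForm_localForm hn σ hσ
  have h1 : galRep P M σ x - x = galRep P M σ (x - n) - (x - n) := by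
    rw [map_sub, h]; abel
  rw [h1]
  refine (complexNorm_sub_le D _ _).trans_lt ?_
  rw [complexNorm_galRep]
  linarith

/-- The traces of `e • n k` lie in `M ⊗ K_∞⟨A⟩` and converge to those of `e • x`, since only
finitely many isometries are summed. Closedness and the trace criterion conclude. -/
lemma mem_levelSpan_of_tendsto {E : LocalLevel P} {x : ComplexMod P M} {n : ℕ → ComplexMod P M}
    (hx : ∀ σ, res E σ = 1 → galRep P M σ x = x) (hn : ∀ k, n k ∈ complexLevel P M E)
    (hlim : Filter.Tendsto (fun k => complexNorm D (x - n k)) Filter.atTop (nhds 0)) :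
    x ∈ complexLevel P M E := by
  refine mem_levelSpan_of_levelTrace_mem isSemilinearRep_galRep hx fun e =>
    mem_localForm_of_approx D _ fun ε hε => ?_
  set C : ℝ := Fintype.card Gal(E/LocalField P) * ‖sepScalar P e‖ with hC
  have hlim' : Filter.Tendsto (fun k => C * complexNorm D (x - n k)) Filter.atTop (nhds 0) := by
    have := hlim.const_mul C
    rwa [mul_zero] at this
  obtain ⟨k, hk⟩ := (hlim'.eventually_lt_const hε).exists
  refine ⟨_, levelTrace_mem isSemilinearRep_galRep isInvariantForm_localForm
    (smul_mem_levelSpan e (hn k)), lt_of_le_of_lt ?_ hk⟩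
  have h1 : levelTrace (galRep P M) E (sepScalar P e • x) -
      levelTrace (galRep P M) E (sepScalar P e • n k) =
      ∑ γ : Gal(E/LocalField P), galRep P M (lift E γ) (sepScalar P e • (x - n k)) := by
    simp only [levelTrace, ← Finset.sum_sub_distrib, smul_sub, map_sub]
  rw [h1]
  refine (complexNorm_sum_le D _ _).trans ?_
  simp only [complexNorm_galRep, Finset.sum_const, Finset.card_univ, nsmul_eq_mul]
  rw [hC, mul_assoc]
  exact mul_le_mul_of_nonneg_left (complexNorm_smul_le D _ _) (Nat.cast_nonneg _)

namespace AMotive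

variable (𝔐 : AMotive F (CoordRing P) K M) (hL : JInvertible F (CoordRing P) K (LocalField P))
  (hC : JInvertible F (CoordRing P) K (LocalComplex P))

lemma frobComplex_smul (s : Tate F (CoordRing P) (LocalComplex P)) (x : ComplexMod P M) :
    𝔐.frobComplex hC (s • x) =
      tateTau F (CoordRing P) (LocalComplex P) s • 𝔐.frobComplex hC x :=
  𝔐.frobTate_smul hC s x

lemma frobComplex_sepScalar_smul (ℓ : LocalSep P) (x : ComplexMod P M) :
    𝔐.frobComplex hC (sepScalar P ℓ • x) =
      sepScalar P (ℓ ^ Fintype.card F) • 𝔐.frobComplex hC x := by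
  rw [frobComplex_smul]
  congr 1
  refine (tateTau_tateScalar _).trans ?_
  rw [← map_pow]
  rfl

lemma frobComplex_localToComplex (y : LocalMod P M) :
    𝔐.frobComplex hC (localToComplex P M y) = localToComplex P M (𝔐.frobLocal hL y) :=
  (𝔐.moduleMap_frobTate hL hC _ (continuous_localField P) y).symm

lemma frobComplex_galRep (σ : LocalGal P) (x : ComplexMod P M) :
    𝔐.frobComplex hC (galRep P M σ x) = galRep P M σ (𝔐.frobComplex hC x) :=
  (𝔐.moduleMap_frobTate hC hC _ (continuous_galComplex P σ) x).symm

lemma idSubFrobComplex_apply (x : ComplexMod P M) :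
    𝔐.idSubFrobComplex hC x = x - 𝔐.frobComplex hC x := rfl

lemma idSubFrobLocal_apply (y : LocalMod P M) :
    𝔐.idSubFrobLocal hL y = y - 𝔐.frobLocal hL y := rfl

lemma idSubFrobComplex_galRep (σ : LocalGal P) (x : ComplexMod P M) :
    𝔐.idSubFrobComplex hC (galRep P M σ x) = galRep P M σ (𝔐.idSubFrobComplex hC x) := by
  rw [idSubFrobComplex_apply, idSubFrobComplex_apply, map_sub, frobComplex_galRep]

lemma idSubFrobComplex_localToComplex (y : LocalMod P M) :
    𝔐.idSubFrobComplex hC (localToComplex P M y) =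
      localToComplex P M (𝔐.idSubFrobLocal hL y) := by
  rw [idSubFrobComplex_apply, idSubFrobLocal_apply, map_sub, frobComplex_localToComplex]

lemma mem_betti_iff (x : ComplexMod P M) :
    x ∈ 𝔐.betti hC ↔ 𝔐.idSubFrobComplex hC x = 0 := by
  rw [mem_betti, idSubFrobComplex_apply, sub_eq_zero]

/-- `τ_M` is semilinear for `e ↦ e^q`, which preserves `E`, and it maps `M ⊗ K_∞⟨A⟩` to itself. -/
lemma frobComplex_mem_complexLevel (hL : JInvertible F (CoordRing P) K (LocalField P))
    {E : LocalLevel P} {x : ComplexMod P M}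
    (hx : x ∈ complexLevel P M E) : 𝔐.frobComplex hC x ∈ complexLevel P M E := by
  refine AddSubgroup.closure_induction ?_ ?_ ?_ ?_ hx
  · rintro _ ⟨e, _, ⟨y, rfl⟩, rfl⟩
    rw [frobComplex_sepScalar_smul, 𝔐.frobComplex_localToComplex hL]
    exact AddSubgroup.subset_closure ⟨e ^ Fintype.card F, _, ⟨𝔐.frobLocal hL y, rfl⟩, rfl⟩
  · rw [map_zero]; exact zero_mem _
  · intro u v _ _ hu hv; rw [map_add]; exact add_mem hu hv
  · intro u _ hu; rw [map_neg]; exact neg_mem hu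

end AMotive

end Descent

/-! ### The Betti realization: finite level, the connecting homomorphism and exactness -/

section BettiDescent

variable {F K : Type*} [Field F] [Fintype F] [Field K] [Algebra F K] {P : ClosedPoint F K}
  {M : Type*} [AddCommGroup M] [Module ((CoordRing P) ⊗[F] K) M]

lemma ContH1.mk_eq_zero_iff {A G V : Type*} [CommRing A] [Group G]
    [TopologicalSpace G] [AddCommGroup V] [Module A V] (ρ : Representation A G V)
    (c : contCocycles ρ) :
    ContH1.mk ρ c = 0 ↔ ∃ v, ∀ σ, (c : G → V) σ = ρ σ v - v := by
  refine (Submodule.Quotient.mk_eq_zero _).trans ?_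
  rw [Submodule.mem_comap, LinearMap.mem_range]
  exact exists_congr fun v => ⟨fun h σ => (congrFun h σ).symm, fun h => funext fun σ => (h σ).symm⟩

namespace AMotive

variable (𝔐 : AMotive F (CoordRing P) K M) (hL : JInvertible F (CoordRing P) K (LocalField P))
  (hC : JInvertible F (CoordRing P) K (LocalComplex P))

lemma exists_dualFrame (𝔐 : AMotive F (CoordRing P) K M) :
    Nonempty (DualFrame ((CoordRing P) ⊗[F] K) M) := by
  have := 𝔐.finite
  have := 𝔐.projective
  exact nonempty_dualFrame _ M

/-- If `ξ` has an open stabiliser and `ξ - τ_M ξ` comes from `K_∞`, then `ξ` is of finite level. -/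
lemma exists_mem_complexLevel (hL : JInvertible F (CoordRing P) K (LocalField P))
    {ξ : ComplexMod P M} (hξ : ∃ E : LocalLevel P, ∀ σ, res E σ = 1 → galRep P M σ ξ = ξ)
    {f : LocalMod P M} (hf : 𝔐.idSubFrobComplex hC ξ = localToComplex P M f) :
    ∃ E, ξ ∈ complexLevel P M E := by
  obtain ⟨D⟩ := 𝔐.exists_dualFrame
  obtain ⟨E₀, hE₀⟩ := hξ
  obtain ⟨ε, hε, hlim⟩ : ∃ ε : ℝ, 0 < ε ∧ ∀ x : ComplexMod P M, complexNorm D x < ε →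
      Filter.Tendsto (fun k : ℕ => complexNorm D ((𝔐.frobComplex hC)^[k] x)) Filter.atTop
        (nhds 0) := 𝔐.exists_tendsto_frobTate_iterate D hC
  obtain ⟨E₁, n₀, hn₀, hlt⟩ := exists_mem_levelSpan_complexNorm_lt D ξ hε
  -- `ξ` is a fixed point of `x ↦ f + τ_M x`. Iterating this map from an approximation `n₀` of
  -- finite level never leaves the common level `E₀ ⊔ E₁`, and the error `τ_M^k (ξ - n₀)` tends to
  -- `0`.
  let n : ℕ → ComplexMod P M := fun k =>
    (fun x => localToComplex P M f + 𝔐.frobComplex hC x)^[k] n₀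
  have hsucc : ∀ k, n (k + 1) = localToComplex P M f + 𝔐.frobComplex hC (n k) := fun k =>
    Function.iterate_succ_apply' _ _ _
  have hmem : ∀ k, n k ∈ complexLevel P M (E₀ ⊔ E₁) := by
    intro k
    induction k with
    | zero => exact levelSpan_mono le_sup_right hn₀
    | succ k ih =>
      rw [hsucc]
      exact add_mem (le_levelSpan ⟨f, rfl⟩) (𝔐.frobComplex_mem_complexLevel hC hL ih)
  have hdiff : ∀ k, ξ - n k = (𝔐.frobComplex hC)^[k] (ξ - n₀) := by
    intro k
    induction k with
    | zero => rfl
    | succ k ih =>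
      rw [Function.iterate_succ_apply', ← ih, hsucc, ← hf, idSubFrobComplex_apply, map_sub]
      abel
  refine ⟨E₀ ⊔ E₁, mem_levelSpan_of_tendsto D
    (fun σ hσ => hE₀ σ (res_eq_one_of_le le_sup_left hσ)) hmem ?_⟩
  simp only [hdiff]
  exact hlim _ hlt

/-- `id - τ_M` commutes with `G_∞`, which fixes the image of `f`. -/
lemma sub_mem_betti {ξ : ComplexMod P M} {f : LocalMod P M}
    (hf : 𝔐.idSubFrobComplex hC ξ = localToComplex P M f) (σ : LocalGal P) :
    galRep P M σ ξ - ξ ∈ 𝔐.betti hC := by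
  rw [mem_betti_iff, map_sub, idSubFrobComplex_galRep, hf, galRep_localToComplex, sub_self]

/-- As the elements fixed by `τ_M` form a discrete subgroup, `ξ` has an open stabiliser as soon as
it is moved by elements fixed by `τ_M` only. -/
lemma exists_level_galRep_eq {ξ : ComplexMod P M}
    (hξ : ∀ σ, galRep P M σ ξ - ξ ∈ 𝔐.betti hC) :
    ∃ E : LocalLevel P, ∀ σ, res E σ = 1 → galRep P M σ ξ = ξ := by
  obtain ⟨D⟩ := 𝔐.exists_dualFrame
  obtain ⟨ε, hε, h⟩ := 𝔐.exists_eq_zero_of_norm_coord_lt D hC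
  obtain ⟨E, hE⟩ := exists_level_complexNorm_galRep_sub_lt D ξ hε
  exact ⟨E, fun σ hσ => sub_eq_zero.1 (h _ (hE σ hσ) (hξ σ))⟩

lemma isLocallyConstant_galRep {ξ : ComplexMod P M}
    (hξ : ∀ σ, galRep P M σ ξ - ξ ∈ 𝔐.betti hC) :
    IsLocallyConstant fun σ => galRep P M σ ξ := by
  obtain ⟨E, hE⟩ := 𝔐.exists_level_galRep_eq hC hξ
  exact isLocallyConstant_of_res E fun σ σ' h => map_eq_of_res_eq hE h

lemma isLocallyConstant_bettiRep (ω : 𝔐.betti hC) :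
    IsLocallyConstant fun σ : LocalGal P => 𝔐.bettiRep hC σ ω :=
  IsLocallyConstant.desc _ Subtype.val (𝔐.isLocallyConstant_galRep hC fun σ =>
    sub_mem (𝔐.galRep_mem_betti hC σ _ ω.2) ω.2) Subtype.val_injective

lemma exists_mem_complexLevel_of_mem_betti (hL : JInvertible F (CoordRing P) K (LocalField P))
    {ω : ComplexMod P M} (hω : ω ∈ 𝔐.betti hC) : ∃ E, ω ∈ complexLevel P M E :=
  𝔐.exists_mem_complexLevel hC hL (f := 0)
    (𝔐.exists_level_galRep_eq hC fun σ => sub_mem (𝔐.galRep_mem_betti hC σ _ hω) hω)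
    (((𝔐.mem_betti_iff hC ω).1 hω).trans (map_zero _).symm)

/-- An element fixed by `G_∞` with `ξ - τ_M ξ` coming from `K_∞` itself comes from `K_∞`. -/
lemma exists_localToComplex_eq (hL : JInvertible F (CoordRing P) K (LocalField P))
    {ξ : ComplexMod P M} (hξ : ∀ σ, galRep P M σ ξ = ξ) {f : LocalMod P M}
    (hf : 𝔐.idSubFrobComplex hC ξ = localToComplex P M f) :
    ∃ y, localToComplex P M y = ξ ∧ 𝔐.idSubFrobLocal hL y = f := by
  obtain ⟨D⟩ := 𝔐.exists_dualFrame
  obtain ⟨E, hE⟩ := 𝔐.exists_mem_complexLevel hC hL ⟨⊥, fun σ _ => hξ σ⟩ hf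
  obtain ⟨y, rfl⟩ := mem_of_mem_levelSpan_of_forall_map_eq isSemilinearRep_galRep
    isInvariantForm_localForm hE hξ
  refine ⟨y, rfl, localToComplex_injective D ?_⟩
  rw [← 𝔐.idSubFrobComplex_localToComplex hL hC, hf]

/-- By triviality every element is a sum of `s • ω` with `ω ∈ M_B`. On such terms `id - τ_M` acts as
`id - τ` on the coefficient, where `exists_sub_tateTau_eq` applies. -/
lemma idSubFrobComplex_surjective (h : 𝔐.IsRigidAnalyticallyTrivial hC) :
    Function.Surjective (𝔐.idSubFrobComplex hC) := by
  intro f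
  obtain ⟨t, rfl⟩ := h.2 f
  induction t using TensorProduct.induction_on with
  | zero => exact ⟨0, by rw [map_zero, map_zero]⟩
  | tmul s ω =>
    obtain ⟨u, rfl⟩ := exists_sub_tateTau_eq P (CoordRing P) s
    refine ⟨u • (ω : ComplexMod P M), ?_⟩
    rw [LinearMap.liftBaseChange_tmul, idSubFrobComplex_apply, frobComplex_smul,
      ← (𝔐.mem_betti hC).1 ω.2, sub_smul]
    rfl
  | add x y hx hy =>
    obtain ⟨u, hu⟩ := hx
    obtain ⟨v, hv⟩ := hy
    exact ⟨u + v, by rw [map_add, map_add, hu, hv]⟩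

/-- The cocycle `σ ↦ σ ξ - ξ`. -/
noncomputable def cocycle (ξ : ComplexMod P M) (hξ : ∀ σ, galRep P M σ ξ - ξ ∈ 𝔐.betti hC) :
    contCocycles (𝔐.bettiRep hC) :=
  ⟨fun σ => ⟨galRep P M σ ξ - ξ, hξ σ⟩,
    IsLocallyConstant.desc _ Subtype.val ((𝔐.isLocallyConstant_galRep hC hξ).comp (· - ξ))
      Subtype.val_injective,
    fun σ σ' => Subtype.ext <| by
      change galRep P M (σ * σ') ξ - ξ = galRep P M σ ξ - ξ + galRep P M σ (galRep P M σ' ξ - ξ)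
      rw [map_mul, Module.End.mul_apply, map_sub]
      abel⟩

/-- If the cocycle of `ξ` is the coboundary of `ω`, then `ξ - ω` is invariant, and conversely.
Subtracting `ω` leaves `ξ - τ_M ξ` unchanged, so this is the input for descending `ξ`. -/
lemma mk_cocycle_eq_zero_iff (ξ : ComplexMod P M)
    (hξ : ∀ σ, galRep P M σ ξ - ξ ∈ 𝔐.betti hC) :
    ContH1.mk (𝔐.bettiRep hC) (𝔐.cocycle hC ξ hξ) = 0 ↔
      ∃ ω ∈ 𝔐.betti hC, ∀ σ, galRep P M σ (ξ - ω) = ξ - ω := by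
  rw [ContH1.mk_eq_zero_iff]
  constructor
  · rintro ⟨ω, hω⟩
    refine ⟨ω, ω.2, fun σ => ?_⟩
    have h : galRep P M σ ξ - ξ = galRep P M σ ω - ω := congrArg Subtype.val (hω σ)
    rw [map_sub, sub_eq_sub_iff_sub_eq_sub, h]
  · rintro ⟨ω, hω, h⟩
    refine ⟨⟨ω, hω⟩, fun σ => Subtype.ext ?_⟩
    change galRep P M σ ξ - ξ = galRep P M σ ω - ω
    rw [← sub_eq_sub_iff_sub_eq_sub, ← map_sub, h]

/-- Two solutions differ by an element of `M_B`, whose coboundary is the difference of the cocycles.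
Hence `δ` does not depend on the chosen preimage, which yields both its linearity and its
description by any `ξ`. -/
lemma mk_cocycle_eq_of_idSubFrobComplex_eq {ξ ξ' : ComplexMod P M}
    (hξ : ∀ σ, galRep P M σ ξ - ξ ∈ 𝔐.betti hC)
    (hξ' : ∀ σ, galRep P M σ ξ' - ξ' ∈ 𝔐.betti hC)
    (h : 𝔐.idSubFrobComplex hC ξ = 𝔐.idSubFrobComplex hC ξ') :
    ContH1.mk (𝔐.bettiRep hC) (𝔐.cocycle hC ξ hξ) =
      ContH1.mk (𝔐.bettiRep hC) (𝔐.cocycle hC ξ' hξ') := by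
  rw [← sub_eq_zero, ← map_sub, ContH1.mk_eq_zero_iff]
  refine ⟨⟨ξ - ξ', by rw [mem_betti_iff, map_sub, h, sub_self]⟩, fun σ => Subtype.ext ?_⟩
  change (galRep P M σ ξ - ξ) - (galRep P M σ ξ' - ξ') = galRep P M σ (ξ - ξ') - (ξ - ξ')
  rw [map_sub]
  abel

/-- The connecting homomorphism. -/
noncomputable def connecting (hsurj : Function.Surjective (𝔐.idSubFrobComplex hC)) :
    LocalMod P M →ₗ[CoordRing P] ContH1 (𝔐.bettiRep hC) where
  toFun f := ContH1.mk (𝔐.bettiRep hC) (𝔐.cocycle hC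
    (Function.surjInv hsurj (localToComplex P M f))
    (𝔐.sub_mem_betti hC (Function.surjInv_eq hsurj _)))
  map_add' f g := by
    have h : ∀ f, 𝔐.idSubFrobComplex hC (Function.surjInv hsurj (localToComplex P M f)) =
      localToComplex P M f := fun f => Function.surjInv_eq hsurj _
    rw [← map_add]
    refine (𝔐.mk_cocycle_eq_of_idSubFrobComplex_eq hC
      (ξ' := Function.surjInv hsurj (localToComplex P M f) +
        Function.surjInv hsurj (localToComplex P M g)) _
      (𝔐.sub_mem_betti hC (f := f + g) (by rw [map_add, h, h, ← map_add]))
      (by rw [h, map_add, map_add, h, h])).trans (congrArg _ (Subtype.ext (funext fun σ =>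
        Subtype.ext ?_)))
    change galRep P M σ (_ + _) - (_ + _) = (galRep P M σ _ - _) + (galRep P M σ _ - _)
    rw [map_add]
    abel
  map_smul' a f := by
    have h : ∀ f, 𝔐.idSubFrobComplex hC (Function.surjInv hsurj (localToComplex P M f)) =
      localToComplex P M f := fun f => Function.surjInv_eq hsurj _
    rw [RingHom.id_apply, ← map_smul]
    refine (𝔐.mk_cocycle_eq_of_idSubFrobComplex_eq hC
      (ξ' := a • Function.surjInv hsurj (localToComplex P M f)) _
      (𝔐.sub_mem_betti hC (f := a • f) (by rw [map_smul, h, ← map_smul]))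
      (by rw [h, map_smul, map_smul, h])).trans (congrArg _ (Subtype.ext (funext fun σ =>
        Subtype.ext ?_)))
    change galRep P M σ (a • _) - a • _ = a • (galRep P M σ _ - _)
    rw [map_smul, smul_sub]

lemma connecting_eq (hsurj : Function.Surjective (𝔐.idSubFrobComplex hC)) {f : LocalMod P M}
    {ξ : ComplexMod P M} (hf : 𝔐.idSubFrobComplex hC ξ = localToComplex P M f) :
    𝔐.connecting hC hsurj f =
      ContH1.mk (𝔐.bettiRep hC) (𝔐.cocycle hC ξ (𝔐.sub_mem_betti hC hf)) :=
  𝔐.mk_cocycle_eq_of_idSubFrobComplex_eq hC _ _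
    ((Function.surjInv_eq hsurj _).trans hf.symm)

lemma exact_connecting (hsurj : Function.Surjective (𝔐.idSubFrobComplex hC)) :
    Function.Exact (𝔐.idSubFrobLocal hL) (𝔐.connecting hC hsurj) := by
  intro f
  constructor
  · intro hf
    obtain ⟨ξ, hξ⟩ := hsurj (localToComplex P M f)
    rw [𝔐.connecting_eq hC hsurj hξ, mk_cocycle_eq_zero_iff] at hf
    obtain ⟨ω, hω, h⟩ := hf
    obtain ⟨y, -, hy⟩ := 𝔐.exists_localToComplex_eq hC hL h (f := f)
      (by rw [map_sub, (𝔐.mem_betti_iff hC ω).1 hω, sub_zero, hξ])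
    exact ⟨y, hy⟩
  · rintro ⟨y, rfl⟩
    rw [𝔐.connecting_eq hC hsurj (𝔐.idSubFrobComplex_localToComplex hL hC y),
      mk_cocycle_eq_zero_iff]
    exact ⟨0, zero_mem _, fun σ => by rw [sub_zero, galRep_localToComplex]⟩

/-- A continuous cocycle vanishes on some `Gal(K_∞^s/E)`, so additive Hilbert 90 writes it as `σξ -
ξ` with `ξ` an explicit combination of its values. It remains to see that `ξ - τ_M ξ` is defined
over `K_∞`. -/
lemma connecting_surjective (hL : JInvertible F (CoordRing P) K (LocalField P))
    (hsurj : Function.Surjective (𝔐.idSubFrobComplex hC)) :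
    Function.Surjective (𝔐.connecting hC hsurj) := by
  intro h
  obtain ⟨⟨c, hc, hc'⟩, rfl⟩ := Submodule.Quotient.mk_surjective _ h
  have hcoc : ∀ σ σ', (c (σ * σ') : ComplexMod P M) = c σ + galRep P M σ (c σ') := fun σ σ' =>
    congrArg Subtype.val (hc' σ σ')
  have h1 : c 1 = 0 := by
    have := hc' 1 1
    rwa [mul_one, map_one, Module.End.one_apply, left_eq_add] at this
  obtain ⟨E, hE⟩ := exists_level_of_isLocallyConstant hc
  obtain ⟨z, hz⟩ := exists_map_sub_eq (E := E) (c := fun σ => (c σ : ComplexMod P M))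
    isSemilinearRep_galRep hcoc (fun σ hσ => by rw [hE σ hσ, h1]; rfl)
  set ξ : ComplexMod P M := -∑ γ : Gal(E/LocalField P),
    sepScalar P (γ z : E) • (c (lift E γ) : ComplexMod P M) with hξ
  -- The values of `c` lie in `M_B` and so have finite level, though not necessarily the level `E`
  -- on which `c` is trivial; hence a new level `E'`.
  have hsum : ∀ s : Finset Gal(E/LocalField P), ∃ E', ∑ γ ∈ s,
      sepScalar P (γ z : E) • (c (lift E γ) : ComplexMod P M) ∈ complexLevel P M E' := by
    classical
    intro s
    induction s using Finset.induction_on with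
    | empty => exact ⟨⊥, by rw [Finset.sum_empty]; exact zero_mem _⟩
    | insert γ s hγ ih =>
      rw [Finset.sum_insert hγ]
      exact exists_mem_levelSpan_add (exists_mem_levelSpan_smul _
        (𝔐.exists_mem_complexLevel_of_mem_betti hC hL (c _).2)) ih
  obtain ⟨E', hE'⟩ := hsum Finset.univ
  have hξE : ξ ∈ complexLevel P M E' := neg_mem hE'
  -- `ξ - τ_M ξ` has finite level, and it is invariant because `σξ - ξ = c σ` is killed by `id -
  -- τ_M`; so it descends.
  have hmem : 𝔐.idSubFrobComplex hC ξ ∈ localForm P M := by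
    refine mem_of_mem_levelSpan_of_forall_map_eq isSemilinearRep_galRep
      isInvariantForm_localForm (E := E')
      (sub_mem hξE (𝔐.frobComplex_mem_complexLevel hC hL hξE)) fun σ => ?_
    rw [← idSubFrobComplex_galRep, ← sub_eq_zero, ← map_sub, ← hz, ← mem_betti_iff]
    exact (c σ).2
  obtain ⟨f, hf⟩ := hmem
  refine ⟨f, (𝔐.connecting_eq hC hsurj (ξ := ξ) hf.symm).trans
    (congrArg (ContH1.mk (𝔐.bettiRep hC)) (Subtype.ext (funext fun σ => Subtype.ext ?_)))⟩
  exact (hz σ).symm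

lemma exists_localToComplex_eq_of_mem_invariants
    (hL : JInvertible F (CoordRing P) K (LocalField P)) (ω : (𝔐.bettiRep hC).invariants) :
    ∃ y, localToComplex P M y = (𝔐.betti hC).subtype ω ∧ 𝔐.idSubFrobLocal hL y = 0 :=
  𝔐.exists_localToComplex_eq hC hL (fun σ => congrArg Subtype.val (ω.2 σ))
    (((𝔐.mem_betti_iff hC _).1 (ω : 𝔐.betti hC).2).trans (map_zero _).symm)

/-- The inclusion of `M_B^+` in `M ⊗ K_∞⟨A⟩`. -/
noncomputable def invariantsToLocal (hL : JInvertible F (CoordRing P) K (LocalField P)) :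
    (𝔐.bettiRep hC).invariants →ₗ[CoordRing P] LocalMod P M :=
  -- The chosen preimages depend linearly on `ω` because `localToComplex` is injective.
  have hspec := fun ω => (𝔐.exists_localToComplex_eq_of_mem_invariants hC hL ω).choose_spec.1
  { toFun := fun ω => (𝔐.exists_localToComplex_eq_of_mem_invariants hC hL ω).choose
    map_add' := fun ω ω' => by
      obtain ⟨D⟩ := 𝔐.exists_dualFrame
      refine localToComplex_injective D ?_
      rw [map_add, hspec, hspec, hspec]
      rfl
    map_smul' := fun a ω => by
      obtain ⟨D⟩ := 𝔐.exists_dualFrame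
      refine localToComplex_injective D ?_
      rw [map_smul, hspec, hspec]
      rfl }

lemma localToComplex_invariantsToLocal (ω : (𝔐.bettiRep hC).invariants) :
    localToComplex P M (𝔐.invariantsToLocal hC hL ω) = (𝔐.betti hC).subtype ω :=
  (𝔐.exists_localToComplex_eq_of_mem_invariants hC hL ω).choose_spec.1

lemma invariantsToLocal_injective : Function.Injective (𝔐.invariantsToLocal hC hL) :=
  fun ω ω' h => by
    have := congrArg (localToComplex P M) h
    rw [localToComplex_invariantsToLocal, localToComplex_invariantsToLocal] at this
    exact Subtype.ext (Subtype.ext this)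

lemma exact_invariantsToLocal :
    Function.Exact (𝔐.invariantsToLocal hC hL) (𝔐.idSubFrobLocal hL) := by
  obtain ⟨D⟩ := 𝔐.exists_dualFrame
  intro y
  constructor
  · intro hy
    have hmem : localToComplex P M y ∈ 𝔐.betti hC := by
      rw [mem_betti_iff, idSubFrobComplex_localToComplex 𝔐 hL, hy, map_zero]
    refine ⟨⟨⟨_, hmem⟩, fun σ => Subtype.ext (galRep_localToComplex σ y)⟩,
      localToComplex_injective D ?_⟩
    rw [localToComplex_invariantsToLocal]
    rfl
  · rintro ⟨ω, rfl⟩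
    exact (𝔐.exists_localToComplex_eq_of_mem_invariants hC hL ω).choose_spec.2

end AMotive

end BettiDescent

end AMot

open AMot in
theorem mainTheorem8 {F K : Type*} [Field F] [Fintype F] [Field K] [Algebra F K]
    (hK : IsCurveFunctionField F K) (P : ClosedPoint F K)
    {M : Type*} [AddCommGroup M] [Module ((CoordRing P) ⊗[F] K) M]
    (𝔐 : AMotive F (CoordRing P) K M) :
    -- the ideal `𝔧` generates the unit ideal of `K_∞⟨A⟩` and of `ℂ_∞⟨A⟩`
    ∃ (hL : JInvertible F (CoordRing P) K (LocalField P))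
      (hC : JInvertible F (CoordRing P) K (LocalComplex P)),
      𝔐.IsRigidAnalyticallyTrivial hC →
        -- the short exact sequence of `A[G_∞]`-modules
        (Function.Injective (𝔐.betti hC).subtype ∧
          Function.Exact (𝔐.betti hC).subtype (𝔐.idSubFrobComplex hC) ∧
          Function.Surjective (𝔐.idSubFrobComplex hC) ∧
          (∀ (σ : LocalGal P) (ω : 𝔐.betti hC),
            (𝔐.betti hC).subtype (𝔐.bettiRep hC σ ω) =
              galRep P M σ ((𝔐.betti hC).subtype ω)) ∧
          (∀ (σ : LocalGal P) (f : ComplexMod P M),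
            𝔐.idSubFrobComplex hC (galRep P M σ f) =
              galRep P M σ (𝔐.idSubFrobComplex hC f))) ∧
        -- `G_∞` acts continuously on the discrete module `M_B`
        (∀ ω : 𝔐.betti hC, IsLocallyConstant fun σ : LocalGal P => 𝔐.bettiRep hC σ ω) ∧
        -- the induced exact sequence over `K_∞`, `δ` being the connecting homomorphism
        ∃ (i : (𝔐.bettiRep hC).invariants →ₗ[CoordRing P] LocalMod P M)
          (δ : LocalMod P M →ₗ[CoordRing P] ContH1 (𝔐.bettiRep hC)),
          (∀ ω : (𝔐.bettiRep hC).invariants, localToComplex P M (i ω) = (𝔐.betti hC).subtype ω) ∧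
          (∀ (f : LocalMod P M) (ξ : ComplexMod P M),
            𝔐.idSubFrobComplex hC ξ = localToComplex P M f →
              ∃ c : LocalGal P → 𝔐.betti hC,
                (∀ σ : LocalGal P, (𝔐.betti hC).subtype (c σ) = galRep P M σ ξ - ξ) ∧
                (δ f).IsClassOf c) ∧
          Function.Injective i ∧
          Function.Exact i (𝔐.idSubFrobLocal hL) ∧
          Function.Exact (𝔐.idSubFrobLocal hL) δ ∧
          Function.Surjective δ := by
  refine ⟨jInvertible_localField P hK, jInvertible_localComplex P hK, fun hrig => ?_⟩
  set hL := jInvertible_localField P hK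
  set hC := jInvertible_localComplex P hK
  have hsurj := 𝔐.idSubFrobComplex_surjective hC hrig
  refine ⟨⟨Subtype.val_injective, fun x => ?_, hsurj, fun σ ω => rfl,
    𝔐.idSubFrobComplex_galRep hC⟩, 𝔐.isLocallyConstant_bettiRep hC,
    𝔐.invariantsToLocal hC hL, 𝔐.connecting hC hsurj, 𝔐.localToComplex_invariantsToLocal hL hC,
    fun f ξ hf => ⟨(𝔐.cocycle hC ξ (𝔐.sub_mem_betti hC hf)).1, fun σ => rfl, Subtype.property _,
      𝔐.connecting_eq hC hsurj hf⟩, 𝔐.invariantsToLocal_injective hL hC,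
    𝔐.exact_invariantsToLocal hL hC, 𝔐.exact_connecting hL hC hsurj,
    𝔐.connecting_surjective hC hL hsurj⟩
  rw [← 𝔐.mem_betti_iff hC]
  exact ⟨fun h => ⟨⟨x, h⟩, rfl⟩, fun ⟨ω, h⟩ => h ▸ ω.2⟩
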